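/- **Virtual curve diagrams.** A virtual curve diagram (vcd) $D$ with $n$ curves consists of a finite set $P$ of points with two partial orders $<_P,<_C$ such that: (i) $(P,<_P)$ is the disjoint union of two chains, the upper points $U$ and the base points $B$, $|B|=n$; (ii) $(P,<_C)$ is the disjoint union of $n$ chains (curves) $a_0<_C a_1<_C\dots<_C a_r$, each with $r\ge 1$, $a_0\in B$ and $a_1,\dots,a_r\in U$; $a_r$ is the terminal point of the curve, the arcs $(a_{2k-1},a_{2k})$, $k\ge1$, are over arcs, the arcs $(a_{2k},a_{2k+1})$, $k\ge 1$, are under arcs, $(a_0,a_1)$ is the base arc, and $(a_{r-1},a_r)$ is the terminal arc; (iii) no two over arcs $(x,y),(z,w)$ satisfy $\min\{x,y\}<_P\min\{z,w\}<_P\max\{x,y\}<_P\max\{z,w\}$. Two upper points are adjacent if no point lies strictly between them for $<_P$. Equivalence of vcds is generated by order-preserving relabelling of points, $T$-moves (remove the endpoint $b$ of a terminal arc $(a,b)$ with $a,b$ adjacent upper points) and $B$-moves (for consecutive arcs $(a,b),(b,c),(c,d)$ with $b,c$ adjacent upper points, remove $b$ and $c$). A vcd is simplified if it has the least number of points in its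 equivalence class; every class contains a simplified representative, unique up to relabelling. **The action.** Let $\mathcal B_n$ be the classical braid group, with generators $\sigma_1,\dots,\sigma_{n-1}$ and relations $\sigma_i\sigma_j=\sigma_j\sigma_i$ for $|i-j|>1$ and $\sigma_i\sigma_{i+1}\sigma_i=\sigma_{i+1}\sigma_i\sigma_{i+1}$. It acts from the left on equivalence classes of vcds by pushing off: if $t_1<_P\dots<_P t_n$ are the terminal points, $\sigma_i$ moves the puncture $t_i$ above the upper line, over $t_{i+1}$, to the right of it, pulling along the strands in its way. Explicitly, every vcd is equivalent to one in which the terminal arc at $t_{i+1}$ is not an over arc, the terminal arc at $t_i$ is an over arc, and some set $S$ of consecutive upper points immediately to the left of $t_{i+1}$ consists of $t_i$ and the endpoints of a family of nested under arcs running around $t_i$; then $\sigma_i\cdot D$ is the class of the vcd obtained by moving $t_{i+1}$, in the order $<_P$, to the place immediately to the left of $S$, leaving $<_C$ unchanged. The generator $\sigma_i^{-1}$ acts by the inverse. **Proposition 3.1.** For every $n$ and every simplified vcd $D$ with $n$ curves there is a unique classical braid $\beta\in\mathcal B_n$ such that the simplified representative of $\beta^{-1}\cdot D$ has no terminal over arc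 (that is, no curve whose terminal arc is an over arc). -/

import Mathlib

/-- Virtual curve diagrams with `n` curves.  The base points form the chain `Fin n`.  The upper
points form a finite chain, realised as a finite set of points of the line `ℚ` (the "upper line");
every finite chain embeds in `ℚ`, and the choice of embedding is immaterial because relabelling is
one of the moves generating the equivalence below.  `curve j` is the list of the upper points
`a₁, a₂, …, a_r` (`r ≥ 1`) met successively by the curve that starts at the base point `a₀ = j`.
Hence the curve has the base arc `(a₀, a₁)`, the over arcs `(a₁, a₂), (a₃, a₄), …` and the under
arcs `(a₂, a₃), (a₄, a₅), …`; in the list (indexed from `0`) the over arcs start at even and the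
under arcs at odd indices. -/
structure VCD (n : ℕ) where
  curve : Fin n → List ℚ
  curve_ne_nil : ∀ j, curve j ≠ []
  /-- Every upper point occurs exactly once: on one curve, at one place. -/
  point_unique : ∀ (j k : Fin n) (a b : ℕ) (x : ℚ),
    (curve j)[a]? = some x → (curve k)[b]? = some x → j = k ∧ a = b
  /-- Over arcs do not intersect above the upper line. -/
  over_noncrossing : ∀ (j k : Fin n) (a b : ℕ) (x y z w : ℚ),
    (curve j)[2 * a]? = some x → (curve j)[2 * a + 1]? = some y →
    (curve k)[2 * b]? = some z → (curve k)[2 * b + 1]? = some w →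
    ¬ (min x y < min z w ∧ min z w < max x y ∧ max x y < max z w)

namespace VCD

variable {n : ℕ}

/-- The set of upper points. -/
def points (D : VCD n) : Set ℚ := {x | ∃ j, x ∈ D.curve j}

/-- The number of points (base points and upper points). -/
def numPoints (D : VCD n) : ℕ := n + ∑ j, (D.curve j).length

/-- `(x, y)` is an over arc, traversed from `x` to `y`. -/
def IsOverArc (D : VCD n) (x y : ℚ) : Prop :=
  ∃ (j : Fin n) (a : ℕ), (D.curve j)[2 * a]? = some x ∧ (D.curve j)[2 * a + 1]? = some y

/-- `(x, y)` is an under arc, traversed from `x` to `y`. -/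
def IsUnderArc (D : VCD n) (x y : ℚ) : Prop :=
  ∃ (j : Fin n) (a : ℕ), (D.curve j)[2 * a + 1]? = some x ∧ (D.curve j)[2 * a + 2]? = some y

/-- `t` is the terminal point of some curve. -/
def IsTerminal (D : VCD n) (t : ℚ) : Prop := ∃ j, (D.curve j).getLast? = some t

/-- Some curve of `D` ends with an over arc. -/
def HasTerminalOverArc (D : VCD n) : Prop := ∃ x t, D.IsOverArc x t ∧ D.IsTerminal t

/-- No point of `D` lies strictly between the upper points `x` and `y`. -/
def Adjacent (D : VCD n) (x y : ℚ) : Prop := ∀ z ∈ D.points, ¬ (min x y < z ∧ z < max x y)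

/-- `E` is obtained from `D` by relabelling the points. -/
def Relabel (D E : VCD n) : Prop :=
  ∃ f : ℚ → ℚ, StrictMonoOn f D.points ∧ ∀ j, E.curve j = (D.curve j).map f

/-- `E` is obtained from `D` by removing the end `b` of a terminal arc `(a, b)` with `a, b`
adjacent upper points. -/
def TMove (D E : VCD n) : Prop :=
  ∃ (j : Fin n) (L : List ℚ) (a b : ℚ), D.curve j = L ++ [a, b] ∧ D.Adjacent a b ∧
    E.curve = Function.update D.curve j (L ++ [a])

/-- `E` is obtained from `D` by removing `b, c` from three consecutive arcs
`(a, b), (b, c), (c, d)`, where `b, c` are adjacent upper points.  Here `a` is the last entry of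
`L`, or the base point `j` when `L` is empty, and `d` is the first entry of `R`. -/
def BMove (D E : VCD n) : Prop :=
  ∃ (j : Fin n) (L R : List ℚ) (b c : ℚ), D.curve j = L ++ b :: c :: R ∧ R ≠ [] ∧
    D.Adjacent b c ∧ E.curve = Function.update D.curve j (L ++ R)

/-- Equivalence of virtual curve diagrams: generated by relabellings, `T`-moves and `B`-moves. -/
def Equivalent : VCD n → VCD n → Prop :=
  Relation.EqvGen fun D E => D.Relabel E ∨ D.TMove E ∨ D.BMove E

/-- `D` has the least number of points in its equivalence class. -/
def IsSimplified (D : VCD n) : Prop := ∀ E, Equivalent D E → D.numPoints ≤ E.numPoints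

/-- The pushing off of the generator `σ_i` on a diagram in suitable position: the `i`-th puncture
is moved over the `(i+1)`-st one to its right, pulling along the strands in its way.

Let `p` be the `i`-th and `q` the `(i+1)`-st terminal point (counted from `0`, left to right).
The position required of `D` is the following.
* The arc terminating at `q` is not an over arc.
* The arc terminating at `p` is an over arc, and the points of `D` between some place `q'` on the
  upper line (`q' < p`) and `q` are `p` together with the endpoints of a family of nested under
  arcs running around `p`.  These are the strands that are dragged along with `p`.
Moving this whole family, held above everything else, across `q` amounts to changing the order on
the upper line so that `q` passes underneath it, from its right to its left, to the place `q'`.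
Up to equivalence every diagram can be put in such a position. -/
def SigmaStep (i : Fin (n - 1)) (D E : VCD n) : Prop :=
  ∃ (j : Fin n) (L : List ℚ) (p q q' : ℚ),
    D.curve j = L ++ [q] ∧ Even L.length ∧ q' < p ∧ p < q ∧
    D.IsTerminal p ∧ {t | D.IsTerminal t ∧ t < p}.ncard = i.val ∧ (∃ x, D.IsOverArc x p) ∧
    (∀ t, D.IsTerminal t → q' < t → t < q → t = p) ∧
    (∀ x ∈ D.points, q' < x → x < q → x ≠ p →
      ∃ y, (D.IsUnderArc x y ∨ D.IsUnderArc y x) ∧ q' < y ∧ y < q ∧ min x y < p ∧ p < max x y) ∧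
    (∀ x y z w, (D.IsUnderArc x y ∨ D.IsUnderArc y x) → (D.IsUnderArc z w ∨ D.IsUnderArc w z) →
      q' < x → x < z → z < p → p < y → y < q → p < w → w < q → w < y) ∧
    E.curve = Function.update D.curve j (L ++ [q'])

end VCD

/-- The defining relations of the braid group on `n` strands; the generators are
`σ_0, …, σ_{n-2}`. -/
def braidRelations (n : ℕ) : Set (FreeGroup (Fin (n - 1))) :=
  {r | ∃ i j : Fin (n - 1),
    ((i.val + 1 < j.val ∨ j.val + 1 < i.val) ∧
      r = FreeGroup.of i * FreeGroup.of j * (FreeGroup.of j * FreeGroup.of i)⁻¹) ∨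
    (j.val = i.val + 1 ∧
      r = FreeGroup.of i * FreeGroup.of j * FreeGroup.of i *
        (FreeGroup.of j * FreeGroup.of i * FreeGroup.of j)⁻¹)}

/-- The classical braid group on `n` strands. -/
abbrev BraidGroup (n : ℕ) : Type := PresentedGroup (braidRelations n)

/-- The generator `σ_i` of the braid group. -/
def BraidGroup.sigma {n : ℕ} (i : Fin (n - 1)) : BraidGroup n := PresentedGroup.of i

/-- `Represents β D E` says that the diagram `E` represents the class `β · D`, for the left action
of the braid group on equivalence classes of virtual curve diagrams: `E` is reached from `D` by
performing, up to equivalence, the pushing off of the letters of a word for `β`, the last letter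
first.  The pushing off of `σ_i⁻¹` undoes that of `σ_i`. -/
inductive Represents {n : ℕ} : BraidGroup n → VCD n → VCD n → Prop
  | equivalent {D E : VCD n} : VCD.Equivalent D E → Represents 1 D E
  | sigma {β : BraidGroup n} {D E E' F F' : VCD n} (i : Fin (n - 1)) :
      Represents β D E → VCD.Equivalent E E' → VCD.SigmaStep i E' F' → VCD.Equivalent F' F →
      Represents (BraidGroup.sigma i * β) D F
  | sigma_inv {β : BraidGroup n} {D E E' F F' : VCD n} (i : Fin (n - 1)) :
      Represents β D E → VCD.Equivalent E E' → VCD.SigmaStep i F' E' → VCD.Equivalent F' F →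
      Represents ((BraidGroup.sigma i)⁻¹ * β) D F

/-!
Let `e_m` be the letter of the gap of the upper line with exactly `m` terminal points to its left,
and let a path that crosses the line downwards in this gap read `e_m`, upwards `e_m⁻¹`. A curve of a
diagram then has a holonomy, an element of the free group on the letters, at each of its points, and
a *loop*, which follows the curve to its terminal point, runs around this puncture and returns. The
points with their holonomies, without the ends of terminal over arcs, form the *configuration* of
the diagram. Two adjacent points of a configuration that are consecutive on a curve and have the
same holonomy may be removed. This rewriting is confluent, so an equivalence class of configurations
has at most one irreducible member, up to moving points (`Config.Eqv.exists_reposition_of_irreducible`).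

*Invariance.* Equivalent diagrams have equivalent configurations and the same loops
(`VCD.sameInv_of_equivalent`), and the pushing off of `σ_i` transforms the holonomies and the loops
by the Artin automorphism `e_{i+1} ↦ e_{i+2} e_{i+1}⁻¹ e_i` (`VCD.sigmaStep_conf`): the nested
strands that are dragged along are removable on both sides.

*Uniqueness.* The configuration of a simplified diagram without terminal over arcs is irreducible.
So if two such diagrams differ by a braid `β`, the positions of the terminal points and the
holonomies at them correspond to each other, and the comparison of the loops shows that `β` fixes
each `e_m⁻¹ e_{m+1}` (`VCD.eq_one_of_represents`). Since the Artin action is faithful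
(`BraidGroup.artin_injective`), `β = 1`. The faithfulness is proved by induction on the number of
strands: a braid is factored into one on fewer strands, loops of the last strand around the others,
and a coset representative, which can be recovered from the action after filling in a puncture.

*Independence of the simplified representative.* Over arcs of a simplified diagram pass over
terminal points (`VCD.IsSimplified.exists_terminal`), and the same holds for the pairs that are
removable from its configuration. So the word read along a curve between points that survive is
reduced. If a curve ended with an over arc, its loop seen from its last surviving point would be a
longer reduced word than for a diagram without terminal over arcs with the same invariants
(`VCD.not_hasTerminalOverArc`).

*Existence.* If there is a terminal over arc, its puncture can be pushed back along an innermost one,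
over the punctures on the way and dragging along the strands on the way, until the arc disappears;
all the points created by dragging disappear as well, at the latest at the start of the arc
(`VCD.Sliding.exists_represents`). So a diagram with the least number of points in the orbit has no
terminal over arc (`VCD.exists_represents_numPoints_lt`).
-/

/-! ### The Artin action of the braid group on a free group -/

namespace BraidGroup

open FreeGroup (of)

/-- The substitution `e_{i+1} ↦ e_{i+2} e_{i+1}⁻¹ e_i` on the free group on letters `e_0, e_1, …`,
where `e_m` stands for crossing the upper line in the gap with exactly `m` punctures to its left. -/
def artinHom (i : ℕ) : FreeGroup ℕ →* FreeGroup ℕ :=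
  FreeGroup.lift fun m => if m = i + 1 then of (i + 2) * (of (i + 1))⁻¹ * of i else of m

/-- The substitution `e_{i+1} ↦ e_i e_{i+1}⁻¹ e_{i+2}`, inverse to `artinHom i`. -/
def artinInvHom (i : ℕ) : FreeGroup ℕ →* FreeGroup ℕ :=
  FreeGroup.lift fun m => if m = i + 1 then of i * (of (i + 1))⁻¹ * of (i + 2) else of m

theorem artinHom_self (i : ℕ) :
    artinHom i (of (i + 1)) = of (i + 2) * (of (i + 1))⁻¹ * of i := by
  simp [artinHom]

theorem artinHom_of_ne {i m : ℕ} (h : m ≠ i + 1) : artinHom i (of m) = of m := by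
  simp [artinHom, h]

theorem artinInvHom_self (i : ℕ) :
    artinInvHom i (of (i + 1)) = of i * (of (i + 1))⁻¹ * of (i + 2) := by
  simp [artinInvHom]

theorem artinInvHom_of_ne {i m : ℕ} (h : m ≠ i + 1) : artinInvHom i (of m) = of m := by
  simp [artinInvHom, h]

/-- The automorphism `e_{i+1} ↦ e_{i+2} e_{i+1}⁻¹ e_i` of the free group. -/
def artinAut (i : ℕ) : MulAut (FreeGroup ℕ) :=
  MonoidHom.toMulEquiv (artinHom i) (artinInvHom i)
    (by
      ext m
      by_cases h : m = i + 1
      · subst h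
        simp only [MonoidHom.comp_apply, artinHom_self, map_mul, map_inv, artinInvHom_self,
          artinInvHom_of_ne (show i + 2 ≠ i + 1 by omega),
          artinInvHom_of_ne (show i ≠ i + 1 by omega), MonoidHom.id_apply]
        group
      · simp only [MonoidHom.comp_apply, artinHom_of_ne h, artinInvHom_of_ne h,
          MonoidHom.id_apply])
    (by
      ext m
      by_cases h : m = i + 1
      · subst h
        simp only [MonoidHom.comp_apply, artinInvHom_self, map_mul, map_inv, artinHom_self,
          artinHom_of_ne (show i + 2 ≠ i + 1 by omega),
          artinHom_of_ne (show i ≠ i + 1 by omega), MonoidHom.id_apply]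
        group
      · simp only [MonoidHom.comp_apply, artinHom_of_ne h, artinInvHom_of_ne h,
          MonoidHom.id_apply])

theorem artinAut_self (i : ℕ) :
    artinAut i (of (i + 1)) = of (i + 2) * (of (i + 1))⁻¹ * of i := artinHom_self i

theorem artinAut_of_ne {i m : ℕ} (h : m ≠ i + 1) : artinAut i (of m) = of m := artinHom_of_ne h

theorem mulAut_ext {f g : MulAut (FreeGroup ℕ)} (h : ∀ m, f (of m) = g (of m)) : f = g := by
  have : f.toMonoidHom = g.toMonoidHom := FreeGroup.ext_hom _ _ h
  ext x
  exact DFunLike.congr_fun this x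

theorem artinAut_comm {i j : ℕ} (h : i + 1 < j) :
    artinAut i * artinAut j = artinAut j * artinAut i := by
  apply mulAut_ext
  intro m
  simp only [MulAut.mul_apply]
  by_cases hi : m = i + 1
  · subst hi
    rw [artinAut_of_ne (show i + 1 ≠ j + 1 by omega), artinAut_self]
    simp only [map_mul, map_inv]
    rw [artinAut_of_ne (show i + 1 ≠ j + 1 by omega), artinAut_of_ne (show i + 2 ≠ j + 1 by omega),
      artinAut_of_ne (show i ≠ j + 1 by omega)]
  · by_cases hj : m = j + 1
    · subst hj
      rw [artinAut_of_ne hi, artinAut_self]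
      simp only [map_mul, map_inv]
      rw [artinAut_of_ne hi, artinAut_of_ne (show j + 2 ≠ i + 1 by omega),
        artinAut_of_ne (show j ≠ i + 1 by omega)]
    · rw [artinAut_of_ne hi, artinAut_of_ne hj, artinAut_of_ne hi]

theorem artinAut_braid (i : ℕ) :
    artinAut i * artinAut (i + 1) * artinAut i =
      artinAut (i + 1) * artinAut i * artinAut (i + 1) := by
  apply mulAut_ext
  intro m
  simp only [MulAut.mul_apply]
  have a0 : artinAut i (of i) = of i := artinAut_of_ne (by omega)
  have a1 := artinAut_self i
  have a2 : artinAut i (of (i + 2)) = of (i + 2) := artinAut_of_ne (by omega)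
  have a3 : artinAut i (of (i + 3)) = of (i + 3) := artinAut_of_ne (by omega)
  have b3 : artinAut (i + 1) (of (i + 3)) = of (i + 3) := artinAut_of_ne (by omega)
  have b0 : artinAut (i + 1) (of i) = of i := artinAut_of_ne (by omega)
  have b1 : artinAut (i + 1) (of (i + 1)) = of (i + 1) := artinAut_of_ne (by omega)
  have b2 : artinAut (i + 1) (of (i + 2)) = of (i + 3) * (of (i + 2))⁻¹ * of (i + 1) :=
    artinAut_self (i + 1)
  by_cases h1 : m = i + 1
  · subst h1
    simp only [a0, a1, a2, a3, b0, b1, b2, map_mul, map_inv]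
    group
  · by_cases h2 : m = i + 2
    · subst h2
      simp only [a1, a2, a3, b0, b1, b2, b3, map_mul, map_inv]
      group
    · rw [artinAut_of_ne h1, artinAut_of_ne (show m ≠ i + 1 + 1 by omega), artinAut_of_ne h1,
        artinAut_of_ne (show m ≠ i + 1 + 1 by omega)]

/-- The Artin action of the braid group, in the letters `e_m`. -/
def artin (n : ℕ) : BraidGroup n →* MulAut (FreeGroup ℕ) :=
  PresentedGroup.toGroup (f := fun i : Fin (n - 1) => artinAut i.val) (by
    rintro r ⟨i, j, ⟨h, rfl⟩ | ⟨h, rfl⟩⟩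
    · simp only [map_mul, map_inv, FreeGroup.lift_apply_of]
      rw [mul_inv_eq_one]
      rcases h with h | h
      · exact artinAut_comm h
      · exact (artinAut_comm h).symm
    · simp only [map_mul, map_inv, FreeGroup.lift_apply_of]
      rw [mul_inv_eq_one, h]
      exact artinAut_braid i.val)

theorem artin_sigma {n : ℕ} (i : Fin (n - 1)) : artin n (sigma i) = artinAut i.val :=
  PresentedGroup.toGroup.of _

/-! ### Faithfulness of the Artin action -/

/-- The generator `σ_i`, extended by `1` to all natural numbers `i`. -/
def gen (n i : ℕ) : BraidGroup n := if h : i < n - 1 then sigma ⟨i, h⟩ else 1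

theorem artin_gen {n i : ℕ} (h : i < n - 1) : artin n (gen n i) = artinAut i := by
  rw [gen, dif_pos h, artin_sigma]

theorem gen_comm {n i j : ℕ} (h : i + 1 < j) : gen n i * gen n j = gen n j * gen n i := by
  unfold gen
  split_ifs with h1 h2
  · have := PresentedGroup.mk_eq_mk_of_mul_inv_mem (rels := braidRelations n)
      (x := of (⟨i, h1⟩ : Fin (n - 1)) * of ⟨j, h2⟩) (y := of ⟨j, h2⟩ * of ⟨i, h1⟩)
      ⟨⟨i, h1⟩, ⟨j, h2⟩, Or.inl ⟨Or.inl h, rfl⟩⟩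
    simp only [map_mul] at this
    exact this
  all_goals simp

theorem gen_braid {n i : ℕ} (h : i + 1 < n - 1) :
    gen n i * gen n (i + 1) * gen n i = gen n (i + 1) * gen n i * gen n (i + 1) := by
  have h0 : i < n - 1 := by omega
  rw [gen, gen, dif_pos h, dif_pos h0]
  have := PresentedGroup.mk_eq_mk_of_mul_inv_mem (rels := braidRelations n)
    (x := of (⟨i, h0⟩ : Fin (n - 1)) * of ⟨i + 1, h⟩ * of ⟨i, h0⟩)
    (y := of ⟨i + 1, h⟩ * of ⟨i, h0⟩ * of ⟨i + 1, h⟩)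
    ⟨⟨i, h0⟩, ⟨i + 1, h⟩, Or.inr ⟨rfl, rfl⟩⟩
  simp only [map_mul] at this
  exact this

/-- The subgroup of braids on the strands `0, …, k`, generated by `σ_0, …, σ_{k-1}`. -/
def firstStrands (n k : ℕ) : Subgroup (BraidGroup n) := Subgroup.closure {g | ∃ i < k, g = gen n i}

theorem gen_mem {n i k : ℕ} (h : i < k) : gen n i ∈ firstStrands n k :=
  Subgroup.subset_closure ⟨i, h, rfl⟩

/-- `cosetRep n k d = σ_k σ_{k-1} ⋯ σ_{k+1-d}`, with `d` factors: it brings the strand `k + 1 - d`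
to the last place `k + 1`. -/
def cosetRep (n k : ℕ) : ℕ → BraidGroup n
  | 0 => 1
  | d + 1 => cosetRep n k d * gen n (k - d)

/-- `loopGen n k d` carries the last strand `k + 1` once around the strand `k - d`. -/
def loopGen (n k d : ℕ) : BraidGroup n :=
  cosetRep n k d * (gen n (k - d) * gen n (k - d)) * (cosetRep n k d)⁻¹

/-- The subgroup generated by the loops of the last strand around the others. -/
def loops (n k : ℕ) : Subgroup (BraidGroup n) :=
  Subgroup.closure {g | ∃ d ≤ k, g = loopGen n k d}

theorem loopGen_mem {n k d : ℕ} (h : d ≤ k) : loopGen n k d ∈ loops n k :=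
  Subgroup.subset_closure ⟨d, h, rfl⟩

theorem gen_mul_cosetRep_of_lt {n k d i : ℕ} (hd : d ≤ k) (h : i + d < k) :
    gen n i * cosetRep n k d = cosetRep n k d * gen n i := by
  induction d with
  | zero => simp [cosetRep]
  | succ d ih =>
    rw [cosetRep, ← mul_assoc, ih (by omega) (by omega), mul_assoc, mul_assoc,
      gen_comm (show i + 1 < k - d by omega)]

theorem gen_mul_cosetRep_of_ge {n k d i : ℕ} (hk : k < n - 1) (hd : d ≤ k + 1) (hi : i < k)
    (h : k + 1 ≤ i + d) : gen n i * cosetRep n k d = cosetRep n k d * gen n (i + 1) := by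
  induction d with
  | zero => omega
  | succ d ih =>
    by_cases hid : k + 1 ≤ i + d
    · rw [cosetRep, ← mul_assoc, ih (by omega) hid, mul_assoc, mul_assoc,
        gen_comm (show k - d + 1 < i + 1 by omega)]
    · obtain ⟨d, rfl⟩ : ∃ d', d = d' + 1 := ⟨d - 1, by omega⟩
      have e : k - d = i + 1 := by omega
      have e' : k - (d + 1) = i := by omega
      rw [cosetRep, cosetRep, e, e', ← mul_assoc, ← mul_assoc,
        gen_mul_cosetRep_of_lt (show d ≤ k by omega) (by omega)]
      have := gen_braid (n := n) (i := i) (by omega)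
      simp only [mul_assoc] at this ⊢
      rw [this]

/-- Conjugation by `σ_i` moves each loop to a neighbouring one, up to a conjugation by a loop. -/
theorem conj_loopGen {n k d i : ℕ} (hk : k < n - 1) (hd : d ≤ k) (hi : i < k) :
    gen n i * loopGen n k d * (gen n i)⁻¹ ∈ loops n k ∧
      (gen n i)⁻¹ * loopGen n k d * gen n i ∈ loops n k := by
  have key : ∀ c, c + 1 ≤ k → k - (c + 1) = i →
      gen n i * loopGen n k (c + 1) * (gen n i)⁻¹ = loopGen n k c ∧
      gen n i * loopGen n k c * (gen n i)⁻¹ =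
        (loopGen n k c)⁻¹ * loopGen n k (c + 1) * loopGen n k c := by
    intro c hc hci
    have e : k - c = i + 1 := by omega
    have hcomm := gen_mul_cosetRep_of_lt (n := n) (k := k) (d := c) (i := i) (by omega) (by omega)
    have hcomm' : (gen n i) * (cosetRep n k c) * (gen n i)⁻¹ = cosetRep n k c := by
      rw [hcomm]; group
    have hb := gen_braid (n := n) (i := i) (by omega)
    set s := gen n i
    set t := gen n (i + 1)
    set w := cosetRep n k c
    have hx : t⁻¹ * (s * t) = s * t * s⁻¹ := by
      rw [inv_mul_eq_iff_eq_mul, ← mul_assoc, eq_mul_inv_iff_mul_eq, ← mul_assoc, hb]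
    have hy : t * s * t⁻¹ = s⁻¹ * (t * s) := by
      rw [eq_inv_mul_iff_mul_eq, ← mul_assoc, mul_inv_eq_iff_eq_mul, ← mul_assoc, hb]
    have h1 : s * (t * (s * s) * t⁻¹) * s⁻¹ = t * t := by
      calc _ = s * ((t * s * t⁻¹) * (t * s * t⁻¹)) * s⁻¹ := by group
        _ = _ := by rw [hy]; group
    have h4 : s * (t * t) * s⁻¹ = (t * t)⁻¹ * (t * (s * s) * t⁻¹) * (t * t) := by
      calc _ = (s * t * s⁻¹) * (s * t * s⁻¹) := by group
        _ = (t⁻¹ * (s * t)) * (t⁻¹ * (s * t)) := by rw [hx]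
        _ = _ := by group
    have hl1 : loopGen n k (c + 1) = w * (t * (s * s) * t⁻¹) * w⁻¹ := by
      simp only [loopGen, cosetRep, hci, e, mul_inv_rev, mul_assoc, s, t, w]
    have hl0 : loopGen n k c = w * (t * t) * w⁻¹ := by simp only [loopGen, e, t, w]
    have hconj : ∀ y, s * (w * y * w⁻¹) * s⁻¹ = w * (s * y * s⁻¹) * w⁻¹ := by
      intro y
      calc _ = (s * w) * y * (s * w)⁻¹ := by group
        _ = (w * s) * y * (w * s)⁻¹ := by rw [hcomm]
        _ = _ := by group
    constructor
    · rw [hl1, hl0, hconj, h1]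
    · rw [hl1, hl0, hconj, h4]; group
  by_cases h0 : k - d = i
  · obtain ⟨c, rfl⟩ : ∃ c, d = c + 1 := ⟨d - 1, by omega⟩
    obtain ⟨h1, h2⟩ := key c hd h0
    refine ⟨h1 ▸ loopGen_mem (by omega), ?_⟩
    have : (gen n i)⁻¹ * loopGen n k (c + 1) * gen n i =
        loopGen n k (c + 1) * loopGen n k c * (loopGen n k (c + 1))⁻¹ := by
      have h3 : loopGen n k c = (gen n i) * (loopGen n k (c + 1)) * (gen n i)⁻¹ := h1.symm
      have h5 : loopGen n k (c + 1) = loopGen n k c * (gen n i * loopGen n k c * (gen n i)⁻¹) *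
          (loopGen n k c)⁻¹ := by rw [h2]; group
      have h6 : (gen n i)⁻¹ * loopGen n k c * gen n i = loopGen n k (c + 1) := by
        rw [h3]; group
      calc _ = ((gen n i)⁻¹ * loopGen n k c * gen n i) * loopGen n k c *
          ((gen n i)⁻¹ * loopGen n k c * gen n i)⁻¹ := by
            nth_rw 1 [h5]; group
        _ = _ := by rw [h6]
    rw [this]
    exact mul_mem (mul_mem (loopGen_mem hd) (loopGen_mem (by omega))) (inv_mem (loopGen_mem hd))
  by_cases h1 : k - d = i + 1
  · obtain ⟨h1, h2⟩ := key d (by omega) (by omega)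
    refine ⟨?_, ?_⟩
    · rw [h2]
      exact mul_mem (mul_mem (inv_mem (loopGen_mem hd)) (loopGen_mem (by omega))) (loopGen_mem hd)
    · rw [← h1]
      have : (gen n i)⁻¹ * (gen n i * loopGen n k (d + 1) * (gen n i)⁻¹) * gen n i =
        loopGen n k (d + 1) := by group
      rw [this]
      exact loopGen_mem (by omega)
  · have hc : gen n i * loopGen n k d = loopGen n k d * gen n i := by
      have h2 : ∃ j, gen n i * cosetRep n k d = cosetRep n k d * gen n j ∧
          gen n j * gen n (k - d) = gen n (k - d) * gen n j := by
        by_cases h : i + d < k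
        · exact ⟨i, gen_mul_cosetRep_of_lt hd h, gen_comm (by omega)⟩
        · exact ⟨i + 1, gen_mul_cosetRep_of_ge hk (by omega) hi (by omega),
            (gen_comm (by omega)).symm⟩
      obtain ⟨j, hj, hj'⟩ := h2
      have hj2 : gen n j * (cosetRep n k d)⁻¹ = (cosetRep n k d)⁻¹ * gen n i := by
        rw [eq_inv_mul_iff_mul_eq, ← mul_assoc, ← hj]; group
      unfold loopGen
      calc _ = (gen n i * cosetRep n k d) * (gen n (k - d) * gen n (k - d)) *
            (cosetRep n k d)⁻¹ := by group
        _ = cosetRep n k d * (gen n j * gen n (k - d)) * gen n (k - d) *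
            (cosetRep n k d)⁻¹ := by rw [hj]; group
        _ = cosetRep n k d * gen n (k - d) * (gen n j * gen n (k - d)) *
            (cosetRep n k d)⁻¹ := by rw [hj']; simp only [mul_assoc, hj']
        _ = cosetRep n k d * (gen n (k - d) * gen n (k - d)) *
            (gen n j * (cosetRep n k d)⁻¹) := by rw [hj']; simp only [mul_assoc]
        _ = _ := by rw [hj2]; simp only [mul_assoc]
    refine ⟨?_, ?_⟩
    · rw [hc, mul_assoc, mul_inv_cancel, mul_one]; exact loopGen_mem hd
    · rw [mul_assoc, ← hc, ← mul_assoc, inv_mul_cancel, one_mul]; exact loopGen_mem hd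

theorem conj_mem_loops {n k i : ℕ} (hk : k < n - 1) (hi : i < k) {a : BraidGroup n}
    (ha : a ∈ loops n k) :
    gen n i * a * (gen n i)⁻¹ ∈ loops n k ∧ (gen n i)⁻¹ * a * gen n i ∈ loops n k := by
  constructor
  · have : loops n k ≤ (loops n k).comap (MulAut.conj (gen n i)).toMonoidHom := by
      rw [loops, Subgroup.closure_le]
      rintro _ ⟨d, hd, rfl⟩
      exact (conj_loopGen hk hd hi).1
    exact this ha
  · have : loops n k ≤ (loops n k).comap (MulAut.conj (gen n i)⁻¹).toMonoidHom := by
      rw [loops, Subgroup.closure_le]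
      rintro _ ⟨d, hd, rfl⟩
      have := (conj_loopGen hk hd hi).2
      simpa [loops] using this
    simpa using this ha

/-- Every braid on the strands `0, …, k + 1` factors as a braid on `0, …, k`, a product of loops of
the last strand, and a coset representative: the products of this shape contain `1` and are stable
under right multiplication by the generators and their inverses. -/
theorem exists_factorization {n k : ℕ} (hk : k < n - 1) {g : BraidGroup n}
    (hg : g ∈ firstStrands n (k + 1)) :
    ∃ h ∈ firstStrands n k, ∃ a ∈ loops n k, ∃ d ≤ k + 1, g = h * a * cosetRep n k d := by
  have step : ∀ h ∈ firstStrands n k, ∀ a ∈ loops n k, ∀ d ≤ k + 1, ∀ i < k + 1, 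
      (∃ h' ∈ firstStrands n k, ∃ a' ∈ loops n k, ∃ d' ≤ k + 1,
        h * a * cosetRep n k d * gen n i = h' * a' * cosetRep n k d') ∧
      (∃ h' ∈ firstStrands n k, ∃ a' ∈ loops n k, ∃ d' ≤ k + 1,
        h * a * cosetRep n k d * (gen n i)⁻¹ = h' * a' * cosetRep n k d') := by
    intro h hh a ha d hd i hi
    by_cases e1 : i + d = k
    · have e : k - d = i := by omega
      have hm : loopGen n k d ∈ loops n k := loopGen_mem (by omega)
      refine ⟨⟨h, hh, a, ha, d + 1, by omega, by rw [cosetRep, e, mul_assoc]⟩,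
        ⟨h, hh, a * (loopGen n k d)⁻¹, mul_mem ha (inv_mem hm), d + 1, by omega, ?_⟩⟩
      rw [loopGen, cosetRep, e]; group
    by_cases e2 : i + d = k + 1
    · obtain ⟨c, rfl⟩ : ∃ c, d = c + 1 := ⟨d - 1, by omega⟩
      have e : k - c = i := by omega
      have hm : loopGen n k c ∈ loops n k := loopGen_mem (by omega)
      refine ⟨⟨h, hh, a * loopGen n k c, mul_mem ha hm, c, by omega, ?_⟩,
        ⟨h, hh, a, ha, c, by omega, ?_⟩⟩
      · rw [loopGen, cosetRep, e]; group
      · rw [cosetRep, e]; group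
    · have h2 : ∃ j < k, gen n j * cosetRep n k d = cosetRep n k d * gen n i := by
        by_cases h : i + d < k
        · exact ⟨i, by omega, gen_mul_cosetRep_of_lt (by omega) h⟩
        · refine ⟨i - 1, by omega, ?_⟩
          have := gen_mul_cosetRep_of_ge (n := n) hk hd (show i - 1 < k by omega) (by omega)
          rwa [show i - 1 + 1 = i by omega] at this
      obtain ⟨j, hj, hj'⟩ := h2
      have hj2 : (gen n j)⁻¹ * cosetRep n k d = cosetRep n k d * (gen n i)⁻¹ := by
        rw [eq_mul_inv_iff_mul_eq, mul_assoc, ← hj']; group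
      refine ⟨⟨h * gen n j, mul_mem hh (gen_mem hj), (gen n j)⁻¹ * a * gen n j,
        (conj_mem_loops hk hj ha).2, d, hd, ?_⟩, ⟨h * (gen n j)⁻¹, mul_mem hh (inv_mem (gen_mem hj)),
          gen n j * a * (gen n j)⁻¹, (conj_mem_loops hk hj ha).1, d, hd, ?_⟩⟩
      · rw [mul_assoc, ← hj']; group
      · rw [mul_assoc, ← hj2]; group
  induction hg using Subgroup.closure_induction_right with
  | one => exact ⟨1, one_mem _, 1, one_mem _, 0, by omega, by simp [cosetRep]⟩
  | mul_right x _ y hy ih =>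
    obtain ⟨i, hi, rfl⟩ := hy
    obtain ⟨h, hh, a, ha, d, hd, rfl⟩ := ih
    exact (step h hh a ha d hd i hi).1
  | mul_inv_cancel x _ y hy ih =>
    obtain ⟨i, hi, rfl⟩ := hy
    obtain ⟨h, hh, a, ha, d, hd, rfl⟩ := ih
    exact (step h hh a ha d hd i hi).2

/-- Filling in the puncture `k + 1`: the gaps `k + 1` and `k + 2` on its two sides are identified. -/
def fill (k : ℕ) : FreeGroup ℕ →* FreeGroup ℕ :=
  FreeGroup.lift fun m => if m = k + 2 then of (k + 1) else of m

theorem fill_self (k : ℕ) : fill k (of (k + 2)) = of (k + 1) := by simp [fill]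

theorem fill_of_ne {k m : ℕ} (h : m ≠ k + 2) : fill k (of m) = of m := by simp [fill, h]

theorem artin_firstStrands_of {n k m : ℕ} (hk : k ≤ n - 1) {h : BraidGroup n}
    (hh : h ∈ firstStrands n k) (hm : m = 0 ∨ k < m) : artin n h (of m) = of m := by
  induction hh using Subgroup.closure_induction with
  | mem x hx =>
    obtain ⟨i, hi, rfl⟩ := hx
    rw [artin_gen (by omega), artinAut_of_ne (by omega)]
  | one => simp
  | mul x y _ _ hx hy => rw [map_mul, MulAut.mul_apply, hy, hx]
  | inv x _ hx =>
    rw [map_inv, MulAut.inv_apply, MulEquiv.symm_apply_eq, hx]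

theorem fill_comp_gen {n k i : ℕ} (hk : k < n - 1) (hi : i < k) (x : FreeGroup ℕ) :
    fill k (artin n (gen n i) x) = artin n (gen n i) (fill k x) := by
  have : (fill k).comp (artin n (gen n i)).toMonoidHom =
      (artin n (gen n i)).toMonoidHom.comp (fill k) := by
    ext m
    rw [artin_gen (by omega)]
    change fill k (artinAut i (of m)) = artinAut i (fill k (of m))
    by_cases h1 : m = i + 1
    · subst h1
      rw [fill_of_ne (by omega), artinAut_self]
      simp only [map_mul, map_inv]
      rw [fill_of_ne (by omega), fill_of_ne (by omega), fill_of_ne (by omega)]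
    · rw [artinAut_of_ne h1]
      by_cases h2 : m = k + 2
      · subst h2
        rw [fill_self, artinAut_of_ne (by omega)]
      · rw [fill_of_ne h2, artinAut_of_ne h1]
  exact DFunLike.congr_fun this x

theorem fill_comp_firstStrands {n k : ℕ} (hk : k < n - 1) {h : BraidGroup n}
    (hh : h ∈ firstStrands n k) (x : FreeGroup ℕ) :
    fill k (artin n h x) = artin n h (fill k x) := by
  induction hh using Subgroup.closure_induction generalizing x with
  | mem y hy =>
    obtain ⟨i, hi, rfl⟩ := hy
    exact fill_comp_gen hk hi x
  | one => simp
  | mul y z _ _ hy hz => rw [map_mul, MulAut.mul_apply, MulAut.mul_apply, hy, hz]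
  | inv y _ hy =>
    have := hy ((artin n y)⁻¹ x)
    rw [map_inv, MulAut.inv_apply, MulAut.inv_apply, MulEquiv.eq_symm_apply, ← hy,
      MulEquiv.apply_symm_apply]

theorem loopGen_succ {n k d : ℕ} (hk : k < n - 1) (hd : d + 1 ≤ k) :
    loopGen n k (d + 1) = (gen n (k - (d + 1)))⁻¹ * loopGen n k d * gen n (k - (d + 1)) := by
  set i := k - (d + 1) with hi
  have e : k - d = i + 1 := by omega
  have hcomm := gen_mul_cosetRep_of_lt (n := n) (k := k) (d := d) (i := i) (by omega) (by omega)
  have hb := gen_braid (n := n) (i := i) (by omega)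
  have hl1 : loopGen n k (d + 1) = cosetRep n k d * (gen n (i + 1) * (gen n i * gen n i) *
      (gen n (i + 1))⁻¹) * (cosetRep n k d)⁻¹ := by
    simp only [loopGen, cosetRep, ← hi, e]; group
  have hl0 : loopGen n k d = cosetRep n k d * (gen n (i + 1) * gen n (i + 1)) *
      (cosetRep n k d)⁻¹ := by simp only [loopGen, e]
  rw [hl1, hl0]
  generalize gen n i = s at *
  generalize gen n (i + 1) = t at *
  generalize cosetRep n k d = w at *
  have h1 : t * s * t⁻¹ = s⁻¹ * t * s := by
    rw [eq_comm, mul_assoc, inv_mul_eq_iff_eq_mul, eq_comm, ← mul_assoc, ← mul_assoc]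
    rw [mul_inv_eq_iff_eq_mul, hb]
  have hw : s⁻¹ * w = w * s⁻¹ := by
    rw [inv_mul_eq_iff_eq_mul, ← mul_assoc, hcomm]; group
  calc w * (t * (s * s) * t⁻¹) * w⁻¹ = w * ((t * s * t⁻¹) * (t * s * t⁻¹)) * w⁻¹ := by group
    _ = (w * s⁻¹) * (t * t) * (w * s⁻¹)⁻¹ := by rw [h1]; group
    _ = (s⁻¹ * w) * (t * t) * (s⁻¹ * w)⁻¹ := by rw [hw]
    _ = _ := by group

/-- The word that describes the loop `loopGen n k d` as a path of the last puncture, after filling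
in that puncture. -/
def loopWord (k d : ℕ) : FreeGroup ℕ :=
  (of (k + 1))⁻¹ * of (k - d) * (of (k - d + 1))⁻¹ * of (k + 1)

theorem artinAut_sq (k : ℕ) :
    artinAut k (artinAut k (of (k + 1))) =
      of (k + 2) * (of k)⁻¹ * of (k + 1) * (of (k + 2))⁻¹ * of k := by
  have a0 : artinAut k (of k) = of k := artinAut_of_ne (by omega)
  have a2 : artinAut k (of (k + 2)) = of (k + 2) := artinAut_of_ne (by omega)
  rw [artinAut_self]
  simp only [map_mul, map_inv, artinAut_self, a0, a2]
  group

/-- The loop around the strand `k - d` is invisible after filling in the puncture, and it conjugates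
the generator `e_{k+1}⁻¹ e_{k+2}` around that puncture. -/
theorem artin_loopGen {n k d : ℕ} (hk : k < n - 1) (hd : d ≤ k) :
    (∀ x, fill k (artin n (loopGen n k d) x) = fill k x) ∧
      ∃ U, fill k U = loopWord k d ∧
        artin n (loopGen n k d) ((of (k + 1))⁻¹ * of (k + 2)) =
          U⁻¹ * ((of (k + 1))⁻¹ * of (k + 2)) * U := by
  induction d with
  | zero =>
    have h0 : artin n (loopGen n k 0) = artinAut k * artinAut k := by
      simp [loopGen, cosetRep, artin_gen hk]
    rw [h0]
    have a2 : artinAut k (of (k + 2)) = of (k + 2) := artinAut_of_ne (by omega)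
    refine ⟨fun x => ?_, (of (k + 1))⁻¹ * of k, ?_, ?_⟩
    · have : (fill k).comp (artinAut k * artinAut k).toMonoidHom = fill k := by
        ext m
        change fill k (artinAut k (artinAut k (of m))) = _
        by_cases hm : m = k + 1
        · subst hm
          rw [artinAut_sq]
          simp only [map_mul, map_inv, fill_self, fill_of_ne (show k ≠ k + 2 by omega),
            fill_of_ne (show k + 1 ≠ k + 2 by omega)]
          group
        · rw [artinAut_of_ne hm, artinAut_of_ne hm]
      exact DFunLike.congr_fun this x
    · simp only [map_mul, map_inv, fill_of_ne (show k ≠ k + 2 by omega),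
            fill_of_ne (show k + 1 ≠ k + 2 by omega), loopWord]
      simp
    · rw [MulAut.mul_apply, map_mul, map_inv, map_mul, map_inv, artinAut_sq, a2, a2]
      group
  | succ d ih =>
    obtain ⟨ih1, U, hU, ih2⟩ := ih (by omega)
    set i := k - (d + 1) with hi
    have hik : i < k := by omega
    have hs := gen_mem (n := n) hik
    have hs' := inv_mem hs
    rw [loopGen_succ hk hd, ← hi]
    refine ⟨fun x => ?_, artin n (gen n i)⁻¹ U, ?_, ?_⟩
    · simp only [map_mul, MulAut.mul_apply]
      rw [fill_comp_firstStrands hk hs', ih1, fill_comp_firstStrands hk hs, ← MulAut.mul_apply,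
        ← map_mul, inv_mul_cancel, map_one, MulAut.one_apply]
    · rw [fill_comp_firstStrands hk hs', hU, loopWord, loopWord, ← hi, show k - d = i + 1 by omega]
      rw [map_inv, MulAut.inv_apply, MulEquiv.symm_apply_eq, artin_gen (by omega)]
      simp only [map_mul, map_inv, artinAut_self]
      rw [artinAut_of_ne (show k + 1 ≠ i + 1 by omega), artinAut_of_ne (show i ≠ i + 1 by omega)]
      group
    · have fx : ∀ h ∈ firstStrands n k, artin n h ((of (k + 1))⁻¹ * of (k + 2)) =
          (of (k + 1))⁻¹ * of (k + 2) := by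
        intro h hh
        rw [map_mul, map_inv, artin_firstStrands_of hk.le hh (by omega),
          artin_firstStrands_of hk.le hh (by omega)]
      have fs := fx _ hs
      have fs' := fx _ hs'
      rw [map_mul (artin n), MulAut.mul_apply, map_mul (artin n), MulAut.mul_apply]
      generalize (of (k + 1))⁻¹ * of (k + 2) = X at *
      rw [fs, ih2, map_mul, map_mul, fs', map_inv (artin n (gen n i)⁻¹)]

theorem fill_comp_loops {n k : ℕ} (hk : k < n - 1) {a : BraidGroup n} (ha : a ∈ loops n k)
    (x : FreeGroup ℕ) : fill k (artin n a x) = fill k x := by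
  induction ha using Subgroup.closure_induction generalizing x with
  | mem y hy =>
    obtain ⟨d, hd, rfl⟩ := hy
    exact (artin_loopGen hk hd).1 x
  | one => simp
  | mul y z _ _ hy hz => rw [map_mul, MulAut.mul_apply, hy, hz]
  | inv y _ hy =>
    rw [← hy, map_inv, MulAut.inv_apply, MulEquiv.apply_symm_apply]

/-- An action of the free group on `FreeGroup ℕ × Bool` over left multiplication by `fill k x`, in
which `e_{k+1}⁻¹ e_{k+2}` exchanges the two points over `1` and fixes all others. -/
noncomputable def fillPerm (k : ℕ) : FreeGroup ℕ →* Equiv.Perm (FreeGroup ℕ × Bool) :=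
  FreeGroup.lift fun m =>
    if m = k + 2 then
      (Equiv.prodCongr (Equiv.mulLeft (of (k + 1))) (Equiv.refl Bool)) *
        Equiv.swap (1, false) (1, true)
    else Equiv.prodCongr (Equiv.mulLeft (of m)) (Equiv.refl Bool)

theorem fillPerm_fst (k : ℕ) (x : FreeGroup ℕ) (s : FreeGroup ℕ × Bool) :
    (fillPerm k x s).1 = fill k x * s.1 := by
  induction x using FreeGroup.induction_on generalizing s with
  | C1 => simp
  | of m =>
    by_cases hm : m = k + 2
    · subst hm
      have : (Equiv.swap ((1 : FreeGroup ℕ), false) (1, true) s).1 = s.1 := by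
        rw [Equiv.swap_apply_def]; split_ifs with h1 h2 <;> simp_all
      simp [fillPerm, fill, this]
    · simp [fillPerm, fill, hm]
  | inv_of m h =>
    have := h ((fillPerm k (of m))⁻¹ s)
    rw [← Equiv.Perm.mul_apply, mul_inv_cancel, Equiv.Perm.one_apply] at this
    rw [map_inv, map_inv, this]; group
  | mul x y hx hy => rw [map_mul, Equiv.Perm.mul_apply, hx, hy, map_mul, mul_assoc]

/-- What commutes with `e_{k+1}⁻¹ e_{k+2}` becomes trivial when that puncture is filled in. -/
theorem fill_eq_one_of_commute {k : ℕ} {U : FreeGroup ℕ}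
    (h : U⁻¹ * ((of (k + 1))⁻¹ * of (k + 2)) * U = (of (k + 1))⁻¹ * of (k + 2)) :
    fill k U = 1 := by
  have hX : fillPerm k ((of (k + 1))⁻¹ * of (k + 2)) = Equiv.swap (1, false) (1, true) := by
    rw [map_mul, map_inv]; simp [fillPerm]
  by_contra hU
  have h1 := congrArg (fun g => fillPerm k g (1, false)) h
  simp only [map_mul (fillPerm k) (U⁻¹ * _), map_mul (fillPerm k) U⁻¹, hX,
    Equiv.Perm.mul_apply, Equiv.swap_apply_left, map_inv] at h1
  have h2 : (fillPerm k U (1, false)).1 ≠ 1 := by rw [fillPerm_fst]; simpa using hU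
  rw [Equiv.swap_apply_of_ne_of_ne (fun e => h2 (by rw [e])) (fun e => h2 (by rw [e])),
    ← Equiv.Perm.mul_apply, inv_mul_cancel, Equiv.Perm.one_apply] at h1
  simp at h1

theorem artin_cosetRep {n k d : ℕ} (hk : k < n - 1) (hd : d ≤ k + 1) :
    artin n (cosetRep n k d) (of (k + 1 - d + 1)) =
        of (k + 2) * (of (k + 1))⁻¹ * of (k + 1 - d) ∧
      ∀ m ≤ k + 1 - d, artin n (cosetRep n k d) (of m) = of m := by
  induction d with
  | zero => simp [cosetRep]
  | succ d ih =>
    obtain ⟨ih1, ih2⟩ := ih (by omega)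
    have e : k + 1 - d = (k - d) + 1 := by omega
    have e' : k + 1 - (d + 1) = k - d := by omega
    rw [e] at ih1 ih2
    rw [e', cosetRep, map_mul, artin_gen (show k - d < n - 1 by omega)]
    refine ⟨?_, fun m hm => ?_⟩
    · rw [MulAut.mul_apply, artinAut_self]
      simp only [map_mul, map_inv]
      rw [show k - d + 2 = k - d + 1 + 1 by omega, ih1, ih2 _ le_rfl, ih2 _ (by omega)]
      group
    · rw [MulAut.mul_apply, artinAut_of_ne (by omega), ih2 _ (by omega)]

theorem loopWord_free {k : ℕ} {f : FreeGroup (Fin (k + 1))}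
    (h : FreeGroup.lift (fun d : Fin (k + 1) => loopWord k d.val) f = 1) : f = 1 := by
  -- a left inverse: `e_m ↦ z_m z_{m+1} ⋯ z_k`, up to conjugation by `e_{k+1}`
  let z : ℕ → FreeGroup (Fin (k + 1)) := fun d => if hd : d < k + 1 then of ⟨d, hd⟩ else 1
  let P : ℕ → FreeGroup (Fin (k + 1)) := fun d => Nat.rec 1 (fun d p => z d * p) d
  let Q : FreeGroup ℕ →* FreeGroup (Fin (k + 1)) := FreeGroup.lift fun m => P (k + 1 - m)
  have hQ : Q.comp (FreeGroup.lift (fun d : Fin (k + 1) => loopWord k d.val)) =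
      MonoidHom.id _ := by
    ext d
    have hd := d.isLt
    have e1 : k + 1 - (k - d.val) = d.val + 1 := by omega
    have e2 : k + 1 - (k - d.val + 1) = d.val := by omega
    have e3 : P (d.val + 1) = z d.val * P d.val := rfl
    have e4 : P 0 = 1 := rfl
    have e5 : z d.val = of d := dif_pos hd
    simp only [MonoidHom.comp_apply, FreeGroup.lift_apply_of, loopWord, map_mul, map_inv, Q, e1, e2,
      Nat.sub_self, e3, e4, e5, MonoidHom.id_apply]
    group
  have := DFunLike.congr_fun hQ f
  rw [MonoidHom.comp_apply, h, map_one] at this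
  exact this.symm

theorem eq_one_of_mem_loops {n k : ℕ} (hk : k < n - 1) {a : BraidGroup n} (ha : a ∈ loops n k)
    (h : artin n a = 1) : a = 1 := by
  set A : FreeGroup (Fin (k + 1)) →* BraidGroup n :=
    FreeGroup.lift fun d : Fin (k + 1) => loopGen n k d.val with hA
  have hr : ∃ f, A f = a := by
    have : loops n k ≤ A.range := by
      rw [loops, Subgroup.closure_le]
      rintro _ ⟨d, hd, rfl⟩
      exact ⟨of ⟨d, by omega⟩, by simp [hA]⟩
    exact this ha
  have hmem : ∀ f, A f ∈ loops n k := by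
    intro f
    induction f using FreeGroup.induction_on with
    | C1 => rw [map_one]; exact one_mem _
    | of d => simpa [hA] using loopGen_mem (n := n) (Nat.lt_succ_iff.mp d.isLt)
    | inv_of d h => rw [map_inv]; exact inv_mem h
    | mul x y hx hy => rw [map_mul]; exact mul_mem hx hy
  have key : ∀ f, ∃ U, fill k U = FreeGroup.lift (fun d : Fin (k + 1) => loopWord k d.val) f ∧
      artin n (A f) ((of (k + 1))⁻¹ * of (k + 2)) = U⁻¹ * ((of (k + 1))⁻¹ * of (k + 2)) * U := by
    intro f
    induction f using FreeGroup.induction_on with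
    | C1 => exact ⟨1, by simp, by simp⟩
    | of d =>
      simpa [hA] using (artin_loopGen hk (Nat.lt_succ_iff.mp d.isLt)).2
    | inv_of d h =>
      obtain ⟨U, hU, hU'⟩ := h
      refine ⟨(artin n (A (of d))⁻¹ U)⁻¹, ?_, ?_⟩
      · rw [map_inv, fill_comp_loops hk (inv_mem (hmem _)), hU, map_inv]
      · rw [map_inv, map_inv, MulAut.inv_apply, MulEquiv.symm_apply_eq]
        generalize (of (k + 1))⁻¹ * of (k + 2) = X at *
        rw [MulAut.inv_apply, map_mul, map_mul, hU', map_inv, map_inv, MulEquiv.apply_symm_apply]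
        group
    | mul x y hx hy =>
      obtain ⟨U, hU, hU'⟩ := hx
      obtain ⟨V, hV, hV'⟩ := hy
      refine ⟨U * artin n (A x) V, ?_, ?_⟩
      · rw [map_mul, fill_comp_loops hk (hmem _), hU, hV, map_mul]
      · rw [map_mul A, map_mul (artin n), MulAut.mul_apply, hV']
        generalize (of (k + 1))⁻¹ * of (k + 2) = X at *
        rw [map_mul, map_mul, hU', map_inv]
        group
  obtain ⟨f, rfl⟩ := hr
  obtain ⟨U, hU, hU'⟩ := key f
  rw [h, MulAut.one_apply] at hU'
  rw [fill_eq_one_of_commute hU'.symm] at hU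
  rw [loopWord_free hU.symm, map_one]

theorem eq_one_of_mem_firstStrands {n k : ℕ} (hk : k ≤ n - 1) {g : BraidGroup n}
    (hg : g ∈ firstStrands n k) (h : artin n g = 1) : g = 1 := by
  induction k generalizing g with
  | zero =>
    have : firstStrands n 0 = ⊥ := by simp [firstStrands]
    rw [this] at hg
    simpa using hg
  | succ k ih =>
    have hk' : k < n - 1 := by omega
    obtain ⟨b, hb, a, ha, d, hd, rfl⟩ := exists_factorization hk' hg
    have hd0 : d = 0 := by
      -- otherwise `e_m⁻¹ e_{m+1}`, for the strand `m = k + 1 - d`, becomes trivial after filling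
      by_contra hd0
      obtain ⟨h1, h2⟩ := artin_cosetRep (n := n) hk' hd
      set m := k + 1 - d with hm
      have e : ∀ x, fill k x = artin n b (fill k (artin n (cosetRep n k d) x)) := by
        intro x
        have := DFunLike.congr_fun h x
        rw [MulAut.one_apply, map_mul, map_mul, MulAut.mul_apply, MulAut.mul_apply] at this
        nth_rw 1 [← this]
        rw [fill_comp_firstStrands hk' hb, fill_comp_loops hk' ha]
      have e1 := e (of m)
      have e2 := e (of (m + 1))
      rw [h2 m le_rfl] at e1
      rw [h1] at e2
      simp only [map_mul, map_inv, fill_self, fill_of_ne (show k + 1 ≠ k + 2 by omega)] at e2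
      rw [mul_inv_cancel, one_mul, ← e1, fill_of_ne (by omega), fill_of_ne (by omega)] at e2
      have := FreeGroup.of_injective e2
      omega
    subst hd0
    rw [cosetRep, mul_one] at h ⊢
    have hb1 : artin n b = 1 := by
      apply mulAut_ext
      intro m
      by_cases hm : m = k + 2
      · rw [artin_firstStrands_of hk'.le hb (by omega), MulAut.one_apply]
      · have h1 := fill_comp_firstStrands hk' hb (artin n a (of m))
        rw [fill_comp_loops hk' ha, fill_of_ne hm, ← MulAut.mul_apply, ← map_mul, h,
          MulAut.one_apply, fill_of_ne hm] at h1
        rw [← h1, MulAut.one_apply]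
    rw [map_mul, hb1, one_mul] at h
    rw [ih hk'.le hb hb1, eq_one_of_mem_loops hk' ha h, mul_one]

/-- The Artin action is faithful. -/
theorem artin_injective (n : ℕ) : Function.Injective (artin n) := by
  rw [injective_iff_map_eq_one]
  intro g hg
  refine eq_one_of_mem_firstStrands (k := n - 1) le_rfl ?_ hg
  clear hg
  induction g using PresentedGroup.induction_on with
  | _ z =>
  induction z using FreeGroup.induction_on with
  | C1 => rw [map_one]; exact one_mem _
  | of i =>
    have : gen n i.val = PresentedGroup.mk (braidRelations n) (of i) := by
      rw [gen, dif_pos i.isLt]; rfl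
    exact this ▸ gen_mem i.isLt
  | inv_of i h => rw [map_inv]; exact inv_mem h
  | mul x y hx hy => rw [map_mul]; exact mul_mem hx hy

theorem artin_of_ge {n m : ℕ} (g : BraidGroup n) (hm : m = 0 ∨ n ≤ m) :
    artin n g (of m) = of m := by
  induction g using PresentedGroup.induction_on with
  | _ z =>
  induction z using FreeGroup.induction_on with
  | C1 => simp
  | of i =>
    change artin n (sigma i) (of m) = _
    rw [artin_sigma, artinAut_of_ne (by have := i.isLt; omega)]
  | inv_of i h => rw [map_inv, map_inv, MulAut.inv_apply, MulEquiv.symm_apply_eq, h]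
  | mul x y hx hy => rw [map_mul, map_mul, MulAut.mul_apply, hy, hx]

/-- A braid that fixes all generators `e_m⁻¹ e_{m+1}` around the punctures is trivial. -/
theorem eq_one_of_fixes {n : ℕ} {g : BraidGroup n}
    (h : ∀ m < n, artin n g ((of m)⁻¹ * of (m + 1)) = (of m)⁻¹ * of (m + 1)) : g = 1 := by
  apply artin_injective n
  rw [map_one]
  apply mulAut_ext
  intro m
  rw [MulAut.one_apply]
  induction m with
  | zero => exact artin_of_ge g (Or.inl rfl)
  | succ m ih =>
    by_cases hm : m < n
    · have := h m hm
      rw [map_mul, map_inv, ih] at this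
      exact mul_left_cancel this
    · exact artin_of_ge g (by omega)

end BraidGroup

/-! ### Labelled configurations and their reduction -/

/-- A configuration: for each curve the list of its points on the upper line, each labelled by an
element of `α` (later, the holonomy of the curve from its base point to that point). -/
abbrev Config (n : ℕ) (α : Type*) := Fin n → List (ℚ × α)

namespace Config

variable {n : ℕ} {α : Type*}

/-- The points of a configuration. -/
def pts (C : Config n α) : Set ℚ := {x | ∃ j, x ∈ (C j).map Prod.fst}

/-- Every point occurs once. -/
def Simple (C : Config n α) : Prop :=
  (∀ j, ((C j).map Prod.fst).Nodup) ∧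
    ∀ j k, j ≠ k → ∀ x, x ∈ (C j).map Prod.fst → x ∉ (C k).map Prod.fst

/-- No point of the configuration lies strictly between `b` and `c`. -/
def Adj (C : Config n α) (b c : ℚ) : Prop := ∀ z ∈ C.pts, ¬ (min b c < z ∧ z < max b c)

/-- Removal of two points that are adjacent on the line, consecutive on a curve, and carry the same
label. -/
def Del (C E : Config n α) : Prop :=
  ∃ (j : Fin n) (L R : List (ℚ × α)) (b c : ℚ) (u : α),
    C j = L ++ (b, u) :: (c, u) :: R ∧ C.Adj b c ∧ E = Function.update C j (L ++ R)

/-- Moving the points by a map that preserves their order. -/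
def Reposition (C E : Config n α) : Prop :=
  ∃ f : ℚ → ℚ, StrictMonoOn f C.pts ∧ ∀ j, E j = (C j).map (Prod.map f id)

theorem map_fst_map {f : ℚ → ℚ} (l : List (ℚ × α)) :
    (l.map (Prod.map f id)).map Prod.fst = (l.map Prod.fst).map f := by
  simp [List.map_map, Function.comp_def]

theorem pts_reposition {C E : Config n α} {f : ℚ → ℚ}
    (h : ∀ j, E j = (C j).map (Prod.map f id)) : E.pts = f '' C.pts := by
  ext x
  simp only [pts, Set.mem_ofPred_eq, Set.mem_image, h, map_fst_map]
  simp only [List.mem_map]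
  constructor
  · rintro ⟨j, a, ha, rfl⟩; exact ⟨a, ⟨j, ha⟩, rfl⟩
  · rintro ⟨a, ⟨j, ha⟩, rfl⟩; exact ⟨j, a, ha, rfl⟩

theorem Reposition.refl (C : Config n α) : Reposition C C := ⟨id, strictMonoOn_id, fun j => by simp⟩

theorem Reposition.symm {C E : Config n α} (h : Reposition C E) : Reposition E C := by
  obtain ⟨f, hf, h⟩ := h
  have inv : ∀ x ∈ C.pts, Function.invFunOn f C.pts (f x) = x :=
    fun x hx => hf.injOn.leftInvOn_invFunOn hx
  refine ⟨Function.invFunOn f C.pts, ?_, fun j => ?_⟩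
  · rw [pts_reposition h]
    rintro _ ⟨x, hx, rfl⟩ _ ⟨y, hy, rfl⟩ hxy
    rw [inv x hx, inv y hy]
    exact (hf.lt_iff_lt hx hy).1 hxy
  · rw [h, List.map_map]
    symm
    have : ∀ z ∈ C j, (Prod.map (Function.invFunOn f C.pts) id ∘ Prod.map f id) z = z := by
      rintro ⟨x, u⟩ hz
      simp only [Function.comp_apply, Prod.map_apply, id]
      rw [inv x ⟨j, List.mem_map.2 ⟨_, hz, rfl⟩⟩]
    rw [List.map_congr_left this]
    simp

theorem Reposition.trans {C E G : Config n α} (h : Reposition C E) (h' : Reposition E G) : Reposition C G := by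
  obtain ⟨f, hf, h⟩ := h
  obtain ⟨g, hg, h'⟩ := h'
  refine ⟨g ∘ f, ?_, fun j => by rw [h', h, List.map_map]; congr⟩
  rw [pts_reposition h] at hg
  exact hg.comp hf (Set.mapsTo_image f C.pts)

theorem Simple.of_reposition {C E : Config n α} (hC : Simple C) (h : Reposition C E) : Simple E := by
  obtain ⟨f, hf, h⟩ := h
  refine ⟨fun j => ?_, fun j k hjk x hx hx' => ?_⟩
  · rw [h, map_fst_map]
    exact (hC.1 j).map_on fun x hx y hy => hf.injOn ⟨j, hx⟩ ⟨j, hy⟩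
  · rw [h, map_fst_map, List.mem_map] at hx hx'
    obtain ⟨a, ha, rfl⟩ := hx
    obtain ⟨b, hb, hab⟩ := hx'
    have := hf.injOn ⟨k, hb⟩ ⟨j, ha⟩ hab
    subst this
    exact hC.2 j k hjk _ ha hb

theorem pts_update_subset {C : Config n α} {j : Fin n} {l : List (ℚ × α)}
    (h : l.Sublist (C j)) : pts (Function.update C j l) ⊆ C.pts := by
  rintro x ⟨k, hk⟩
  by_cases hkj : k = j
  · subst hkj
    rw [Function.update_self] at hk
    exact ⟨k, (h.map Prod.fst).subset hk⟩
  · rw [Function.update_of_ne hkj] at hk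
    exact ⟨k, hk⟩

theorem Adj.mono {C E : Config n α} {b c : ℚ} (h : Adj C b c) (hE : E.pts ⊆ C.pts) : Adj E b c :=
  fun z hz => h z (hE hz)

theorem sublist_delete (L R : List (ℚ × α)) (x y : ℚ × α) :
    (L ++ R).Sublist (L ++ x :: y :: R) :=
  List.Sublist.append_left ((List.sublist_cons_self y R).trans (List.sublist_cons_self x _)) L

theorem Simple.of_del {C E : Config n α} (hC : Simple C) (h : Del C E) : Simple E := by
  obtain ⟨j, L, R, b, c, u, hj, -, rfl⟩ := h
  have hs : (L ++ R).Sublist (C j) := hj ▸ sublist_delete L R (b, u) (c, u)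
  have hsub : ∀ k, ((Function.update C j (L ++ R)) k).Sublist (C k) := by
    intro k
    by_cases hkj : k = j
    · subst hkj; rwa [Function.update_self]
    · rw [Function.update_of_ne hkj]
  exact ⟨fun k => (hC.1 k).sublist ((hsub k).map _), fun i k hik x hx hx' =>
    hC.2 i k hik x (((hsub i).map _).subset hx) (((hsub k).map _).subset hx')⟩

theorem min_max_lt_iff {f : ℚ → ℚ} {s : Set ℚ} (hf : StrictMonoOn f s) {b c z : ℚ} (hb : b ∈ s)
    (hc : c ∈ s) (hz : z ∈ s) :
    (min (f b) (f c) < f z ∧ f z < max (f b) (f c)) ↔ (min b c < z ∧ z < max b c) := by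
  simp only [min_lt_iff, lt_max_iff, hf.lt_iff_lt hb hz, hf.lt_iff_lt hc hz, hf.lt_iff_lt hz hb,
    hf.lt_iff_lt hz hc]

theorem Del.reposition {C E C' : Config n α} (h : Del C E) (hr : Reposition C C') :
    ∃ E', Del C' E' ∧ Reposition E E' := by
  obtain ⟨j, L, R, b, c, u, hj, ha, rfl⟩ := h
  obtain ⟨f, hf, h⟩ := hr
  have hb : b ∈ C.pts := ⟨j, by simp [hj]⟩
  have hc : c ∈ C.pts := ⟨j, by simp [hj]⟩
  have hs : (L ++ R).Sublist (C j) := hj ▸ sublist_delete L R (b, u) (c, u)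
  refine ⟨_, ⟨j, L.map (Prod.map f id), R.map (Prod.map f id), f b, f c, u, ?_, ?_, rfl⟩,
    f, hf.mono (pts_update_subset hs), fun k => ?_⟩
  · rw [h, hj]; simp
  · intro z hz
    rw [pts_reposition h] at hz
    obtain ⟨z, hz, rfl⟩ := hz
    rw [min_max_lt_iff hf hb hc hz]
    exact ha z hz
  · by_cases hkj : k = j
    · subst hkj; simp
    · rw [Function.update_of_ne hkj, Function.update_of_ne hkj, h]

/-- Two removals from the same configuration commute, or their results differ by moving a point past
adjacent points that are no longer there. -/
theorem Del.diamond {C E G : Config n α} (hC : Simple C) (h : Del C E) (h' : Del C G) :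
    Reposition E G ∨ ∃ H, Del E H ∧ Del G H := by
  have main : ∀ {E G : Config n α} (j : Fin n) (L R L' R' : List (ℚ × α)) (b c b' c' : ℚ) (u u' : α),
      C j = L ++ (b, u) :: (c, u) :: R → C.Adj b c → E = Function.update C j (L ++ R) →
      C j = L' ++ (b', u') :: (c', u') :: R' → C.Adj b' c' →
      G = Function.update C j (L' ++ R') → L.length ≤ L'.length →
      Reposition E G ∨ ∃ H, Del E H ∧ Del G H := by
    rintro E G j L R L' R' b c b' c' u u' hj ha rfl hj' ha' rfl hl
    have hj2 := hj.symm.trans hj'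
    have hE : pts (Function.update C j (L ++ R)) ⊆ C.pts :=
      pts_update_subset (hj ▸ sublist_delete L R (b, u) (c, u))
    have hG : pts (Function.update C j (L' ++ R')) ⊆ C.pts :=
      pts_update_subset (hj' ▸ sublist_delete L' R' (b', u') (c', u'))
    rcases List.append_eq_append_iff.1 hj2 with ⟨M, rfl, hM⟩ | ⟨M, rfl, hM⟩
    · match M, hM with
      | [], hM =>
        simp only [List.nil_append, List.cons.injEq, Prod.mk.injEq] at hM
        obtain ⟨⟨rfl, rfl⟩, ⟨rfl, -⟩, rfl⟩ := hM
        left; simpa using Reposition.refl _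
      | [x], hM =>
        simp only [List.cons_append, List.nil_append, List.cons.injEq, Prod.mk.injEq] at hM
        obtain ⟨rfl, ⟨rfl, rfl⟩, rfl⟩ := hM
        left
        have hnd := hC.1 j
        rw [hj] at hnd
        have hb : b ∈ C.pts := ⟨j, by simp [hj]⟩
        have hc : c ∈ C.pts := ⟨j, by simp [hj]⟩
        have hd : c' ∈ C.pts := ⟨j, by simp [hj]⟩
        simp only [List.map_append, List.map_cons] at hnd
        have hnd2 := List.nodup_append.1 hnd
        simp only [List.nodup_cons, List.mem_cons, not_or] at hnd2
        obtain ⟨hL, ⟨⟨hbc, hbd, hbR⟩, ⟨hcd, hcR⟩, hdR, hR⟩, hdis⟩ := hnd2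
        refine ⟨fun z => if z = c' then b else z, ?_, fun k => ?_⟩
        · have hne : ∀ z ∈ pts (Function.update C j (L ++ (c', u) :: R')), z ≠ b ∧ z ≠ c := by
            rintro z ⟨k, hk⟩
            by_cases hkj : k = j
            · subst hkj
              simp only [Function.update_self, List.map_append, List.map_cons, List.mem_append,
                List.mem_cons] at hk
              constructor
              · rintro rfl
                rcases hk with hk | hk | hk
                · exact hdis _ hk z (by simp) rfl
                · exact hbd hk
                · exact hbR hk
              · rintro rfl
                rcases hk with hk | hk | hk
                · exact hdis _ hk z (by simp) rfl
                · exact hcd hk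
                · exact hcR hk
            · rw [Function.update_of_ne hkj] at hk
              constructor
              · rintro rfl
                exact hC.2 k j hkj z hk (by simp [hj])
              · rintro rfl
                exact hC.2 k j hkj z hk (by simp [hj])
          have key : ∀ z ∈ pts (Function.update C j (L ++ (c', u) :: R')), z ≠ c' →
              (z < b ↔ z < c') := by
            intro z hz hzd
            obtain ⟨hzb, hzc⟩ := hne z hz
            have h1 := ha z (hE hz)
            have h2 := ha' z (hE hz)
            simp only [min_lt_iff, lt_max_iff, not_and, not_or, not_lt] at h1 h2
            grind
          intro x hx y hy hxy
          have hx' := hne x hx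
          have hy' := hne y hy
          by_cases hxd : x = c' <;> by_cases hyd : y = c'
          · subst hxd; subst hyd; exact absurd hxy (lt_irrefl _)
          · simp only [hxd, hyd, if_true, if_false]
            subst hxd
            have := key y hy hyd
            rcases lt_trichotomy y b with h | h | h
            · exact absurd (this.1 h) (not_lt.2 hxy.le)
            · exact absurd h hy'.1
            · exact h
          · simp only [hxd, hyd, if_true, if_false]
            subst hyd
            exact (key x hx hxd).2 hxy
          · simpa only [hxd, hyd, if_false] using hxy
        · have e : ∀ (l : List (ℚ × α)), (∀ z ∈ l, z.1 ≠ c') →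
              l.map (Prod.map (fun z => if z = c' then b else z) id) = l := by
            intro l hl
            conv_rhs => rw [← List.map_id l]
            apply List.map_congr_left
            rintro ⟨z, v⟩ hz
            simp [hl _ hz]
          by_cases hkj : k = j
          · subst hkj
            simp only [Function.update_self, List.map_append, List.map_cons, Prod.map_apply,
              if_true, id, List.append_assoc, List.cons_append, List.nil_append]
            rw [e L, e R']
            · rintro ⟨z, v⟩ hz rfl
              exact hdR (List.mem_map.2 ⟨_, hz, rfl⟩)
            · rintro ⟨z, v⟩ hz rfl
              exact hdis z (List.mem_map.2 ⟨_, hz, rfl⟩) z (by simp) rfl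
          · rw [Function.update_of_ne hkj, Function.update_of_ne hkj, e]
            rintro ⟨z, v⟩ hz rfl
            exact hC.2 k j hkj z (List.mem_map.2 ⟨_, hz, rfl⟩) (by simp [hj])
      | x :: y :: M, hM =>
        simp only [List.cons_append, List.cons.injEq] at hM
        obtain ⟨rfl, rfl, rfl⟩ := hM
        right
        refine ⟨Function.update C j (L ++ (M ++ R')),
          ⟨j, L ++ M, R', b', c', u', by simp, ha'.mono hE, by simp⟩,
          ⟨j, L, M ++ R', b, c, u, by simp, ha.mono hG, by simp⟩⟩
    · -- here the second pair would start before the first, so the lengths agree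
      have : M = [] := by
        rw [List.length_append] at hl
        exact List.length_eq_zero_iff.1 (by omega)
      subst this
      simp only [List.append_nil, List.nil_append, List.cons.injEq, Prod.mk.injEq] at hM ⊢
      obtain ⟨⟨rfl, rfl⟩, ⟨rfl, -⟩, rfl⟩ := hM
      exact Or.inl (Reposition.refl _)
  obtain ⟨j, L, R, b, c, u, hj, ha, rfl⟩ := h
  obtain ⟨k, L', R', b', c', u', hk, ha', rfl⟩ := h'
  by_cases hjk : j = k
  · subst hjk
    rcases le_total L.length L'.length with hl | hl
    · exact main j L R L' R' b c b' c' u u' hj ha rfl hk ha' rfl hl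
    · rcases main j L' R' L R b' c' b c u' u hk ha' rfl hj ha rfl hl with h | ⟨H, h1, h2⟩
      · exact Or.inl h.symm
      · exact Or.inr ⟨H, h2, h1⟩
  · right
    refine ⟨Function.update (Function.update C j (L ++ R)) k (L' ++ R'),
      ⟨k, L', R', b', c', u', ?_, ha'.mono ?_, rfl⟩, ⟨j, L, R, b, c, u, ?_, ha.mono ?_, ?_⟩⟩
    · rw [Function.update_of_ne (Ne.symm hjk), hk]
    · exact pts_update_subset (hj ▸ sublist_delete L R (b, u) (c, u))
    · rw [Function.update_of_ne hjk, hj]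
    · exact pts_update_subset (hk ▸ sublist_delete L' R' (b', u') (c', u'))
    · rw [Function.update_comm hjk]

/-- Configurations in which every point occurs once, up to moving the points in order. -/
def repositionSetoid (n : ℕ) (α : Type*) : Setoid {C : Config n α // Simple C} where
  r C E := Reposition C.1 E.1
  iseqv := ⟨fun C => Reposition.refl C.1, Reposition.symm, Reposition.trans⟩

/-- Removal of a pair of points, on classes of configurations. -/
def DelClass (q r : Quotient (repositionSetoid n α)) : Prop :=
  ∃ C E : {C : Config n α // Simple C}, Quotient.mk _ C = q ∧ Quotient.mk _ E = r ∧ Del C.1 E.1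

theorem DelClass.diamond (a b c : Quotient (repositionSetoid n α)) (h : DelClass a b)
    (h' : DelClass a c) :
    ∃ d, Relation.ReflGen DelClass b d ∧ Relation.ReflTransGen DelClass c d := by
  obtain ⟨C, E, rfl, rfl, h⟩ := h
  obtain ⟨C', G, hCC, rfl, h'⟩ := h'
  have hr : Reposition C'.1 C.1 := Quotient.exact hCC
  obtain ⟨G', hG, hGG⟩ := h'.reposition hr
  have hG' : Simple G' := C.2.of_del hG
  have e : (Quotient.mk (repositionSetoid n α) G) = Quotient.mk _ ⟨G', hG'⟩ := Quotient.sound hGG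
  rcases h.diamond C.2 hG with h1 | ⟨H, h1, h2⟩
  · refine ⟨Quotient.mk _ G, ?_, .refl⟩
    have : (Quotient.mk (repositionSetoid n α) E) = Quotient.mk _ G := by
      rw [e]; exact Quotient.sound h1
    rw [this]
  · have hH : Simple H := E.2.of_del h1
    refine ⟨Quotient.mk _ ⟨H, hH⟩, .single ⟨E, ⟨H, hH⟩, rfl, rfl, h1⟩, .single ?_⟩
    exact ⟨⟨G', hG'⟩, ⟨H, hH⟩, e.symm, rfl, h2⟩

/-- Equivalence of configurations, generated by removals and order-preserving moves. -/
def Eqv : Config n α → Config n α → Prop :=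
  Relation.EqvGen fun C E => Simple C ∧ (Reposition C E ∨ Del C E)

theorem Eqv.refl (C : Config n α) : Eqv C C := Relation.EqvGen.refl C
theorem Eqv.symm {C E : Config n α} (h : Eqv C E) : Eqv E C := Relation.EqvGen.symm _ _ h
theorem Eqv.trans {C E G : Config n α} (h : Eqv C E) (h' : Eqv E G) : Eqv C G :=
  Relation.EqvGen.trans _ _ _ h h'
theorem Eqv.reposition {C E : Config n α} (hC : Simple C) (h : Reposition C E) : Eqv C E :=
  Relation.EqvGen.rel _ _ ⟨hC, Or.inl h⟩
theorem Eqv.del {C E : Config n α} (hC : Simple C) (h : Del C E) : Eqv C E :=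
  Relation.EqvGen.rel _ _ ⟨hC, Or.inr h⟩

theorem Eqv.simple_iff {C E : Config n α} (h : Eqv C E) : (Simple C ↔ Simple E) ∧
    ∀ (hC : Simple C) (hE : Simple E), Relation.Join (Relation.ReflTransGen DelClass)
      (Quotient.mk (repositionSetoid n α) ⟨C, hC⟩) (Quotient.mk _ ⟨E, hE⟩) := by
  have he := Relation.equivalence_join_reflTransGen (DelClass.diamond (n := n) (α := α))
  induction h with
  | rel C E h =>
    obtain ⟨hC, h⟩ := h
    rcases h with h | h
    · refine ⟨⟨fun _ => hC.of_reposition h, fun _ => hC⟩, fun hC hE => ?_⟩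
      have : (Quotient.mk (repositionSetoid n α) ⟨C, hC⟩) = Quotient.mk _ ⟨E, hE⟩ := Quotient.sound h
      rw [this]
      exact he.refl _
    · refine ⟨⟨fun _ => hC.of_del h, fun _ => hC⟩, fun hC hE => ?_⟩
      exact ⟨_, .single ⟨⟨C, hC⟩, ⟨E, hE⟩, rfl, rfl, h⟩, .refl⟩
  | refl C => exact ⟨Iff.rfl, fun _ _ => he.refl _⟩
  | symm C E _ ih => exact ⟨ih.1.symm, fun hC hE => he.symm (ih.2 hE hC)⟩
  | trans C E G _ _ ih1 ih2 =>
    exact ⟨ih1.1.trans ih2.1, fun hC hG => he.trans (ih1.2 hC (ih1.1.1 hC)) (ih2.2 _ hG)⟩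

/-- If `C` is equivalent to an irreducible configuration `E`, then it reduces to `E`; so a property
that is preserved by removals and holds for `C` holds for a relabelling of `E`. -/
theorem Eqv.exists_reposition_of_irreducible {C E : Config n α} (hC : Simple C) (h : Eqv C E)
    (hE : ∀ G, ¬ Del E G) {P : Config n α → Prop} (hP : P C)
    (hstep : ∀ G H, P G → Del G H → P H) : ∃ G, P G ∧ Reposition G E := by
  obtain ⟨h1, h2⟩ := h.simple_iff
  have hES := h1.1 hC
  obtain ⟨q, hq1, hq2⟩ := h2 hC hES
  have e : (Quotient.mk (repositionSetoid n α) ⟨E, hES⟩) = q := by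
    rcases Relation.ReflTransGen.cases_head hq2 with h | ⟨c, ⟨A, B, hA, -, hAB⟩, -⟩
    · exact h
    · obtain ⟨G, hG, -⟩ := hAB.reposition (show Reposition A.1 E from Quotient.exact hA)
      exact absurd hG (hE G)
  have : ∀ r, Relation.ReflTransGen DelClass (Quotient.mk (repositionSetoid n α) ⟨C, hC⟩) r →
      ∃ G : {C : Config n α // Simple C}, P G.1 ∧ Quotient.mk _ G = r := by
    intro r hr
    induction hr with
    | refl => exact ⟨⟨C, hC⟩, hP, rfl⟩
    | tail _ hbc ih =>
      obtain ⟨G, hG, rfl⟩ := ih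
      obtain ⟨A, B, hA, rfl, hAB⟩ := hbc
      obtain ⟨H, hH, hBH⟩ := hAB.reposition (show Reposition A.1 G.1 from Quotient.exact hA)
      exact ⟨⟨H, G.2.of_del hH⟩, hstep _ _ hG hH, (Quotient.sound hBH).symm⟩
  obtain ⟨G, hG, hGq⟩ := this q hq1
  exact ⟨G.1, hG, Quotient.exact (hGq.trans e.symm)⟩

/-- The action on labels. -/
def act {β : Type*} (φ : α → β) (C : Config n α) : Config n β :=
  fun j => (C j).map (Prod.map id φ)

theorem map_fst_act {β : Type*} (φ : α → β) (l : List (ℚ × α)) :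
    (l.map (Prod.map id φ)).map Prod.fst = l.map Prod.fst := by
  simp [List.map_map, Function.comp_def]

theorem pts_act {β : Type*} (φ : α → β) (C : Config n α) : (act φ C).pts = C.pts := by
  simp only [pts, act, map_fst_act]

theorem Simple.act {β : Type*} (φ : α → β) {C : Config n α} (h : Simple C) :
    Simple (C.act φ) := by
  simpa only [Simple, Config.act, map_fst_act] using h

theorem Del.act {β : Type*} (φ : α → β) {C E : Config n α} (h : Del C E) :
    Del (C.act φ) (E.act φ) := by
  obtain ⟨j, L, R, b, c, u, hj, ha, rfl⟩ := h
  refine ⟨j, L.map (Prod.map id φ), R.map (Prod.map id φ), b, c, φ u, ?_, ?_, ?_⟩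
  · simp [Config.act, hj]
  · intro z hz; rw [pts_act] at hz; exact ha z hz
  · funext k
    by_cases hkj : k = j
    · subst hkj; simp [Config.act]
    · simp [Config.act, Function.update_of_ne hkj]

theorem Reposition.act {β : Type*} (φ : α → β) {C E : Config n α} (h : Reposition C E) :
    Reposition (C.act φ) (E.act φ) := by
  obtain ⟨f, hf, h⟩ := h
  refine ⟨f, by rwa [pts_act], fun j => ?_⟩
  simp only [Config.act, h, List.map_map]
  congr 1

theorem Eqv.act {β : Type*} (φ : α → β) {C E : Config n α} (h : Eqv C E) :
    Eqv (C.act φ) (E.act φ) := by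
  induction h with
  | rel C E h =>
    exact Relation.EqvGen.rel _ _ ⟨h.1.act φ, h.2.imp (Reposition.act φ) (Del.act φ)⟩
  | refl C => exact Eqv.refl _
  | symm C E _ ih => exact ih.symm
  | trans C E G _ _ ih1 ih2 => exact ih1.trans ih2

theorem act_act {β γ : Type*} (φ : α → β) (ψ : β → γ) (C : Config n α) :
    (C.act φ).act ψ = C.act (ψ ∘ φ) := by
  funext j
  simp only [act, List.map_map]
  congr 1

theorem act_id (C : Config n α) : C.act id = C := by
  funext j
  simp [act]

end Config

/-! ### Points, arcs and terminal points of a diagram -/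

theorem List.getElem?_pair_iff {α : Type*} {l : List α} {i : ℕ} {x y : α} :
    (l[i]? = some x ∧ l[i + 1]? = some y) ↔ ∃ L R, l = L ++ x :: y :: R ∧ L.length = i := by
  constructor
  · rintro ⟨h1, h2⟩
    obtain ⟨hi, rfl⟩ := List.getElem?_eq_some_iff.1 h1
    obtain ⟨hi', rfl⟩ := List.getElem?_eq_some_iff.1 h2
    refine ⟨l.take i, l.drop (i + 2), ?_, by simp; omega⟩
    rw [← List.drop_eq_getElem_cons, ← List.drop_eq_getElem_cons, List.take_append_drop]
  · rintro ⟨L, R, rfl, rfl⟩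
    simp

namespace VCD

variable {n : ℕ}

theorem isOverArc_iff {D : VCD n} {x y : ℚ} :
    D.IsOverArc x y ↔ ∃ j L R, D.curve j = L ++ x :: y :: R ∧ Even L.length := by
  constructor
  · rintro ⟨j, a, h⟩
    obtain ⟨L, R, h, hl⟩ := List.getElem?_pair_iff.1 h
    exact ⟨j, L, R, h, hl ▸ even_two_mul a⟩
  · rintro ⟨j, L, R, h, a, ha⟩
    exact ⟨j, a, List.getElem?_pair_iff.2 ⟨L, R, h, by omega⟩⟩

theorem isUnderArc_iff {D : VCD n} {x y : ℚ} :
    D.IsUnderArc x y ↔ ∃ j L R, D.curve j = L ++ x :: y :: R ∧ Odd L.length := by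
  constructor
  · rintro ⟨j, a, h⟩
    obtain ⟨L, R, h, hl⟩ := List.getElem?_pair_iff.1 h
    exact ⟨j, L, R, h, hl ▸ odd_two_mul_add_one a⟩
  · rintro ⟨j, L, R, h, a, ha⟩
    exact ⟨j, a, List.getElem?_pair_iff.2 ⟨L, R, h, by omega⟩⟩

/-- A point determines its curve and its place on it. -/
theorem split_unique {D : VCD n} {j k : Fin n} {L R L' R' : List ℚ} {x : ℚ}
    (h : D.curve j = L ++ x :: R) (h' : D.curve k = L' ++ x :: R') : j = k ∧ L = L' ∧ R = R' := by
  obtain ⟨rfl, hl⟩ := D.point_unique j k L.length L'.length x (by simp [h]) (by simp [h'])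
  have := h.symm.trans h'
  obtain ⟨rfl, h2⟩ := List.append_inj this hl
  exact ⟨rfl, rfl, (List.cons.inj h2).2⟩

theorem eq_of_mem {D : VCD n} {j k : Fin n} {x : ℚ} (h : x ∈ D.curve j) (h' : x ∈ D.curve k) :
    j = k := by
  obtain ⟨L, R, h⟩ := List.append_of_mem h
  obtain ⟨L', R', h'⟩ := List.append_of_mem h'
  exact (split_unique h h').1

theorem nodup_curve (D : VCD n) (j : Fin n) : (D.curve j).Nodup := by
  rw [List.nodup_iff_getElem?_ne_getElem?]
  intro a b hab hb h
  have := D.point_unique j j a b _ (List.getElem?_eq_getElem (by omega))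
    (h ▸ List.getElem?_eq_getElem (by omega))
  omega

theorem finite_points (D : VCD n) : D.points.Finite := by
  have : D.points = ⋃ j, {x | x ∈ D.curve j} := by ext; simp [points]
  rw [this]
  exact Set.finite_iUnion fun j => List.finite_toSet _

/-- The terminal point of a curve. -/
def tm (D : VCD n) (j : Fin n) : ℚ := (D.curve j).getLast (D.curve_ne_nil j)

theorem curve_eq (D : VCD n) (j : Fin n) : D.curve j = (D.curve j).dropLast ++ [D.tm j] :=
  (List.dropLast_append_getLast _).symm

theorem tm_eq {D : VCD n} {j : Fin n} {L : List ℚ} {t : ℚ} (h : D.curve j = L ++ [t]) :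
    D.tm j = t := by
  simp [tm, h]

theorem tm_mem (D : VCD n) (j : Fin n) : D.tm j ∈ D.curve j := List.getLast_mem _

theorem tm_mem_points (D : VCD n) (j : Fin n) : D.tm j ∈ D.points := ⟨j, D.tm_mem j⟩

theorem tm_injective (D : VCD n) : Function.Injective D.tm := fun j k h =>
  eq_of_mem (D.tm_mem j) (h ▸ D.tm_mem k)

theorem isTerminal_iff {D : VCD n} {t : ℚ} : D.IsTerminal t ↔ ∃ j, D.tm j = t := by
  simp only [IsTerminal, tm, List.getLast?_eq_getLast_of_ne_nil (D.curve_ne_nil _),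
    Option.some.injEq]

theorem tm_of_mem {D : VCD n} {j : Fin n} {t : ℚ} (h : D.IsTerminal t) (hm : t ∈ D.curve j) :
    D.tm j = t := by
  obtain ⟨k, rfl⟩ := isTerminal_iff.1 h
  rw [eq_of_mem hm (D.tm_mem k)]

/-- The number of terminal points to the left of a place. -/
def rank (D : VCD n) (x : ℚ) : ℕ := (Finset.univ.filter fun j => D.tm j < x).card

theorem rank_add {D : VCD n} {x y : ℚ} (h : x ≤ y) :
    D.rank y = D.rank x + (Finset.univ.filter fun j => x ≤ D.tm j ∧ D.tm j < y).card := by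
  rw [rank, rank, ← Finset.card_union_of_disjoint]
  · congr 1
    ext j
    simp only [Finset.mem_filter, Finset.mem_univ, true_and, Finset.mem_union]
    constructor
    · intro hj
      rcases lt_or_ge (D.tm j) x with h1 | h1
      · exact Or.inl h1
      · exact Or.inr ⟨h1, hj⟩
    · rintro (h1 | h1)
      · exact h1.trans_le h
      · exact h1.2
  · rw [Finset.disjoint_filter]
    exact fun j _ h1 h2 => absurd h1 (not_lt.2 h2.1)

theorem rank_mono {D : VCD n} {x y : ℚ} (h : x ≤ y) : D.rank x ≤ D.rank y := by
  rw [rank_add h]; omega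

theorem rank_lt {D : VCD n} {x y t : ℚ} (ht : D.IsTerminal t) (h : x ≤ t) (h' : t < y) :
    D.rank x < D.rank y := by
  obtain ⟨j, rfl⟩ := isTerminal_iff.1 ht
  rw [rank_add (h.trans h'.le)]
  have : 0 < (Finset.univ.filter fun k => x ≤ D.tm k ∧ D.tm k < y).card :=
    Finset.card_pos.2 ⟨j, by simp [h, h']⟩
  omega

theorem rank_eq {D : VCD n} {x y : ℚ} (h : ∀ j, D.tm j < x ↔ D.tm j < y) :
    D.rank x = D.rank y := by
  simp only [rank, h]

theorem rank_succ {D : VCD n} {x y t : ℚ} (ht : D.IsTerminal t) (hx : x ≤ t) (hy : t < y)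
    (h : ∀ s, D.IsTerminal s → x ≤ s → s < y → s = t) : D.rank y = D.rank x + 1 := by
  obtain ⟨j, rfl⟩ := isTerminal_iff.1 ht
  rw [rank_add (hx.trans hy.le)]
  congr 1
  rw [Finset.card_eq_one]
  refine ⟨j, ?_⟩
  ext k
  simp only [Finset.mem_filter, Finset.mem_univ, true_and, Finset.mem_singleton]
  constructor
  · rintro ⟨h1, h2⟩
    exact D.tm_injective (h _ (isTerminal_iff.2 ⟨k, rfl⟩) h1 h2)
  · rintro rfl
    exact ⟨hx, hy⟩

theorem ncard_terminal_lt (D : VCD n) (p : ℚ) :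
    {t | D.IsTerminal t ∧ t < p}.ncard = D.rank p := by
  have : {t | D.IsTerminal t ∧ t < p} =
      D.tm '' ((Finset.univ.filter fun j => D.tm j < p : Finset (Fin n)) : Set (Fin n)) := by
    ext t
    simp only [Set.mem_ofPred_eq, isTerminal_iff, Set.mem_image, Finset.coe_filter, Finset.mem_univ,
      true_and]
    constructor
    · rintro ⟨⟨j, rfl⟩, h⟩; exact ⟨j, h, rfl⟩
    · rintro ⟨j, h, rfl⟩; exact ⟨⟨j, rfl⟩, h⟩
  rw [this, Set.ncard_image_of_injective _ D.tm_injective, Set.ncard_coe_finset, rank]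

theorem rank_lt_card {D : VCD n} {t : ℚ} (ht : D.IsTerminal t) : D.rank t < n := by
  obtain ⟨j, rfl⟩ := isTerminal_iff.1 ht
  have : (Finset.univ.filter fun k => D.tm k < D.tm j) ⊂ Finset.univ := by
    rw [Finset.ssubset_univ_iff, Ne, Finset.eq_univ_iff_forall]
    intro h
    simpa using h j
  simpa [rank] using Finset.card_lt_card this

/-- The terminal points of curves that end with an over arc. -/
def overEnds (D : VCD n) : Set ℚ := {t | ∃ j, D.tm j = t ∧ Even (D.curve j).length}

theorem mem_overEnds_iff {D : VCD n} {j : Fin n} {t : ℚ} (h : t ∈ D.curve j) :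
    t ∈ D.overEnds ↔ D.tm j = t ∧ Even (D.curve j).length := by
  constructor
  · rintro ⟨k, rfl, hk⟩
    obtain rfl := eq_of_mem h (D.tm_mem k)
    exact ⟨rfl, hk⟩
  · exact fun h => ⟨j, h⟩

theorem isTerminal_of_mem_overEnds {D : VCD n} {t : ℚ} (h : t ∈ D.overEnds) : D.IsTerminal t := by
  obtain ⟨j, h, -⟩ := h
  exact isTerminal_iff.2 ⟨j, h⟩

theorem mem_overEnds_iff_isOverArc {D : VCD n} {t : ℚ} :
    t ∈ D.overEnds ↔ D.IsTerminal t ∧ ∃ x, D.IsOverArc x t := by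
  constructor
  · intro h
    refine ⟨isTerminal_of_mem_overEnds h, ?_⟩
    obtain ⟨j, rfl, hj⟩ := h
    have h1 := D.curve_eq j
    have h2 : (D.curve j).dropLast ≠ [] := by
      intro h0
      rw [h1, h0] at hj
      simp at hj
    refine ⟨(D.curve j).dropLast.getLast h2, isOverArc_iff.2
      ⟨j, (D.curve j).dropLast.dropLast, [], ?_, ?_⟩⟩
    · conv_lhs => rw [h1, ← List.dropLast_append_getLast h2]
      simp
    · have h3 : (D.curve j).dropLast.length ≠ 0 := fun h => h2 (List.length_eq_zero_iff.1 h)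
      rw [List.length_dropLast] at h3
      rw [List.length_dropLast, List.length_dropLast]
      obtain ⟨a, ha⟩ := hj
      exact ⟨a - 1, by omega⟩
  · rintro ⟨ht, x, hx⟩
    obtain ⟨j, L, R, h, hL⟩ := isOverArc_iff.1 hx
    have hm : t ∈ D.curve j := by simp [h]
    have h1 := tm_of_mem ht hm
    refine ⟨j, h1, ?_⟩
    have h2 := D.curve_eq j
    rw [h1] at h2
    have h3 : D.curve j = (L ++ [x]) ++ t :: R := by simp [h]
    obtain ⟨-, -, rfl⟩ := split_unique h3 h2
    rw [h3]
    simp only [List.length_append, List.length_cons, List.length_nil]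
    obtain ⟨a, ha⟩ := hL
    exact ⟨a + 1, by omega⟩

theorem hasTerminalOverArc_iff {D : VCD n} :
    D.HasTerminalOverArc ↔ ∃ j, Even (D.curve j).length := by
  constructor
  · rintro ⟨x, t, hx, ht⟩
    obtain ⟨j, -, h⟩ := mem_overEnds_iff_isOverArc.2 ⟨ht, x, hx⟩
    exact ⟨j, h⟩
  · rintro ⟨j, h⟩
    obtain ⟨ht, x, hx⟩ := mem_overEnds_iff_isOverArc.1 (show D.tm j ∈ D.overEnds from ⟨j, rfl, h⟩)
    exact ⟨x, _, hx, ht⟩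

/-! ### Holonomy labels along the curves -/

section Labels

variable {G : Type*} [Group G]

/-- The labels of the points of a list, given the contribution `e x` of crossing the line at `x`.
The flag is `true` when the curve is below the line.  The element carried along is the holonomy
of the curve so far, and the label of a crossing is its value below the line. -/
def lab (e : ℚ → G) : Bool → G → List ℚ → List (ℚ × G)
  | _, _, [] => []
  | true, g, x :: l => (x, g) :: lab e false (g * (e x)⁻¹) l
  | false, g, x :: l => (x, g * e x) :: lab e true (g * e x) l

/-- The holonomy after passing all points of a list. -/
def hol (e : ℚ → G) : Bool → G → List ℚ → G
  | _, g, [] => g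
  | true, g, x :: l => hol e false (g * (e x)⁻¹) l
  | false, g, x :: l => hol e true (g * e x) l

/-- The side of the line after passing all points of a list. -/
def side : Bool → List ℚ → Bool
  | s, [] => s
  | s, _ :: l => side (!s) l

theorem side_eq (s : Bool) (l : List ℚ) : side s l = if Even l.length then s else !s := by
  induction l generalizing s with
  | nil => simp [side]
  | cons x l ih =>
    rw [side, ih, List.length_cons]
    by_cases h : Even l.length <;> simp [h, Nat.even_add_one]

theorem side_of_even {l : List ℚ} (h : Even l.length) : side true l = true := by simp [side_eq, h]

theorem side_of_odd {l : List ℚ} (h : Odd l.length) : side true l = false := by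
  simp [side_eq, Nat.not_even_iff_odd.2 h]

theorem lab_append (e : ℚ → G) (s : Bool) (g : G) (L R : List ℚ) :
    lab e s g (L ++ R) = lab e s g L ++ lab e (side s L) (hol e s g L) R := by
  induction L generalizing s g with
  | nil => cases s <;> rfl
  | cons x L ih => cases s <;> simp [lab, hol, side, ih]

theorem hol_append (e : ℚ → G) (s : Bool) (g : G) (L R : List ℚ) :
    hol e s g (L ++ R) = hol e (side s L) (hol e s g L) R := by
  induction L generalizing s g with
  | nil => cases s <;> rfl
  | cons x L ih => cases s <;> simp [hol, side, ih]

theorem side_append (s : Bool) (L R : List ℚ) : side s (L ++ R) = side (side s L) R := by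
  induction L generalizing s with
  | nil => rfl
  | cons x L ih => simp [side, ih]

theorem map_fst_lab (e : ℚ → G) (s : Bool) (g : G) (l : List ℚ) :
    (lab e s g l).map Prod.fst = l := by
  induction l generalizing s g with
  | nil => simp [lab]
  | cons x l ih => cases s <;> simp [lab, ih]

theorem lab_congr {e e' : ℚ → G} {l : List ℚ} (h : ∀ x ∈ l, e x = e' x) (s : Bool) (g : G) :
    lab e s g l = lab e' s g l := by
  induction l generalizing s g with
  | nil => simp [lab]
  | cons x l ih =>
    have := ih fun y hy => h y (by simp [hy])
    cases s <;> simp [lab, h x, this]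

theorem hol_congr {e e' : ℚ → G} {l : List ℚ} (h : ∀ x ∈ l, e x = e' x) (s : Bool) (g : G) :
    hol e s g l = hol e' s g l := by
  induction l generalizing s g with
  | nil => simp [hol]
  | cons x l ih =>
    have := ih fun y hy => h y (by simp [hy])
    cases s <;> simp [hol, h x, this]

theorem lab_map {e e' : ℚ → G} {f : ℚ → ℚ} {l : List ℚ} (h : ∀ x ∈ l, e' (f x) = e x) (s : Bool)
    (g : G) : lab e' s g (l.map f) = (lab e s g l).map (Prod.map f id) := by
  induction l generalizing s g with
  | nil => simp [lab]
  | cons x l ih =>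
    have := ih fun y hy => h y (by simp [hy])
    cases s <;> simp [lab, h x, this]

theorem hol_map {e e' : ℚ → G} {f : ℚ → ℚ} {l : List ℚ} (h : ∀ x ∈ l, e' (f x) = e x) (s : Bool)
    (g : G) : hol e' s g (l.map f) = hol e s g l := by
  induction l generalizing s g with
  | nil => simp [hol]
  | cons x l ih =>
    have := ih fun y hy => h y (by simp [hy])
    cases s <;> simp [hol, h x, this]

end Labels

open FreeGroup (of)

/-- The letter of the gap between terminal points that contains `x`. -/
def letter (D : VCD n) (x : ℚ) : FreeGroup ℕ := of (D.rank x)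

open Classical in
/-- The indicator function of the complement of `R`. -/
noncomputable def keep (R : Set ℚ) (x : ℚ) : Bool := decide (x ∉ R)

theorem keep_eq_true {R : Set ℚ} {x : ℚ} : keep R x = true ↔ x ∉ R := by simp [keep]

theorem keep_of_mem {R : Set ℚ} {x : ℚ} (h : x ∈ R) : keep R x = false := by simp [keep, h]

theorem keep_of_notMem {R : Set ℚ} {x : ℚ} (h : x ∉ R) : keep R x = true := by simp [keep, h]

/-- The configuration of a diagram: its points outside `R`, labelled by the holonomy. -/
noncomputable def config (D : VCD n) (R : Set ℚ) : Config n (FreeGroup ℕ) := fun j =>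
  (lab D.letter true 1 (D.curve j)).filter fun z => keep R z.1

/-- The generator around the `k`-th puncture, based below or above the line. -/
def loopElt (s : Bool) (k : ℕ) : FreeGroup ℕ :=
  if s then (of k)⁻¹ * of (k + 1) else of (k + 1) * (of k)⁻¹

/-- The loop that follows the curve `j` to its terminal point, runs around that puncture, and
returns along the curve. -/
def loop (D : VCD n) (j : Fin n) : FreeGroup ℕ :=
  hol D.letter true 1 (D.curve j).dropLast * loopElt (side true (D.curve j).dropLast)
    (D.rank (D.tm j)) * (hol D.letter true 1 (D.curve j).dropLast)⁻¹

theorem loop_eq {D : VCD n} {j : Fin n} {L : List ℚ} {t : ℚ} (h : D.curve j = L ++ [t]) :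
    D.loop j = hol D.letter true 1 L * loopElt (side true L) (D.rank t) *
      (hol D.letter true 1 L)⁻¹ := by
  rw [loop, tm_eq h]
  simp [h]

theorem map_fst_config (D : VCD n) (R : Set ℚ) (j : Fin n) :
    ((D.config R) j).map Prod.fst = (D.curve j).filter (keep R) := by
  conv_rhs => rw [← map_fst_lab D.letter true 1 (D.curve j)]
  rw [List.filter_map]
  rfl

theorem mem_pts_config {D : VCD n} {R : Set ℚ} {x : ℚ} :
    x ∈ (D.config R).pts ↔ x ∈ D.points ∧ x ∉ R := by
  simp only [Config.pts, map_fst_config, Set.mem_ofPred_eq, List.mem_filter, keep_eq_true,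
    points]
  exact exists_and_right

theorem simple_config (D : VCD n) (R : Set ℚ) : (D.config R).Simple := by
  refine ⟨fun j => ?_, fun j k hjk x hx hx' => ?_⟩
  · rw [map_fst_config]
    exact (D.nodup_curve j).filter _
  · rw [map_fst_config, List.mem_filter] at hx hx'
    exact hjk (eq_of_mem hx.1 hx'.1)

theorem filter_lab_congr {G : Type*} [Group G] {e : ℚ → G} {s : Bool} {g : G} {l : List ℚ}
    {R S : Set ℚ} (h : ∀ x ∈ l, x ∈ R ↔ x ∈ S) :
    ((lab e s g l).filter fun z => keep R z.1) = (lab e s g l).filter fun z => keep S z.1 := by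
  apply List.filter_congr
  intro z hz
  have : z.1 ∈ l := by
    rw [← map_fst_lab e s g l]
    exact List.mem_map.2 ⟨z, hz, rfl⟩
  have h := h _ this
  by_cases hz : z.1 ∈ R
  · rw [keep_of_mem hz, keep_of_mem (h.1 hz)]
  · rw [keep_of_notMem hz, keep_of_notMem fun h' => hz (h.2 h')]

/-- Removal of two consecutive points, seen in the configuration. -/
theorem del_config {D : VCD n} {R : Set ℚ} {j : Fin n} {L T : List ℚ} {b c : ℚ}
    (hj : D.curve j = L ++ b :: c :: T) (hb : b ∉ R) (hc : c ∉ R)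
    (hr : Even L.length → D.rank b = D.rank c)
    (ha : ∀ z ∈ D.points, z ∉ R → ¬ (min b c < z ∧ z < max b c)) :
    Config.Del (D.config R) (D.config (R ∪ {b, c})) := by
  have hnd := D.nodup_curve j
  rw [hj, List.nodup_append] at hnd
  obtain ⟨-, hnd1, hnd2⟩ := hnd
  simp only [List.nodup_cons, List.mem_cons, not_or] at hnd1
  have hL : ∀ x ∈ L, (x ∈ R ↔ x ∈ R ∪ {b, c}) := by
    intro x hx
    have h1 := hnd2 x hx b (by simp)
    have h2 := hnd2 x hx c (by simp)
    simp [h1, h2]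
  have hT : ∀ x ∈ T, (x ∈ R ↔ x ∈ R ∪ {b, c}) := by
    intro x hx
    have h1 : x ≠ b := fun h => hnd1.1.2 (h ▸ hx)
    have h2 : x ≠ c := fun h => hnd1.2.1 (h ▸ hx)
    simp [h1, h2]
  obtain ⟨u, g, hu⟩ : ∃ u g, lab D.letter true 1 (D.curve j) = lab D.letter true 1 L ++
      (b, u) :: (c, u) :: lab D.letter (side true L) g T := by
    rw [hj, lab_append]
    by_cases he : Even L.length
    · rw [side_of_even he]
      exact ⟨hol D.letter true 1 L, hol D.letter true 1 L, by simp [lab, letter, hr he]⟩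
    · rw [side_of_odd (Nat.not_even_iff_odd.1 he)]
      exact ⟨_, _, rfl⟩
  refine ⟨j, (lab D.letter true 1 L).filter (fun z => keep R z.1),
    (lab D.letter (side true L) g T).filter (fun z => keep R z.1), b, c, u, ?_, ?_, ?_⟩
  · rw [config, hu, List.filter_append, List.filter_cons_of_pos (by simpa using keep_of_notMem hb),
      List.filter_cons_of_pos (by simpa using keep_of_notMem hc)]
  · intro z hz
    rw [mem_pts_config] at hz
    exact ha z hz.1 hz.2
  · funext k
    by_cases hkj : k = j
    · subst hkj
      rw [Function.update_self, config, hu, List.filter_append,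
        List.filter_cons_of_neg (by simp [keep]), List.filter_cons_of_neg (by simp [keep]),
        filter_lab_congr hL, filter_lab_congr hT]
    · rw [Function.update_of_ne hkj, config, config]
      symm
      apply filter_lab_congr
      intro x hx
      have h1 : x ≠ b := by rintro rfl; exact hkj (eq_of_mem hx (by simp [hj]))
      have h2 : x ≠ c := by rintro rfl; exact hkj (eq_of_mem hx (by simp [hj]))
      simp [h1, h2]

/-- The configuration of a diagram; terminal over arcs, which end in the interior of the punctured
half-plane, do not contribute their end. -/
noncomputable def conf (D : VCD n) : Config n (FreeGroup ℕ) := D.config D.overEnds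

/-- Agreement of the invariants of two diagrams. -/
def SameInv (D E : VCD n) : Prop := D.conf.Eqv E.conf ∧ ∀ j, D.loop j = E.loop j

theorem SameInv.refl (D : VCD n) : SameInv D D := ⟨Config.Eqv.refl _, fun _ => rfl⟩
theorem SameInv.symm {D E : VCD n} (h : SameInv D E) : SameInv E D :=
  ⟨h.1.symm, fun j => (h.2 j).symm⟩
theorem SameInv.trans {D E F : VCD n} (h : SameInv D E) (h' : SameInv E F) : SameInv D F :=
  ⟨h.1.trans h'.1, fun j => (h.2 j).trans (h'.2 j)⟩

/-! ### Invariance under relabelling, `T`-moves and `B`-moves -/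

theorem sameInv_of_relabel {D E : VCD n} (h : D.Relabel E) : SameInv D E := by
  obtain ⟨f, hf, hE⟩ := h
  have htm : ∀ j, E.tm j = f (D.tm j) := by
    intro j
    apply tm_eq (L := (D.curve j).dropLast.map f)
    rw [hE]
    conv_lhs => rw [D.curve_eq j]
    simp
  have hrank : ∀ x ∈ D.points, E.rank (f x) = D.rank x := by
    intro x hx
    simp only [rank, htm, hf.lt_iff_lt (D.tm_mem_points _) hx]
  have hlet : ∀ j, ∀ x ∈ D.curve j, E.letter (f x) = D.letter x := by
    intro j x hx
    simp only [letter, hrank x ⟨j, hx⟩]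
  constructor
  · refine Config.Eqv.reposition (simple_config _ _) ⟨f, ?_, fun j => ?_⟩
    · exact hf.mono fun x hx => (mem_pts_config.1 hx).1
    · rw [conf, config, conf, config, hE, lab_map (hlet j), List.filter_map]
      congr 1
      refine Eq.trans ?_ (filter_lab_congr (R := f ⁻¹' E.overEnds) (S := D.overEnds) ?_)
      · rfl
      intro x hx
      have hx' : f x ∈ E.curve j := by rw [hE]; exact List.mem_map.2 ⟨x, hx, rfl⟩
      rw [Set.mem_preimage, mem_overEnds_iff hx, mem_overEnds_iff hx', htm, hE, List.length_map,
        hf.injOn.eq_iff (D.tm_mem_points j) ⟨j, hx⟩]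
  · intro j
    have h1 := D.curve_eq j
    have h2 : E.curve j = (D.curve j).dropLast.map f ++ [f (D.tm j)] := by
      rw [hE]
      conv_lhs => rw [D.curve_eq j]
      simp
    rw [loop_eq h2, loop_eq h1, hol_map fun x hx => hlet j x (List.dropLast_subset _ hx),
      hrank _ (D.tm_mem_points j), side_eq, side_eq, List.length_map]

theorem sameInv_of_bMove {D E : VCD n} (h : D.BMove E) : SameInv D E := by
  obtain ⟨j, L, R, b, c, hj, hR, ha, hE⟩ := h
  have hEj : E.curve j = L ++ R := by rw [hE, Function.update_self]
  have hEk : ∀ k, k ≠ j → E.curve k = D.curve k := fun k hk => by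
    rw [hE, Function.update_of_ne hk]
  obtain ⟨R', t, rfl⟩ : ∃ R' t, R = R' ++ [t] := ⟨_, _, (List.dropLast_append_getLast hR).symm⟩
  have htm : ∀ k, E.tm k = D.tm k := by
    intro k
    by_cases hk : k = j
    · subst hk
      rw [tm_eq (L := L ++ R') (t := t) (by simp [hEj]),
        tm_eq (L := L ++ b :: c :: R') (t := t) (by simp [hj])]
    · simp only [tm, hEk k hk]
  have hrank : E.rank = D.rank := by
    funext x
    simp only [rank, htm]
  have hlet : E.letter = D.letter := by
    funext x; simp only [letter, hrank]
  have hnd := D.nodup_curve j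
  rw [hj, List.nodup_append] at hnd
  obtain ⟨-, hnd1, hnd2⟩ := hnd
  simp only [List.nodup_cons, List.mem_cons, not_or] at hnd1
  have hjt : D.tm j = t := tm_eq (L := L ++ b :: c :: R') (by simp [hj])
  have hbj : D.tm j ≠ b := by rw [hjt]; rintro rfl; exact hnd1.1.2 (by simp)
  have hcj : D.tm j ≠ c := by rw [hjt]; rintro rfl; exact hnd1.2.1 (by simp)
  have hb : b ∉ D.overEnds := fun h =>
    hbj ((mem_overEnds_iff (j := j) (by simp [hj])).1 h).1
  have hc : c ∉ D.overEnds := fun h =>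
    hcj ((mem_overEnds_iff (j := j) (by simp [hj])).1 h).1
  have hbc : D.rank b = D.rank c := by
    apply rank_eq
    intro k
    have h1 := ha (D.tm k) (D.tm_mem_points k)
    have h2 : D.tm k ≠ b := by
      intro h
      obtain rfl := eq_of_mem (D.tm_mem k) (h ▸ (by simp [hj]) : D.tm k ∈ D.curve j)
      exact hbj h
    have h3 : D.tm k ≠ c := by
      intro h
      obtain rfl := eq_of_mem (D.tm_mem k) (h ▸ (by simp [hj]) : D.tm k ∈ D.curve j)
      exact hcj h
    simp only [min_lt_iff, lt_max_iff] at h1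
    grind
  have hholbc : hol D.letter (side true L) (hol D.letter true 1 L) [b, c] =
      hol D.letter true 1 L := by
    cases side true L <;> simp [hol, letter, hbc]
  have hover : E.overEnds = D.overEnds := by
    ext x
    have : ∀ k, Even (E.curve k).length ↔ Even (D.curve k).length := by
      intro k
      by_cases hk : k = j
      · subst hk
        rw [hEj, hj]
        simp only [List.length_append, List.length_cons]
        rw [show L.length + (R'.length + (([] : List ℚ).length + 1) + 1 + 1) =
          L.length + (R'.length + (([] : List ℚ).length + 1)) + 2 by omega, Nat.even_add (n := 2), iff_true_right even_two]
      · rw [hEk k hk]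
    simp only [overEnds, htm, this]
  constructor
  · have h1 := del_config (R := D.overEnds) hj hb hc (fun _ => hbc) fun z hz _ => ha z hz
    have h2 : E.conf = D.config (D.overEnds ∪ {b, c}) := by
      funext k
      rw [conf, config, config, hover, hlet]
      by_cases hk : k = j
      · subst hk
        have e : lab D.letter true 1 (D.curve k) = lab D.letter true 1 L ++
            (lab D.letter (side true L) (hol D.letter true 1 L) [b, c] ++
              lab D.letter (side true L) (hol D.letter true 1 L) (R' ++ [t])) := by
          rw [hj, show b :: c :: (R' ++ [t]) = [b, c] ++ (R' ++ [t]) from rfl, lab_append,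
            lab_append (L := [b, c]), hholbc]
          simp [side]
        have e0 : ∀ p : ℚ × FreeGroup ℕ → Bool, (∀ z, z.1 = b ∨ z.1 = c → p z = false) →
            (lab D.letter (side true L) (hol D.letter true 1 L) [b, c]).filter p = [] := by
          intro p hp
          rw [List.filter_eq_nil_iff]
          intro z hz
          have : z.1 ∈ [b, c] := by
            rw [← map_fst_lab D.letter (side true L) (hol D.letter true 1 L) [b, c]]
            exact List.mem_map.2 ⟨z, hz, rfl⟩
          simp [hp z (by simpa using this)]
        rw [e, hEj, lab_append, List.filter_append, List.filter_append, List.filter_append, e0,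
          List.nil_append]
        · congr 1
          · apply filter_lab_congr
            intro x hx
            have h1 := hnd2 x hx b (by simp)
            have h2 := hnd2 x hx c (by simp)
            simp [h1, h2]
          · apply filter_lab_congr
            intro x hx
            have h1 : x ≠ b := fun h => hnd1.1.2 (h ▸ hx)
            have h2 : x ≠ c := fun h => hnd1.2.1 (h ▸ hx)
            simp [h1, h2]
        · rintro z (hz | hz) <;> simp [hz, keep]
      · rw [hEk k hk]
        apply filter_lab_congr
        intro x hx
        have h1 : x ≠ b := by rintro rfl; exact hk (eq_of_mem hx (by simp [hj]))
        have h2 : x ≠ c := by rintro rfl; exact hk (eq_of_mem hx (by simp [hj]))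
        simp [h1, h2]
    rw [h2]
    exact Config.Eqv.del (simple_config _ _) h1
  · intro k
    by_cases hk : k = j
    · subst hk
      rw [loop_eq (L := L ++ b :: c :: R') (t := t) (by simp [hj]),
        loop_eq (L := L ++ R') (t := t) (by simp [hEj]), hlet, hrank]
      have e1 : hol D.letter true 1 (L ++ b :: c :: R') = hol D.letter true 1 (L ++ R') := by
        rw [show L ++ b :: c :: R' = L ++ ([b, c] ++ R') from rfl, hol_append,
          hol_append (L := [b, c]), hholbc, hol_append]
        simp [side]
      have e2 : side true (L ++ b :: c :: R') = side true (L ++ R') := by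
        simp [side_append, side]
      rw [e1, e2]
    · rw [loop_eq (D.curve_eq k), loop_eq (D := E) ((hEk k hk).trans (D.curve_eq k)), hlet, hrank]

theorem sameInv_of_tMove {D E : VCD n} (h : D.TMove E) : SameInv D E := by
  obtain ⟨j, L, a, b, hj, ha, hE⟩ := h
  have hEj : E.curve j = L ++ [a] := by rw [hE, Function.update_self]
  have hEk : ∀ k, k ≠ j → E.curve k = D.curve k := fun k hk => by
    rw [hE, Function.update_of_ne hk]
  have htk : ∀ k, k ≠ j → E.tm k = D.tm k := fun k hk => by simp only [tm, hEk k hk]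
  have htj : E.tm j = a := tm_eq hEj
  have htj' : D.tm j = b := tm_eq (L := L ++ [a]) (by simp [hj])
  have hnd := D.nodup_curve j
  rw [hj, List.nodup_append] at hnd
  obtain ⟨-, hnd1, hnd2⟩ := hnd
  have hab : a ≠ b := by simpa using hnd1
  have hk_ne : ∀ k, k ≠ j → ∀ x ∈ D.curve k, x ≠ a ∧ x ≠ b := by
    intro k hk x hx
    constructor <;> (rintro rfl; exact hk (eq_of_mem hx (by simp [hj])))
  have hL_ne : ∀ x ∈ L, x ≠ a ∧ x ≠ b := fun x hx =>
    ⟨hnd2 x hx a (by simp), hnd2 x hx b (by simp)⟩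
  have hside : ∀ z ∈ D.points, z ≠ a → z ≠ b → (z < a ↔ z < b) := by
    intro z hz h1 h2
    have h3 := ha z hz
    simp only [min_lt_iff, lt_max_iff] at h3
    grind
  have hrank : ∀ z ∈ D.points, z ≠ a → z ≠ b → E.rank z = D.rank z := by
    intro z hz h1 h2
    have h3 := hside z hz h1 h2
    have : ∀ k, E.tm k < z ↔ D.tm k < z := by
      intro k
      by_cases hk : k = j
      · subst hk; rw [htj, htj']; grind
      · rw [htk k hk]
    simp only [rank, this]
  have hranka : E.rank a = D.rank b := by
    have : ∀ k, E.tm k < a ↔ D.tm k < b := by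
      intro k
      by_cases hk : k = j
      · subst hk; rw [htj, htj']; simp
      · rw [htk k hk]
        have h := hk_ne k hk _ (D.tm_mem k)
        exact hside _ (D.tm_mem_points k) h.1 h.2
    simp only [rank, this]
  have hranka' : D.rank a = D.rank b ∨ D.rank a = D.rank b + 1 := by
    rcases lt_or_gt_of_ne hab with h | h
    · left
      apply rank_eq
      intro k
      by_cases hk : k = j
      · subst hk; rw [htj']; simp [h.le]
      · have h := hk_ne k hk _ (D.tm_mem k)
        exact hside _ (D.tm_mem_points k) h.1 h.2
    · right
      refine rank_succ (isTerminal_iff.2 ⟨j, htj'⟩) le_rfl h fun s hs h1 h2 => ?_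
      obtain ⟨k, rfl⟩ := isTerminal_iff.1 hs
      by_cases hk : k = j
      · subst hk; exact htj'
      · have h := hk_ne k hk _ (D.tm_mem k)
        exact absurd ((hside _ (D.tm_mem_points k) h.1 h.2).1 h2) (not_lt.2 h1)
  have hletk : ∀ k, k ≠ j → ∀ x ∈ D.curve k, E.letter x = D.letter x := by
    intro k hk x hx
    have h := hk_ne k hk x hx
    simp only [letter, hrank x ⟨k, hx⟩ h.1 h.2]
  have hletL : ∀ x ∈ L, E.letter x = D.letter x := by
    intro x hx
    have h := hL_ne x hx
    simp only [letter, hrank x ⟨j, by simp [hj, hx]⟩ h.1 h.2]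
  have hloop : ∀ k, D.loop k = E.loop k := by
    intro k
    by_cases hk : k = j
    · subst hk
      rw [loop_eq (L := L ++ [a]) (t := b) (by simp [hj]), loop_eq hEj, hranka, hol_append,
        side_append, hol_congr hletL]
      by_cases he : Even L.length
      · rw [side_of_even he]
        rcases hranka' with h | h <;> simp [hol, side, letter, loopElt, h] <;> group
      · rw [side_of_odd (Nat.not_even_iff_odd.1 he)]
        rcases hranka' with h | h <;> simp [hol, side, letter, loopElt, h] <;> group
    · have h := hk_ne k hk _ (D.tm_mem k)
      rw [loop_eq (D.curve_eq k), loop_eq (D := E) ((hEk k hk).trans (D.curve_eq k)),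
        hol_congr fun x hx => hletk k hk x (List.dropLast_subset _ hx),
        hrank _ (D.tm_mem_points k) h.1 h.2]
  refine ⟨?_, hloop⟩
  have hconfk : ∀ k, k ≠ j → ∀ R : Set ℚ, (∀ x, x ≠ a → x ≠ b → (x ∈ R ↔ x ∈ D.overEnds)) →
      E.conf k = D.config R k := by
    intro k hk R hR
    rw [conf, config, config, hEk k hk, lab_congr (hletk k hk)]
    apply filter_lab_congr
    intro x hx
    have h := hk_ne k hk x hx
    rw [hR x h.1 h.2, mem_overEnds_iff hx, mem_overEnds_iff (D := E) (j := k) (by rwa [hEk k hk]),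
      htk k hk, hEk k hk]
  have hoverL : ∀ x ∈ L, x ∉ D.overEnds ∧ x ∉ E.overEnds := by
    intro x hx
    have h := hL_ne x hx
    constructor
    · rw [mem_overEnds_iff (j := j) (by simp [hj, hx]), htj']
      exact fun h' => h.2 h'.1.symm
    · rw [mem_overEnds_iff (j := j) (by simp [hEj, hx]), htj]
      exact fun h' => h.1 h'.1.symm
  have haE : a ∈ E.overEnds ↔ Odd L.length := by
    rw [mem_overEnds_iff (j := j) (by simp [hEj]), htj, hEj]
    simp [Nat.even_add_one]
  have hbD : b ∈ D.overEnds ↔ Even L.length := by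
    rw [mem_overEnds_iff (j := j) (by simp [hj]), htj', hj]
    simp [Nat.even_add]
  have haD : a ∉ D.overEnds := by
    rw [mem_overEnds_iff (j := j) (by simp [hj]), htj']
    exact fun h => hab h.1.symm
  by_cases he : Even L.length
  · have : E.conf = D.conf := by
      funext k
      by_cases hk : k = j
      · subst hk
        rw [conf, config, conf, config, hEj, hj, show L ++ [a, b] = L ++ ([a] ++ [b]) from rfl,
          lab_append, lab_append, lab_append, lab_congr hletL, hol_congr hletL, List.filter_append,
          List.filter_append, List.filter_append]
        rw [filter_lab_congr (R := E.overEnds) (S := D.overEnds)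
          (fun x hx => by simp [hoverL x hx])]
        congr 1
        have h1 : a ∉ E.overEnds := fun h => Nat.not_even_iff_odd.2 (haE.1 h) he
        simp [side_of_even he, lab, side, keep, h1, haD, hbD.2 he]
      · exact hconfk k hk _ fun x _ _ => Iff.rfl
    rw [this]
    exact Config.Eqv.refl _
  · have ho := Nat.not_even_iff_odd.1 he
    have h1 := del_config (R := D.overEnds) hj haD (fun h => he (hbD.1 h)) (fun h => absurd h he)
      fun z hz _ => ha z hz
    have : E.conf = D.config (D.overEnds ∪ {a, b}) := by
      funext k
      by_cases hk : k = j
      · subst hk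
        rw [conf, config, config, hEj, hj, lab_append, lab_append, lab_congr hletL,
          hol_congr hletL, List.filter_append, List.filter_append]
        rw [filter_lab_congr (R := E.overEnds) (S := D.overEnds ∪ {a, b})
          (fun x hx => by simp [hoverL x hx, hL_ne x hx])]
        congr 1
        simp [side_of_odd ho, lab, keep, haE.2 ho]
      · apply hconfk k hk
        intro x hxa hxb
        simp [hxa, hxb]
    rw [this]
    exact Config.Eqv.del (simple_config _ _) h1

theorem sameInv_of_equivalent {D E : VCD n} (h : Equivalent D E) : SameInv D E := by
  induction h with
  | rel D E h =>
    rcases h with h | h | h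
    · exact sameInv_of_relabel h
    · exact sameInv_of_tMove h
    · exact sameInv_of_bMove h
  | refl D => exact SameInv.refl D
  | symm D E _ ih => exact ih.symm
  | trans D E F _ _ ih1 ih2 => exact ih1.trans ih2

end VCD

/-! ### Pushing off and the Artin action -/

namespace VCD

variable {n : ℕ}

theorem exists_getElem?_of_mem_overEnds {D : VCD n} {t : ℚ} (h : t ∈ D.overEnds) :
    ∃ j a, (D.curve j)[2 * a + 1]? = some t ∧ (D.curve j).length = 2 * a + 2 := by
  obtain ⟨j, rfl, a, ha⟩ := h
  have h0 : (D.curve j).length ≠ 0 := fun h => D.curve_ne_nil j (List.length_eq_zero_iff.1 h)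
  refine ⟨j, a - 1, ?_, by omega⟩
  rw [tm, List.getLast_eq_getElem, List.getElem?_eq_some_iff]
  exact ⟨by omega, by congr 1; omega⟩

theorem underArc_unique {D : VCD n} {x y z : ℚ} (h : D.IsUnderArc x y ∨ D.IsUnderArc y x)
    (h' : D.IsUnderArc x z ∨ D.IsUnderArc z x) : y = z := by
  rcases h with ⟨j, a, h1, h2⟩ | ⟨j, a, h1, h2⟩ <;> rcases h' with ⟨k, b, h3, h4⟩ | ⟨k, b, h3, h4⟩
  · obtain ⟨rfl, h⟩ := D.point_unique _ _ _ _ _ h1 h3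
    obtain rfl : a = b := by omega
    simpa [h2] using h4
  · obtain ⟨rfl, h⟩ := D.point_unique _ _ _ _ _ h1 h4
    omega
  · obtain ⟨rfl, h⟩ := D.point_unique _ _ _ _ _ h2 h3
    omega
  · obtain ⟨rfl, h⟩ := D.point_unique _ _ _ _ _ h2 h4
    obtain rfl : a = b := by omega
    simpa [h1] using h3

theorem overArc_unique {D : VCD n} {x y z : ℚ} (h : D.IsOverArc x y ∨ D.IsOverArc y x)
    (h' : D.IsOverArc x z ∨ D.IsOverArc z x) : y = z := by
  rcases h with ⟨j, a, h1, h2⟩ | ⟨j, a, h1, h2⟩ <;> rcases h' with ⟨k, b, h3, h4⟩ | ⟨k, b, h3, h4⟩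
  · obtain ⟨rfl, h⟩ := D.point_unique _ _ _ _ _ h1 h3
    obtain rfl : a = b := by omega
    simpa [h2] using h4
  · obtain ⟨rfl, h⟩ := D.point_unique _ _ _ _ _ h1 h4
    omega
  · obtain ⟨rfl, h⟩ := D.point_unique _ _ _ _ _ h2 h3
    omega
  · obtain ⟨rfl, h⟩ := D.point_unique _ _ _ _ _ h2 h4
    obtain rfl : a = b := by omega
    simpa [h1] using h3

theorem notMem_overEnds_of_underArc {D : VCD n} {x y : ℚ}
    (h : D.IsUnderArc x y ∨ D.IsUnderArc y x) : x ∉ D.overEnds := by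
  intro hx
  obtain ⟨k, b, h3, h4⟩ := exists_getElem?_of_mem_overEnds hx
  rcases h with ⟨j, a, h1, h2⟩ | ⟨j, a, h1, h2⟩
  · obtain ⟨rfl, h⟩ := D.point_unique _ _ _ _ _ h1 h3
    have := (List.getElem?_eq_some_iff.1 h2).1
    omega
  · obtain ⟨rfl, h⟩ := D.point_unique _ _ _ _ _ h2 h3
    omega

theorem mem_points_of_underArc {D : VCD n} {x y : ℚ}
    (h : D.IsUnderArc x y ∨ D.IsUnderArc y x) : x ∈ D.points := by
  rcases h with ⟨j, a, h1, h2⟩ | ⟨j, a, h1, h2⟩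
  · exact ⟨j, List.mem_of_getElem? h1⟩
  · exact ⟨j, List.mem_of_getElem? h2⟩

/-- The part of the line between `l` and `r` consists of the end `p` of a terminal over arc and of
the endpoints of nested under arcs running around `p`. -/
structure Nested (D : VCD n) (l p r : ℚ) : Prop where
  mem_overEnds : p ∈ D.overEnds
  lt_left : l < p
  lt_right : p < r
  partner : ∀ x ∈ D.points, l < x → x < r → x ≠ p →
    ∃ y, (D.IsUnderArc x y ∨ D.IsUnderArc y x) ∧ l < y ∧ y < r ∧ min x y < p ∧ p < max x y
  nested : ∀ x y z w, (D.IsUnderArc x y ∨ D.IsUnderArc y x) →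
    (D.IsUnderArc z w ∨ D.IsUnderArc w z) →
    l < x → x < z → z < p → p < y → y < r → p < w → w < r → w < y

theorem config_congr {D : VCD n} {R S : Set ℚ} (h : ∀ x ∈ D.points, x ∈ R ↔ x ∈ S) :
    D.config R = D.config S := by
  funext j
  exact filter_lab_congr fun x hx => h x ⟨j, hx⟩

theorem del_config_of_underArc {D : VCD n} {R : Set ℚ} {b c : ℚ}
    (h : D.IsUnderArc b c ∨ D.IsUnderArc c b) (hb : b ∉ R) (hc : c ∉ R)
    (ha : ∀ z ∈ D.points, z ∉ R → ¬ (min b c < z ∧ z < max b c)) :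
    (D.config R).Del (D.config (R ∪ {b, c})) := by
  rcases h with h | h
  · obtain ⟨j, L, T, hj, hL⟩ := isUnderArc_iff.1 h
    exact del_config hj hb hc (fun h => absurd hL (Nat.not_odd_iff_even.2 h)) ha
  · obtain ⟨j, L, T, hj, hL⟩ := isUnderArc_iff.1 h
    rw [Set.pair_comm]
    refine del_config hj hc hb (fun h => absurd hL (Nat.not_odd_iff_even.2 h)) ?_
    rwa [min_comm, max_comm]

/-- The outermost of the nested arcs bounds a smaller part of the line of the same kind. -/
theorem Nested.inner {D : VCD n} {l p r z : ℚ} (h : D.Nested l p r) (hz : z ∈ D.points)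
    (hlz : l < z) (hzp : z < p) (hmin : ∀ b ∈ D.points, l < b → b < p → z ≤ b) :
    ∃ z', (D.IsUnderArc z z' ∨ D.IsUnderArc z' z) ∧ p < z' ∧ z' < r ∧ D.Nested z p z' := by
  obtain ⟨z', hzz', h4, h5, h6, h7⟩ := h.partner z hz hlz (hzp.trans h.lt_right) hzp.ne
  have hpz' : p < z' := by
    rcases lt_max_iff.1 h7 with h8 | h8
    · exact absurd h8 (not_lt.2 hzp.le)
    · exact h8
  refine ⟨z', hzz', hpz', h5, h.mem_overEnds, hzp, hpz', fun x hx h1 h2 h3 => ?_,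
    fun x y u w hxy huw h1 h2 h3 h8 h9 h10 h11 => h.nested x y u w hxy huw (hlz.trans h1) h2 h3 h8
      (h9.trans h5) h10 (h11.trans h5)⟩
  obtain ⟨y, hy, h8, h9, h10, h11⟩ := h.partner x hx (hlz.trans h1) (h2.trans h5) h3
  refine ⟨y, hy, ?_, ?_, h10, h11⟩
  · rcases lt_or_gt_of_ne h3 with hxp | hxp
    · rcases lt_max_iff.1 h11 with h | h <;> linarith
    · have hyp : y < p := by rcases min_lt_iff.1 h10 with h | h <;> linarith
      rcases (hmin y (mem_points_of_underArc hy.symm) h8 hyp).lt_or_eq with h12 | h12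
      · exact h12
      · subst h12
        exact absurd (underArc_unique hzz' hy.symm) h2.ne'
  · rcases lt_or_gt_of_ne h3 with hxp | hxp
    · have hpy : p < y := by rcases lt_max_iff.1 h11 with h | h <;> linarith
      exact h.nested z z' x y hzz' hy hlz h1 hxp hpz' h5 hpy h9
    · rcases min_lt_iff.1 h10 with h | h <;> linarith

/-- Under arcs nested around the end of a terminal over arc cancel in the configuration, the
innermost one first. -/
theorem Nested.eqv {D : VCD n} {l p r : ℚ} (h : D.Nested l p r) :
    D.conf.Eqv (D.config (D.overEnds ∪ Set.Ioo l r)) := by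
  induction hm : (D.points ∩ Set.Ioo l r).ncard using Nat.strong_induction_on generalizing l r with
  | _ m ih =>
  by_cases he : ∃ x ∈ D.points, l < x ∧ x < r ∧ x ≠ p
  · have hlow : {x | x ∈ D.points ∧ l < x ∧ x < p}.Nonempty := by
      obtain ⟨x, hx, h1, h2, h3⟩ := he
      obtain ⟨y, hy, h4, h5, h6, h7⟩ := h.partner x hx h1 h2 h3
      rcases lt_or_gt_of_ne h3 with h8 | h8
      · exact ⟨x, hx, h1, h8⟩
      · refine ⟨y, mem_points_of_underArc hy.symm, h4, ?_⟩
        rcases min_lt_iff.1 h6 with h9 | h9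
        · exact absurd h9 (not_lt.2 h8.le)
        · exact h9
    obtain ⟨z, ⟨hz, hlz, hzp⟩, hmin⟩ := Set.exists_min_image _ id
      (D.finite_points.subset fun x hx => hx.1) hlow
    simp only [Set.mem_ofPred_eq, id] at hmin
    obtain ⟨z', hzz', hpz', h5, hin⟩ := h.inner hz hlz hzp fun b hb h1 h2 => hmin b ⟨hb, h1, h2⟩
    have hlt : (D.points ∩ Set.Ioo z z').ncard < m := by
      rw [← hm]
      refine Set.ncard_lt_ncard ⟨fun x hx => ⟨hx.1, hlz.trans hx.2.1, hx.2.2.trans h5⟩, fun hs => ?_⟩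
        (D.finite_points.subset fun x hx => hx.1)
      exact lt_irrefl z (hs ⟨hz, hlz, hzp.trans h.lt_right⟩).2.1
    refine (ih _ hlt hin rfl).trans ?_
    have hd := del_config_of_underArc (R := D.overEnds ∪ Set.Ioo z z') hzz'
      (by simp [notMem_overEnds_of_underArc hzz'])
      (by simp [notMem_overEnds_of_underArc hzz'.symm]) (fun x hx hxR => by
        rw [min_eq_left (hzp.trans hpz').le, max_eq_right (hzp.trans hpz').le]
        exact fun h => hxR (Or.inr h))
    have := Config.Eqv.del (simple_config _ _) hd
    rwa [config_congr (R := D.overEnds ∪ Set.Ioo z z' ∪ {z, z'}) (S := D.overEnds ∪ Set.Ioo l r)]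
      at this
    intro x hx
    by_cases hxp : x = p
    · subst hxp
      simp [h.mem_overEnds]
    simp only [Set.mem_union, Set.mem_Ioo, Set.mem_insert_iff, Set.mem_singleton_iff]
    constructor
    · rintro ((h8 | h8) | (rfl | rfl))
      · exact Or.inl h8
      · exact Or.inr ⟨hlz.trans h8.1, h8.2.trans h5⟩
      · exact Or.inr ⟨hlz, hzp.trans h.lt_right⟩
      · exact Or.inr ⟨h.lt_left.trans hpz', h5⟩
    · rintro (h8 | ⟨h8, h9⟩)
      · exact Or.inl (Or.inl h8)
      · obtain ⟨y, hy, h10, h11, h12, h13⟩ := h.partner x hx h8 h9 hxp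
        rcases lt_or_gt_of_ne hxp with hxp | hxp
        · rcases (hmin x ⟨hx, h8, hxp⟩).lt_or_eq with h14 | h14
          · exact Or.inl (Or.inr ⟨h14, hxp.trans hpz'⟩)
          · exact Or.inr (Or.inl h14.symm)
        · have hyp : y < p := by rcases min_lt_iff.1 h12 with h | h <;> linarith
          rcases (hmin y ⟨mem_points_of_underArc hy.symm, h10, hyp⟩).lt_or_eq with h14 | h14
          · exact Or.inl (Or.inr ⟨hzp.trans hxp,
              h.nested z z' y x hzz' hy.symm hlz h14 hyp hpz' h5 hxp h9⟩)
          · subst h14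
            exact Or.inr (Or.inr (underArc_unique hy.symm hzz'))
  · rw [conf, config_congr (S := D.overEnds ∪ Set.Ioo l r)]
    · exact Config.Eqv.refl _
    · intro x hx
      simp only [Set.mem_union, Set.mem_Ioo]
      refine ⟨Or.inl, ?_⟩
      rintro (h1 | ⟨h1, h2⟩)
      · exact h1
      · by_cases hxp : x = p
        · exact hxp ▸ h.mem_overEnds
        · exact absurd ⟨x, hx, h1, h2, hxp⟩ he

/-- `E` arises from `D` by moving the terminal point `t` of a curve to the place `t'`; the terminal
arc is not an over arc. -/
structure MoveEnd (D E : VCD n) (j : Fin n) (L : List ℚ) (t t' : ℚ) : Prop where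
  curve_left : D.curve j = L ++ [t]
  curve_right : E.curve j = L ++ [t']
  curve_of_ne : ∀ k, k ≠ j → E.curve k = D.curve k
  even : Even L.length
  ne : t ≠ t'

namespace MoveEnd

variable {D E : VCD n} {j : Fin n} {L : List ℚ} {t t' : ℚ}

theorem symm (h : MoveEnd D E j L t t') : MoveEnd E D j L t' t :=
  ⟨h.curve_right, h.curve_left, fun k hk => (h.curve_of_ne k hk).symm, h.even, h.ne.symm⟩

theorem mem_points (h : MoveEnd D E j L t t') {x : ℚ} (hx : x ∈ D.points) (hxt : x ≠ t) :
    x ∈ E.points := by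
  obtain ⟨k, hk⟩ := hx
  refine ⟨k, ?_⟩
  by_cases hkj : k = j
  · subst hkj
    rw [h.curve_left, List.mem_append, List.mem_singleton, or_iff_left hxt] at hk
    simp [h.curve_right, hk]
  · rwa [h.curve_of_ne k hkj]

theorem notMem (h : MoveEnd D E j L t t') : t' ∉ D.points := by
  rintro ⟨k, hk⟩
  by_cases hkj : k = j
  · subst hkj
    have hnd := E.nodup_curve k
    rw [h.curve_right, List.nodup_append] at hnd
    rw [h.curve_left, List.mem_append, List.mem_singleton, or_iff_left h.ne.symm] at hk
    exact hnd.2.2 _ hk t' (by simp) rfl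
  · exact hkj (eq_of_mem (D := E) (x := t') (by rwa [h.curve_of_ne k hkj]) (by simp [h.curve_right]))

theorem overArc (h : MoveEnd D E j L t t') {x y : ℚ} (hxy : D.IsOverArc x y) :
    E.IsOverArc x y := by
  obtain ⟨l, hl⟩ := h.even
  obtain ⟨k, m, h1, h2⟩ := hxy
  refine ⟨k, m, ?_⟩
  by_cases hkj : k = j
  · subst hkj
    rw [h.curve_left] at h1 h2
    rw [h.curve_right]
    grind
  · rw [h.curve_of_ne k hkj]; exact ⟨h1, h2⟩

theorem underArc (h : MoveEnd D E j L t t') {x y : ℚ} (hxy : D.IsUnderArc x y ∨ D.IsUnderArc y x)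
    (hx : x ≠ t) (hy : y ≠ t) : E.IsUnderArc x y ∨ E.IsUnderArc y x := by
  have main : ∀ {x y}, D.IsUnderArc x y → x ≠ t → y ≠ t → E.IsUnderArc x y := by
    rintro x y ⟨k, m, h1, h2⟩ hx hy
    refine ⟨k, m, ?_⟩
    by_cases hkj : k = j
    · subst hkj
      rw [h.curve_left] at h1 h2
      rw [h.curve_right]
      grind
    · rw [h.curve_of_ne k hkj]; exact ⟨h1, h2⟩
  exact hxy.imp (main · hx hy) (main · hy hx)

theorem tm_self (h : MoveEnd D E j L t t') : D.tm j = t := tm_eq h.curve_left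

theorem tm_of_ne (h : MoveEnd D E j L t t') {k : Fin n} (hk : k ≠ j) : E.tm k = D.tm k := by
  simp only [tm, h.curve_of_ne k hk]

theorem isTerminal (h : MoveEnd D E j L t t') {s : ℚ} (hs : D.IsTerminal s) (hst : s ≠ t) :
    E.IsTerminal s := by
  obtain ⟨k, rfl⟩ := isTerminal_iff.1 hs
  have hk : k ≠ j := by
    rintro rfl; exact hst h.tm_self
  exact isTerminal_iff.2 ⟨k, h.tm_of_ne hk⟩

theorem length_eq (h : MoveEnd D E j L t t') (k : Fin n) :
    (E.curve k).length = (D.curve k).length := by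
  by_cases hk : k = j
  · subst hk; simp [h.curve_left, h.curve_right]
  · rw [h.curve_of_ne k hk]

theorem numPoints (h : MoveEnd D E j L t t') : E.numPoints = D.numPoints := by
  simp only [VCD.numPoints, h.length_eq]

theorem notMem_overEnds (h : MoveEnd D E j L t t') : t ∉ D.overEnds := by
  rw [mem_overEnds_iff (j := j) (by simp [h.curve_left]), h.curve_left]
  simp [Nat.even_add_one, h.even]

theorem mem_overEnds (h : MoveEnd D E j L t t') {s : ℚ} (hs : s ∈ D.overEnds) :
    s ∈ E.overEnds := by
  have hne : s ≠ t := by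
    rintro rfl; exact h.notMem_overEnds hs
  obtain ⟨k, rfl, hk⟩ := hs
  have hkj : k ≠ j := by
    rintro rfl; exact hne h.tm_self
  exact ⟨k, h.tm_of_ne hkj, by rwa [h.length_eq]⟩

theorem curve_eq_update (h : MoveEnd D E j L t t') :
    E.curve = Function.update D.curve j (L ++ [t']) := by
  funext k
  by_cases hk : k = j
  · subst hk; rw [Function.update_self, h.curve_right]
  · rw [Function.update_of_ne hk, h.curve_of_ne k hk]

theorem of_update (hj : D.curve j = L ++ [t]) (hL : Even L.length) (hne : t ≠ t')
    (hE : E.curve = Function.update D.curve j (L ++ [t'])) : MoveEnd D E j L t t' :=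
  ⟨hj, by rw [hE, Function.update_self], fun k hk => by rw [hE, Function.update_of_ne hk], hL, hne⟩

/-- Moving a terminal point does not affect the nested arcs elsewhere. -/
theorem nested (h : MoveEnd D E j L t t') {l p r : ℚ} (hN : D.Nested l p r)
    (ht : ¬ (l < t ∧ t < r)) (ht' : ¬ (l < t' ∧ t' < r)) : E.Nested l p r := by
  refine ⟨h.mem_overEnds hN.mem_overEnds, hN.lt_left, hN.lt_right, fun x hx h1 h2 h3 => ?_,
    fun x y z w hxy hzw h1 h2 h3 h4 h5 h6 h7 => ?_⟩
  · have hxt' : x ≠ t' := by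
      rintro rfl; exact ht' ⟨h1, h2⟩
    obtain ⟨y, hy, h4, h5, h6⟩ := hN.partner x (h.symm.mem_points hx hxt') h1 h2 h3
    refine ⟨y, h.underArc hy ?_ ?_, h4, h5, h6⟩
    · rintro rfl; exact ht ⟨h1, h2⟩
    · rintro rfl; exact ht ⟨h4, h5⟩
  · have key : ∀ {v}, l < v → v < r → v ≠ t' := by
      rintro v h8 h9 rfl; exact ht' ⟨h8, h9⟩
    have hpr := hN.lt_right
    have hlp := hN.lt_left
    exact hN.nested x y z w
      (h.symm.underArc hxy (key h1 (by linarith)) (key (by linarith) h5))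
      (h.symm.underArc hzw (key (by linarith) (by linarith)) (key (by linarith) h7))
      h1 h2 h3 h4 h5 h6 h7

end MoveEnd

section Twist

variable {G H : Type*} [Group G] [Group H]

/-- The correction `κ` at the last point of a list, when the curve is then below the line. -/
def lastTwist (κ : ℚ → H) (s : Bool) (l : List ℚ) : H :=
  if s then (l.getLast?.map κ).getD 1 else 1

/-- Transport of holonomies along a homomorphism `ψ`, when the letters of the points on the strands
that are dragged along change by an additional factor `κ`, which is constant on under arcs. -/
theorem lab_hol_twist {e : ℚ → G} {e' κ : ℚ → H} (ψ : G →* H) (l : List ℚ)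
    (he : ∀ x ∈ l, e' x = ψ (e x) * κ x) (h0 : ∀ x R, l = x :: R → κ x = 1)
    (hu : ∀ A x y B, l = A ++ x :: y :: B → Odd A.length → κ x = κ y) :
    lab e' true 1 l = (lab e true 1 l).map (fun z => (z.1, ψ z.2 * κ z.1)) ∧
      hol e' true 1 l = ψ (hol e true 1 l) * lastTwist κ (side true l) l := by
  induction l using List.reverseRecOn with
  | nil => simp [lab, hol, lastTwist]
  | append_singleton L x ih =>
    obtain ⟨ih1, ih2⟩ := ih (fun y hy => he y (by simp [hy])) (fun y R h => h0 y (R ++ [x]) (by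
      simp [h])) (fun A y z B h => hu A y z (B ++ [x]) (by simp [h]))
    have hx := he x (by simp)
    rw [lab_append, lab_append, hol_append, hol_append, List.map_append, ih1, ih2, side_append]
    rcases Nat.even_or_odd L.length with hL | hL
    · rw [side_of_even hL]
      have hk : lastTwist κ true L = κ x := by
        rcases List.eq_nil_or_concat L with rfl | ⟨A, y, rfl⟩
        · simp [lastTwist, h0 x [] rfl]
        · have := hu A y x [] (by simp) (by
            rw [List.concat_eq_append, List.length_append] at hL
            simpa [Nat.even_add_one] using hL)
          simp [lastTwist, this]
      rw [hk]
      simp [lab, hol, side, lastTwist, hx]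
    · rw [side_of_odd hL]
      simp [lab, hol, side, lastTwist, hx, mul_assoc]

end Twist

open FreeGroup (of)
open BraidGroup

/-- Pushing off acts on configurations and loops by the Artin automorphism. After the removal of the
strands that are dragged along, the only change is that `q` moves to `q'`, and no point lies between
these places. -/
theorem sigmaStep_conf {i : Fin (n - 1)} {D E : VCD n} (h : D.SigmaStep i E) :
    (D.conf.act (artinAut i.val)).Eqv E.conf ∧ ∀ k, E.loop k = artinAut i.val (D.loop k) := by
  obtain ⟨j, L, p, q, q', hj, hL, hq'p, hpq, hpt, hpi, hpo, hter, hpart, hnest, hE⟩ := h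
  have hpO : p ∈ D.overEnds := mem_overEnds_iff_isOverArc.2 ⟨hpt, hpo⟩
  have hN : D.Nested q' p q := ⟨hpO, hq'p, hpq, hpart, hnest⟩
  have hM : MoveEnd D E j L q q' := .of_update hj hL (hq'p.trans hpq).ne' hE
  have hEj := hM.curve_right
  have hEk := hM.curve_of_ne
  have htj := hM.tm_self
  have htj' := hM.symm.tm_self
  have htk : ∀ k, k ≠ j → E.tm k = D.tm k := fun k hk => hM.tm_of_ne hk
  have hqO := hM.notMem_overEnds
  have hq'O := hM.symm.notMem_overEnds
  have hq'D := hM.notMem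
  have hover : E.overEnds = D.overEnds := Set.ext fun t => ⟨hM.symm.mem_overEnds, hM.mem_overEnds⟩
  have hNE : E.Nested q' p q := hM.nested hN (fun h => lt_irrefl _ h.2) (fun h => lt_irrefl _ h.1)
  have hranki : D.rank p = i := by rw [← hpi, ncard_terminal_lt]
  have hrankq : D.rank q = i + 1 := by
    rw [← hranki]
    exact rank_succ hpt le_rfl hpq fun s hs h1 h2 => hter s hs (hq'p.trans_le h1) h2
  have hrank : ∀ z, z ≠ q → z ≠ q' →
      E.rank z = if q' < z ∧ z < q then D.rank z + 1 else D.rank z := by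
    intro z hzq hzq'
    split_ifs with h
    · have : (Finset.univ.filter fun k => E.tm k < z) =
          insert j (Finset.univ.filter fun k => D.tm k < z) := by
        ext k
        by_cases hk : k = j
        · subst hk; simp [htj', h.1]
        · simp [htk k hk, hk]
      rw [rank, this, Finset.card_insert_of_notMem (by simp [htj, h.2.le]), rank]
    · simp only [rank]
      congr 2
      ext k
      by_cases hk : k = j
      · subst hk; rw [htj, htj']; grind
      · rw [htk k hk]
  have hlet : ∀ z ∈ D.points, z ≠ q → E.letter z = artinAut i.val (D.letter z) *
      (if q' < z ∧ z < q then (of i.val)⁻¹ * of (i.val + 1) else 1) := by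
    intro z hz hzq
    have hzq' : z ≠ q' := fun h => hq'D (h ▸ hz)
    rw [letter, letter, hrank z hzq hzq']
    split_ifs with h
    · rcases le_or_gt z p with h1 | h1
      · have : D.rank z = i := by
          rw [← hranki]
          apply rank_eq
          intro k
          refine ⟨fun h2 => h2.trans_le h1, fun h2 => ?_⟩
          by_contra h3
          have := hter _ (isTerminal_iff.2 ⟨k, rfl⟩) (h.1.trans_le (not_lt.1 h3)) (h2.trans hpq)
          exact h2.ne this
        rw [this, artinAut_of_ne (by omega)]
        group
      · have : D.rank z = i + 1 := by
          rw [← hrankq]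
          apply rank_eq
          intro k
          refine ⟨fun h2 => h2.trans h.2, fun h2 => ?_⟩
          by_contra h3
          have := hter _ (isTerminal_iff.2 ⟨k, rfl⟩) (h.1.trans_le (not_lt.1 h3)) h2
          rw [this] at h3
          exact h3 h1
        rw [this, artinAut_self]
        group
    · rw [mul_one, artinAut_of_ne]
      rcases lt_or_gt_of_ne hzq with h1 | h1
      · have h2 : z ≤ p := by
          by_contra h3
          exact h ⟨hq'p.trans (not_le.1 h3), h1⟩
        have := D.rank_mono h2
        omega
      · have := rank_lt (isTerminal_iff.2 ⟨j, htj⟩) le_rfl h1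
        omega
  set κ : ℚ → FreeGroup ℕ :=
    fun z => if q' < z ∧ z < q then (of i.val)⁻¹ * of (i.val + 1) else 1 with hκ
  have hκ0 : ∀ k x R, D.curve k = x :: R → κ x = 1 := by
    intro k x R h
    simp only [hκ]
    rw [if_neg]
    rintro ⟨h1, h2⟩
    have h0 : (D.curve k)[0]? = some x := by simp [h]
    by_cases hxp : x = p
    · obtain ⟨w, k', a, -, h3⟩ := hpo
      have := (D.point_unique _ _ _ _ _ h0 (hxp ▸ h3)).2
      omega
    · obtain ⟨y, hy, -⟩ := hpart x ⟨k, by simp [h]⟩ h1 h2 hxp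
      rcases hy with ⟨k', a, h3, h4⟩ | ⟨k', a, h3, h4⟩
      · have := (D.point_unique _ _ _ _ _ h0 h3).2
        omega
      · have := (D.point_unique _ _ _ _ _ h0 h4).2
        omega
  have hκu : ∀ k A x y B, D.curve k = A ++ x :: y :: B → Odd A.length → κ x = κ y := by
    intro k A x y B h hA
    have hxy : D.IsUnderArc x y := isUnderArc_iff.2 ⟨k, A, B, h, hA⟩
    have key : ∀ x y, (D.IsUnderArc x y ∨ D.IsUnderArc y x) → q' < x ∧ x < q → q' < y ∧ y < q := by
      rintro x y hxy ⟨h1, h2⟩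
      have hxp : x ≠ p := by
        rintro rfl
        exact notMem_overEnds_of_underArc hxy hpO
      obtain ⟨z, hz, h3, h4, -⟩ := hpart x (mem_points_of_underArc hxy) h1 h2 hxp
      rw [underArc_unique hxy hz]
      exact ⟨h3, h4⟩
    simp only [hκ, show (q' < x ∧ x < q) ↔ (q' < y ∧ y < q) from
      ⟨key x y (Or.inl hxy), key y x (Or.inr hxy)⟩]
  have hnd := D.nodup_curve j
  rw [hj, List.nodup_append] at hnd
  have hLq : ∀ x ∈ L, x ≠ q := fun x hx => hnd.2.2 x hx q (by simp)
  have twk : ∀ k, k ≠ j → ∀ A B, D.curve k = A ++ B → _ := fun k hk A B h =>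
    lab_hol_twist (e := D.letter) (e' := E.letter) (κ := κ) (artinAut i.val).toMonoidHom A
      (fun x hx => hlet x ⟨k, by simp [h, hx]⟩ (by
        rintro rfl
        exact hk (eq_of_mem (D := D) (x := x) (by simp [h, hx]) (by simp [hj]))))
      (fun x R h' => hκ0 k x (R ++ B) (by simp [h, h']))
      (fun A' x y B' h' => hκu k A' x y (B' ++ B) (by simp [h, h']))
  have twj := lab_hol_twist (e := D.letter) (e' := E.letter) (κ := κ) (artinAut i.val).toMonoidHom L
      (fun x hx => hlet x ⟨j, by simp [hj, hx]⟩ (hLq x hx))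
      (fun x R h' => hκ0 j x (R ++ [q]) (by simp [hj, h']))
      (fun A' x y B' h' => hκu j A' x y (B' ++ [q]) (by simp [hj, h']))
  have hκq : κ q = 1 := by simp [hκ]
  have htwj : lastTwist κ (side true L) L = 1 := by
    rcases List.eq_nil_or_concat L with rfl | ⟨A, y, rfl⟩
    · simp [lastTwist]
    · have := hκu j A y q [] (by simp [hj]) (by
        rw [List.concat_eq_append, List.length_append] at hL
        simpa [Nat.even_add_one] using hL)
      simp [lastTwist, this, hκq]
  rw [htwj, mul_one] at twj
  set R : Set ℚ := D.overEnds ∪ Set.Ioo q' q with hR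
  have hfil : ∀ l : List (ℚ × FreeGroup ℕ), (∀ z ∈ l, z.1 ≠ q) →
      (l.map fun z => (z.1, artinAut i.val z.2 * κ z.1)).filter (fun z => keep R z.1) =
        ((l.filter fun z => keep R z.1).map (Prod.map id (artinAut i.val))).map
          (Prod.map (fun z => if z = q then q' else z) id) := by
    intro l hl
    rw [List.filter_map, List.map_map]
    apply List.map_congr_left
    intro z hz
    rw [List.mem_filter] at hz
    have h1 : z.1 ∉ R := keep_eq_true.1 hz.2
    have h2 : κ z.1 = 1 := if_neg fun h => h1 (Or.inr h)
    obtain ⟨x, u⟩ := z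
    simp [show κ x = 1 from h2, show x ≠ q from hl _ hz.1]
  have hmemlab : ∀ {l z g}, z ∈ lab D.letter true g l → z.1 ∈ l := by
    intro l z g hz
    rw [← map_fst_lab D.letter true g l]
    exact List.mem_map.2 ⟨z, hz, rfl⟩
  constructor
  · refine ((hN.eqv.act _).trans ?_).trans hNE.eqv.symm
    rw [hover]
    refine Config.Eqv.reposition (Config.Simple.act _ (simple_config _ _))
      ⟨fun z => if z = q then q' else z, ?_, fun k => ?_⟩
    · rw [Config.pts_act]
      intro x hx y hy hxy
      rw [mem_pts_config] at hx hy
      simp only [Set.mem_union, Set.mem_Ioo, not_or, not_and, not_lt] at hx hy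
      have hx' : x ≠ q' := fun h => hq'D (h ▸ hx.1)
      have hy' : y ≠ q' := fun h => hq'D (h ▸ hy.1)
      dsimp only
      split_ifs with h1 h2 h2
      · subst h1 h2; exact absurd hxy (lt_irrefl _)
      · subst h1
        linarith
      · subst h2
        rcases lt_or_gt_of_ne hx' with h3 | h3
        · exact h3
        · exact absurd (hx.2.2 h3) (not_le.2 hxy)
      · exact hxy
    · by_cases hk : k = j
      · subst hk
        rw [config, Config.act, config, hEj, hj, lab_append, lab_append, twj.1, twj.2,
          List.filter_append, List.filter_append, List.map_append, List.map_append]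
        congr 1
        · exact hfil _ fun z hz => hLq _ (hmemlab hz)
        · have h1 : q ∉ R := by simp [hR, hqO]
          have h2 : q' ∉ R := by simp [hR, ← hover, hq'O]
          rw [side_of_even hL]
          simp [lab, ← hR, keep_of_notMem h1, keep_of_notMem h2]
      · have := (twk k hk _ [] (List.append_nil _).symm).1
        rw [config, Config.act, config, hEk k hk, this]
        exact hfil _ fun z hz h => hk (eq_of_mem (hmemlab hz) (by simp [hj, h]))
  · intro k
    by_cases hk : k = j
    · subst hk
      rw [loop_eq hj, loop_eq hEj, twj.2, side_of_even hL]
      have : E.rank q' = i := by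
        rw [← hranki, rank, rank]
        congr 2
        ext l
        by_cases hl : l = k
        · subst hl; simp [htj, htj', hpq.le]
        · rw [htk l hl]
          refine ⟨fun h => h.trans hq'p, fun h => ?_⟩
          have h1 : D.tm l ≠ q' := fun h => hq'D (h ▸ D.tm_mem_points l)
          by_contra h2
          exact h.ne (hter _ (isTerminal_iff.2 ⟨l, rfl⟩) (lt_of_le_of_ne (not_lt.1 h2) h1.symm)
            (h.trans hpq))
      simp [loopElt, hrankq, this, artinAut_self, artinAut_of_ne]
      group
    · have hc := D.curve_eq k
      set A := (D.curve k).dropLast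
      set t := D.tm k with ht
      have htT : D.IsTerminal t := isTerminal_iff.2 ⟨k, rfl⟩
      have htq : t ≠ q := fun h => hk (D.tm_injective (h.trans htj.symm))
      have htq' : t ≠ q' := fun h => hq'D (h ▸ D.tm_mem_points k)
      rw [loop_eq hc, loop_eq ((hEk k hk).trans hc), (twk k hk A [t] hc).2, hrank t htq htq']
      -- a terminal point other than `p` keeps its rank, which differs from those of `p` and `q`
      have hoth : t ≠ p → artinAut i.val (loopElt (side true A) (D.rank t)) =
          loopElt (side true A) (D.rank t) ∧ ¬ (q' < t ∧ t < q) := by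
        intro htp
        refine ⟨?_, fun h => htp (hter t htT h.1 h.2)⟩
        have h1 : D.rank t ≠ i := by
          intro h
          rcases lt_or_gt_of_ne htp with h1 | h1
          · have := rank_lt htT le_rfl h1; omega
          · have := rank_lt hpt le_rfl h1; omega
        have h2 : D.rank t ≠ i + 1 := by
          intro h
          rcases lt_or_gt_of_ne htq with h1 | h1
          · have := rank_lt htT le_rfl h1; omega
          · have := rank_lt (isTerminal_iff.2 ⟨j, htj⟩) le_rfl h1; omega
        unfold loopElt
        split_ifs <;> simp [artinAut_of_ne, h1, h2]
      by_cases hA : Even A.length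
      · have htp : t ≠ p := by
          intro h
          rw [← h, mem_overEnds_iff (D.tm_mem k), hc] at hpO
          simp [Nat.even_add_one, hA] at hpO
        obtain ⟨h1, h2⟩ := hoth htp
        have h3 : lastTwist κ (side true A) A = 1 := by
          have h4 : κ t = 1 := if_neg h2
          rcases List.eq_nil_or_concat A with h | ⟨B, y, h⟩
          · simp [lastTwist, h]
          · have := hκu k B y t [] (by simp [hc, h]) (by
              rw [h, List.concat_eq_append, List.length_append] at hA
              simpa [Nat.even_add_one] using hA)
            simp [lastTwist, h, this, h4]
        rw [if_neg h2, h3, map_mul, map_mul, h1]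
        simp
      · have h3 : lastTwist κ (side true A) A = 1 := by
          simp [lastTwist, side_of_odd (Nat.not_even_iff_odd.1 hA)]
        rw [h3]
        by_cases htp : t = p
        · rw [if_pos (htp ▸ ⟨hq'p, hpq⟩), htp, hranki]
          simp [side_of_odd (Nat.not_even_iff_odd.1 hA), loopElt, artinAut_self, artinAut_of_ne]
        · obtain ⟨h1, h2⟩ := hoth htp
          rw [if_neg h2, map_mul, map_mul, h1]
          simp

/-- The braid action on diagrams induces the Artin action on configurations and loops. -/
theorem represents_conf {β : BraidGroup n} {D E : VCD n} (h : Represents β D E) :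
    (D.conf.act (artin n β)).Eqv E.conf ∧ ∀ k, E.loop k = artin n β (D.loop k) := by
  induction h with
  | equivalent h =>
    obtain ⟨h1, h2⟩ := sameInv_of_equivalent h
    rw [map_one]
    refine ⟨?_, fun k => (h2 k).symm⟩
    rw [MulAut.coe_one, Config.act_id]
    exact h1
  | sigma i _ h1 h2 h3 ih =>
    have e1 := sameInv_of_equivalent h1
    have e3 := sameInv_of_equivalent h3
    have e2 := sigmaStep_conf h2
    rw [map_mul, artin_sigma]
    refine ⟨?_, fun k => ?_⟩
    · refine Config.Eqv.trans ?_ (((e1.1.act _).trans e2.1).trans e3.1)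
      simpa [Config.act_act] using ih.1.act (artinAut i.val)
    · rw [← e3.2, e2.2, ← e1.2, ih.2, MulAut.mul_apply]
  | sigma_inv i _ h1 h2 h3 ih =>
    have e1 := sameInv_of_equivalent h1
    have e3 := sameInv_of_equivalent h3
    have e2 := sigmaStep_conf h2
    rw [map_mul, map_inv, artin_sigma]
    refine ⟨?_, fun k => ?_⟩
    · have h4 := (ih.1.trans e1.1).trans e2.1.symm
      have h5 := h4.act ((artinAut i.val)⁻¹ : MulAut (FreeGroup ℕ))
      rw [Config.act_act, Config.act_act] at h5
      refine Config.Eqv.trans ?_ e3.1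
      simpa [Config.act_id] using h5
    · rw [← e3.2, MulAut.mul_apply, ← ih.2, e1.2, e2.2, ← MulAut.mul_apply, inv_mul_cancel,
        MulAut.one_apply]

end VCD

/-! ### Surgery on diagrams -/

namespace VCD

variable {n : ℕ}

/-- The pairs `{x, y}` and `{z, w}` do not separate each other on the line. -/
def Unlinked (x y z w : ℚ) : Prop := (x < z ↔ y < z) ↔ (x < w ↔ y < w)

theorem Unlinked.not_cross {x y z w : ℚ} (h : Unlinked x y z w) :
    ¬ (min x y < min z w ∧ min z w < max x y ∧ max x y < max z w) := by
  unfold Unlinked at h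
  rintro ⟨h1, h2, h3⟩
  rcases le_total x y with h4 | h4 <;> rcases le_total z w with h5 | h5 <;>
    simp only [h4, h5, min_eq_left, max_eq_right, min_eq_right, max_eq_left] at h1 h2 h3 <;> grind

theorem Unlinked.symm {x y z w : ℚ} (h : Unlinked x y z w) (h1 : x ≠ z) (h2 : x ≠ w) (h3 : y ≠ z)
    (h4 : y ≠ w) : Unlinked z w x y := by
  unfold Unlinked at *
  grind

theorem Unlinked.trans {x b c y z w : ℚ} (h : Unlinked x b z w) (h' : Unlinked c y z w)
    (h1 : b < z ↔ c < z) (h2 : b < w ↔ c < w) : Unlinked x y z w := by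
  unfold Unlinked at *
  rw [h1, h2] at h
  generalize (x < z) = p1, (c < z) = p2, (y < z) = p3, (x < w) = q1, (c < w) = q2,
    (y < w) = q3 at *
  by_cases p1 <;> by_cases p2 <;> by_cases p3 <;> by_cases q1 <;> by_cases q2 <;> simp_all

theorem mem_points_of_overArc {D : VCD n} {x y : ℚ} (h : D.IsOverArc x y ∨ D.IsOverArc y x) :
    x ∈ D.points := by
  rcases h with ⟨j, a, h1, h2⟩ | ⟨j, a, h1, h2⟩
  · exact ⟨j, List.mem_of_getElem? h1⟩
  · exact ⟨j, List.mem_of_getElem? h2⟩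

theorem IsOverArc.ne {D : VCD n} {x y : ℚ} (h : D.IsOverArc x y) : x ≠ y := by
  rintro rfl
  obtain ⟨j, a, h1, h2⟩ := h
  have := (D.point_unique _ _ _ _ _ h1 h2).2
  omega

theorem unlinked_of_overArc {D : VCD n} {x y z w : ℚ} (h : D.IsOverArc x y ∨ D.IsOverArc y x)
    (h' : D.IsOverArc z w ∨ D.IsOverArc w z) (hz : z ≠ x) (hz' : z ≠ y) : Unlinked x y z w := by
  have hw : w ≠ x := by
    rintro rfl; exact hz' (overArc_unique h'.symm h)
  have hw' : w ≠ y := by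
    rintro rfl; exact hz (overArc_unique h'.symm h.symm)
  have main : ∀ {x y z w}, (D.IsOverArc x y ∨ D.IsOverArc y x) →
      (D.IsOverArc z w ∨ D.IsOverArc w z) →
      ¬ (min x y < min z w ∧ min z w < max x y ∧ max x y < max z w) := by
    rintro x y z w (⟨j, a, h1, h2⟩ | ⟨j, a, h1, h2⟩) (⟨k, b, h3, h4⟩ | ⟨k, b, h3, h4⟩)
    · exact D.over_noncrossing _ _ _ _ _ _ _ _ h1 h2 h3 h4
    · rw [min_comm z, max_comm z]
      exact D.over_noncrossing _ _ _ _ _ _ _ _ h1 h2 h3 h4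
    · rw [min_comm x, max_comm x]
      exact D.over_noncrossing _ _ _ _ _ _ _ _ h1 h2 h3 h4
    · rw [min_comm z, max_comm z, min_comm x, max_comm x]
      exact D.over_noncrossing _ _ _ _ _ _ _ _ h1 h2 h3 h4
  have e1 := main h h'
  have e2 := main h' h
  unfold Unlinked
  rcases le_total x y with h4 | h4 <;> rcases le_total z w with h5 | h5 <;>
    simp only [h4, h5, min_eq_left, max_eq_right, min_eq_right, max_eq_left] at e1 e2 <;> grind

/-- Replacing one curve gives a diagram again, if at most one over arc `(x₀, y₀)` is new and this
arc is not linked with the old ones. -/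
theorem exists_update (D : VCD n) (j : Fin n) {l : List ℚ} (hne : l ≠ []) (hnd : l.Nodup)
    (hmem : ∀ x ∈ l, x ∈ D.points → x ∈ D.curve j) (x₀ y₀ : ℚ)
    (hover : ∀ a x y, l[2 * a]? = some x → l[2 * a + 1]? = some y →
      D.IsOverArc x y ∨ x = x₀ ∧ y = y₀)
    (hunl : ∀ z w, D.IsOverArc z w → z ≠ x₀ → z ≠ y₀ → w ≠ x₀ → w ≠ y₀ → Unlinked x₀ y₀ z w) :
    ∃ E : VCD n, E.curve = Function.update D.curve j l := by
  have hpt : ∀ (k m : Fin n) (a b : ℕ) (x : ℚ), (Function.update D.curve j l k)[a]? = some x →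
      (Function.update D.curve j l m)[b]? = some x → k = m ∧ a = b := by
    intro k m a b x h1 h2
    by_cases hk : k = j <;> by_cases hm : m = j
    · subst hk; subst hm
      rw [Function.update_self] at h1 h2
      refine ⟨rfl, ?_⟩
      obtain ⟨ha, e1⟩ := List.getElem?_eq_some_iff.1 h1
      obtain ⟨hb, e2⟩ := List.getElem?_eq_some_iff.1 h2
      exact (hnd.getElem_inj_iff).1 (e1.trans e2.symm)
    · subst hk
      rw [Function.update_self] at h1
      rw [Function.update_of_ne hm] at h2
      exact absurd (eq_of_mem (List.mem_of_getElem? h2)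
        (hmem x (List.mem_of_getElem? h1) ⟨m, List.mem_of_getElem? h2⟩)) hm
    · subst hm
      rw [Function.update_self] at h2
      rw [Function.update_of_ne hk] at h1
      exact absurd (eq_of_mem (List.mem_of_getElem? h1)
        (hmem x (List.mem_of_getElem? h2) ⟨k, List.mem_of_getElem? h1⟩)) hk
    · rw [Function.update_of_ne hm] at h2
      rw [Function.update_of_ne hk] at h1
      exact D.point_unique _ _ _ _ _ h1 h2
  have hov : ∀ k a x y, (Function.update D.curve j l k)[2 * a]? = some x →
      (Function.update D.curve j l k)[2 * a + 1]? = some y →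
      D.IsOverArc x y ∨ x = x₀ ∧ y = y₀ := by
    intro k a x y h1 h2
    by_cases hk : k = j
    · subst hk
      rw [Function.update_self] at h1 h2
      exact hover a x y h1 h2
    · rw [Function.update_of_ne hk] at h1 h2
      exact Or.inl ⟨k, a, h1, h2⟩
  refine ⟨⟨Function.update D.curve j l, fun k => ?_, hpt, ?_⟩, rfl⟩
  · by_cases hk : k = j
    · subst hk; rwa [Function.update_self]
    · rw [Function.update_of_ne hk]; exact D.curve_ne_nil k
  · intro k m a b x y z w h1 h2 h3 h4
    by_cases hxz : x = z
    · subst hxz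
      obtain ⟨rfl, hab⟩ := hpt _ _ _ _ _ h1 h3
      obtain rfl : a = b := by omega
      obtain rfl : y = w := by simpa [h2] using h4
      simp
    · have hxw : x ≠ w := by
        rintro rfl; have := (hpt _ _ _ _ _ h1 h4).2; omega
      have hyz : y ≠ z := by
        rintro rfl; have := (hpt _ _ _ _ _ h2 h3).2; omega
      have hyw : y ≠ w := by
        rintro rfl
        obtain ⟨rfl, hab⟩ := hpt _ _ _ _ _ h2 h4
        obtain rfl : a = b := by omega
        simp [h1] at h3
        exact hxz h3
      apply Unlinked.not_cross
      rcases hov _ _ _ _ h1 h2 with h5 | ⟨rfl, rfl⟩ <;> rcases hov _ _ _ _ h3 h4 with h6 | ⟨rfl, rfl⟩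
      · exact unlinked_of_overArc (Or.inl h5) (Or.inl h6) (Ne.symm hxz) hyz.symm
      · exact (hunl _ _ h5 hxz hxw hyz hyw).symm (Ne.symm hxz) hyz.symm hxw.symm hyw.symm
      · exact hunl _ _ h6 (Ne.symm hxz) hyz.symm hxw.symm hyw.symm
      · exact absurd rfl hxz

theorem getElem?_append_pair_high {L R : List ℚ} {b c : ℚ} {i : ℕ} (h : L.length ≤ i) :
    (L ++ b :: c :: R)[i + 2]? = (L ++ R)[i]? := by
  rw [List.getElem?_append_right h, List.getElem?_append_right (by omega),
    show i + 2 - L.length = i - L.length + 1 + 1 by omega, List.getElem?_cons_succ,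
    List.getElem?_cons_succ]

theorem exists_drop_end {D : VCD n} {j : Fin n} {L : List ℚ} {a b : ℚ}
    (hj : D.curve j = L ++ [a, b]) :
    ∃ E : VCD n, E.curve = Function.update D.curve j (L ++ [a]) := by
  have hsub : (L ++ [a]) <+: D.curve j := ⟨[b], by simp [hj]⟩
  refine exists_update D j (by simp) (hsub.sublist.nodup (D.nodup_curve j))
    (fun x hx _ => hsub.subset hx) 0 0 (fun m x y h1 h2 => Or.inl ⟨j, m, ?_, ?_⟩)
    (fun z w _ _ _ _ _ => by simp [Unlinked])
  · rw [hj]; grind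
  · rw [hj]; grind

theorem exists_remove_pair {D : VCD n} {j : Fin n} {L R : List ℚ} {b c : ℚ}
    (hj : D.curve j = L ++ b :: c :: R) (hne : L ++ R ≠ [])
    (ha : Odd L.length → D.Adjacent b c) :
    ∃ E : VCD n, E.curve = Function.update D.curve j (L ++ R) := by
  have hsub : (L ++ R).Sublist (D.curve j) := by
    rw [hj]
    exact List.Sublist.append_left ((List.sublist_cons_self c R).cons b) L
  have hlow : ∀ i x, i < L.length → (L ++ R)[i]? = some x → (D.curve j)[i]? = some x := by
    intro i x hi h
    rw [hj]
    grind
  have hhigh : ∀ i x, L.length ≤ i → (L ++ R)[i]? = some x → (D.curve j)[i + 2]? = some x := by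
    intro i x hi h
    rw [hj, getElem?_append_pair_high hi, h]
  rcases Nat.even_or_odd L.length with hL | hL
  · refine exists_update D j hne (hsub.nodup (D.nodup_curve j)) (fun x hx _ => hsub.subset hx) 0 0
      (fun m x y h1 h2 => Or.inl ?_) (fun z w _ _ _ _ _ => by simp [Unlinked])
    obtain ⟨l, hl⟩ := hL
    rcases lt_or_ge m l with h | h
    · exact ⟨j, m, hlow _ _ (by omega) h1, hlow _ _ (by omega) h2⟩
    · exact ⟨j, m + 1, hhigh (2 * m) _ (by omega) h1, hhigh (2 * m + 1) _ (by omega) h2⟩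
  · have hadj := ha hL
    rcases List.eq_nil_or_concat L with rfl | ⟨A, x₀, rfl⟩
    · simp at hL
    rw [List.concat_eq_append] at *
    have hA : Even A.length := by
      simpa [Nat.even_add_one, Nat.odd_add_one] using hL
    have ho1 : D.IsOverArc x₀ b := isOverArc_iff.2 ⟨j, A, c :: R, by simp [hj], hA⟩
    rcases R with _ | ⟨y₀, B⟩
    · refine exists_update D j hne (hsub.nodup (D.nodup_curve j)) (fun x hx _ => hsub.subset hx) 0 0
        (fun m x y h1 h2 => Or.inl ?_) (fun z w _ _ _ _ _ => by simp [Unlinked])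
      have := (List.getElem?_eq_some_iff.1 h1).1
      have := (List.getElem?_eq_some_iff.1 h2).1
      simp only [List.length_append, List.length_cons, List.length_nil] at this hlow
      exact ⟨j, m, hlow _ _ (by omega) h1, hlow _ _ (by omega) h2⟩
    · have ho2 : D.IsOverArc c y₀ := isOverArc_iff.2
        ⟨j, A ++ [x₀, b], B, by simp [hj], by simpa [Nat.even_add] using hA⟩
      have hnd := D.nodup_curve j
      rw [hj] at hnd
      refine exists_update D j hne (hsub.nodup (D.nodup_curve j)) (fun x hx _ => hsub.subset hx)
        x₀ y₀ (fun m x y h1 h2 => ?_) (fun z w hzw h1 h2 h3 h4 => ?_)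
      · obtain ⟨l, hl⟩ := hA
        simp only [List.length_append, List.length_cons, List.length_nil] at hlow hhigh
        rcases lt_trichotomy m l with h | h | h
        · exact Or.inl ⟨j, m, hlow _ _ (by omega) h1, hlow _ _ (by omega) h2⟩
        · right
          have e1 : 2 * m = A.length := by omega
          rw [e1] at h1 h2
          constructor
          · simpa using h1.symm
          · simpa using h2.symm
        · exact Or.inl ⟨j, m + 1, hhigh (2 * m) _ (by omega) h1, hhigh (2 * m + 1) _ (by omega) h2⟩
      · -- linking numbers with the two old arcs add up, as `b` and `c` are adjacent
        have hzb : z ≠ b := by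
          rintro rfl
          exact h3 (overArc_unique (Or.inl hzw) (Or.inr ho1))
        have hwb : w ≠ b := by
          rintro rfl
          exact h1 (overArc_unique (Or.inr hzw) (Or.inr ho1))
        have hzc : z ≠ c := by
          rintro rfl
          exact h4 (overArc_unique (Or.inl hzw) (Or.inl ho2))
        have hwc : w ≠ c := by
          rintro rfl
          exact h2 (overArc_unique (Or.inr hzw) (Or.inl ho2))
        have e1 := unlinked_of_overArc (Or.inl ho1) (Or.inl hzw) h1 hzb
        have e2 := unlinked_of_overArc (Or.inl ho2) (Or.inl hzw) hzc h2
        have e3 := hadj z (mem_points_of_overArc (Or.inl hzw))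
        have e4 := hadj w (mem_points_of_overArc (Or.inr hzw))
        simp only [min_lt_iff, lt_max_iff] at e3 e4
        have e5 : b < z ↔ c < z := by grind
        have e6 : b < w ↔ c < w := by grind
        exact e1.trans e2 e5 e6

theorem exists_insert_pair {D : VCD n} {j : Fin n} {L R : List ℚ} {b c : ℚ}
    (hj : D.curve j = L ++ R) (hL : Even L.length) (hb : b ∉ D.points) (hc : c ∉ D.points)
    (hbc : b ≠ c) (ha : ∀ z ∈ D.points, b < z ↔ c < z) :
    ∃ E : VCD n, E.curve = Function.update D.curve j (L ++ b :: c :: R) := by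
  have hb' : b ∉ L ++ R := fun h => hb ⟨j, hj ▸ h⟩
  have hc' : c ∉ L ++ R := fun h => hc ⟨j, hj ▸ h⟩
  have hnd := D.nodup_curve j
  rw [hj] at hnd
  refine exists_update D j (by simp) ?_ ?_ b c ?_ ?_
  · rw [List.nodup_middle, List.nodup_cons, List.nodup_middle, List.nodup_cons]
    simp only [List.mem_append, List.mem_cons, not_or] at *
    grind
  · intro x hx hxD
    rw [hj]
    have h1 : x ≠ b := fun h => hb (h ▸ hxD)
    have h2 : x ≠ c := fun h => hc (h ▸ hxD)
    simpa [h1, h2] using hx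
  · intro m x y h1 h2
    obtain ⟨l, hl⟩ := hL
    rcases lt_trichotomy m l with h | h | h
    · left; refine ⟨j, m, ?_, ?_⟩ <;> rw [hj] <;> grind
    · right
      have e : 2 * m = L.length := by omega
      rw [e] at h1 h2
      constructor
      · simpa using h1.symm
      · simpa using h2.symm
    · left; refine ⟨j, m - 1, ?_, ?_⟩ <;> rw [hj] <;> grind
  · intro z w hzw _ _ _ _
    have e1 := ha z (mem_points_of_overArc (Or.inl hzw))
    have e2 := ha w (mem_points_of_overArc (Or.inr hzw))
    simp [Unlinked, e1, e2]

theorem exists_move_end {D : VCD n} {j : Fin n} {L : List ℚ} {t t' : ℚ}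
    (hj : D.curve j = L ++ [t]) (hL : Even L.length) (ht : t' ∉ D.points) :
    ∃ E : VCD n, E.curve = Function.update D.curve j (L ++ [t']) := by
  have ht' : t' ∉ L := fun h => ht ⟨j, by simp [hj, h]⟩
  have hnd := D.nodup_curve j
  rw [hj] at hnd
  refine exists_update D j (by simp) ?_ ?_ 0 0 (fun m x y h1 h2 => Or.inl ⟨j, m, ?_⟩)
    (fun z w _ _ _ _ _ => by simp [Unlinked])
  · grind
  · intro x hx hxD
    have h1 : x ≠ t' := fun h => ht (h ▸ hxD)
    rw [hj]
    simp only [List.mem_append, List.mem_singleton, h1, or_false] at hx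
    simp [hx]
  · obtain ⟨l, hl⟩ := hL
    rw [hj]
    grind

/-- `E` arises from `D` by inserting `b, c` into a curve, such that `(b, c)` is an over arc. -/
structure PairInsert (D E : VCD n) (j : Fin n) (L R : List ℚ) (b c : ℚ) : Prop where
  curve_left : D.curve j = L ++ R
  curve_right : E.curve j = L ++ b :: c :: R
  curve_of_ne : ∀ k, k ≠ j → E.curve k = D.curve k
  even : Even L.length
  ne_nil : R ≠ []

namespace PairInsert

variable {D E : VCD n} {j : Fin n} {L R : List ℚ} {b c : ℚ}

theorem mem_points_iff (h : PairInsert D E j L R b c) {x : ℚ} :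
    x ∈ E.points ↔ x ∈ D.points ∨ x = b ∨ x = c := by
  constructor
  · rintro ⟨k, hk⟩
    by_cases hkj : k = j
    · subst hkj
      rw [h.curve_right] at hk
      by_cases h1 : x = b
      · exact Or.inr (Or.inl h1)
      by_cases h2 : x = c
      · exact Or.inr (Or.inr h2)
      · exact Or.inl ⟨k, by rw [h.curve_left]; simpa [h1, h2] using hk⟩
    · exact Or.inl ⟨k, by rwa [← h.curve_of_ne k hkj]⟩
  · rintro (⟨k, hk⟩ | rfl | rfl)
    · refine ⟨k, ?_⟩
      by_cases hkj : k = j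
      · subst hkj
        rw [h.curve_left, List.mem_append] at hk
        rw [h.curve_right]
        grind
      · rwa [h.curve_of_ne k hkj]
    · exact ⟨j, by simp [h.curve_right]⟩
    · exact ⟨j, by simp [h.curve_right]⟩

theorem overArc_iff (h : PairInsert D E j L R b c) {x y : ℚ} :
    E.IsOverArc x y ↔ D.IsOverArc x y ∨ x = b ∧ y = c := by
  obtain ⟨l, hl⟩ := h.even
  constructor
  · rintro ⟨k, m, h1, h2⟩
    by_cases hkj : k = j
    · subst hkj
      rw [h.curve_right] at h1 h2
      rcases lt_trichotomy m l with h3 | h3 | h3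
      · left; refine ⟨k, m, ?_, ?_⟩ <;> rw [h.curve_left] <;> grind
      · right
        have e : 2 * m = L.length := by omega
        rw [e] at h1 h2
        constructor
        · simpa using h1.symm
        · simpa using h2.symm
      · obtain ⟨m, rfl⟩ : ∃ m', m = m' + 1 := ⟨m - 1, by omega⟩
        have e1 := getElem?_append_pair_high (L := L) (R := R) (b := b) (c := c) (i := 2 * m)
          (by omega)
        have e2 := getElem?_append_pair_high (L := L) (R := R) (b := b) (c := c) (i := 2 * m + 1)
          (by omega)
        exact Or.inl ⟨k, m, by rw [h.curve_left, ← e1]; exact h1,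
          by rw [h.curve_left, ← e2]; exact h2⟩
    · rw [h.curve_of_ne k hkj] at h1 h2
      exact Or.inl ⟨k, m, h1, h2⟩
  · rintro (⟨k, m, h1, h2⟩ | ⟨rfl, rfl⟩)
    · by_cases hkj : k = j
      · subst hkj
        rw [h.curve_left] at h1 h2
        rcases lt_or_ge m l with h3 | h3
        · refine ⟨k, m, ?_, ?_⟩ <;> rw [h.curve_right] <;> grind
        · refine ⟨k, m + 1, ?_, ?_⟩ <;> rw [h.curve_right] <;> grind
      · exact ⟨k, m, by rwa [h.curve_of_ne k hkj], by rwa [h.curve_of_ne k hkj]⟩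
    · exact isOverArc_iff.2 ⟨j, L, R, h.curve_right, h.even⟩

theorem underArc_or (h : PairInsert D E j L R b c) {x y : ℚ} (hxy : D.IsUnderArc x y) :
    E.IsUnderArc x y ∨ L.getLast? = some x ∧ R.head? = some y := by
  obtain ⟨l, hl⟩ := h.even
  obtain ⟨k, m, h1, h2⟩ := hxy
  by_cases hkj : k = j
  · subst hkj
    rw [h.curve_left] at h1 h2
    rcases lt_trichotomy (m + 1) l with h3 | h3 | h3
    · left; refine ⟨k, m, ?_, ?_⟩ <;> rw [h.curve_right] <;> grind
    · right
      have e : 2 * m + 2 = L.length := by omega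
      rw [List.getLast?_eq_getElem?, List.head?_eq_getElem?]
      constructor <;> grind
    · left; refine ⟨k, m + 1, ?_, ?_⟩ <;> rw [h.curve_right] <;> grind
  · exact Or.inl ⟨k, m, by rwa [h.curve_of_ne k hkj], by rwa [h.curve_of_ne k hkj]⟩

theorem underArc_of (h : PairInsert D E j L R b c) {x y : ℚ} (hxy : E.IsUnderArc x y) :
    D.IsUnderArc x y ∨ x = c ∨ y = b := by
  obtain ⟨l, hl⟩ := h.even
  obtain ⟨k, m, h1, h2⟩ := hxy
  by_cases hkj : k = j
  · subst hkj
    rw [h.curve_right] at h1 h2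
    rcases lt_trichotomy (m + 1) l with h3 | h3 | h3
    · left; refine ⟨k, m, ?_, ?_⟩ <;> rw [h.curve_left] <;> grind
    · right; right; grind
    · rcases (show l ≤ m by omega).lt_or_eq with h4 | h4
      · obtain ⟨m, rfl⟩ : ∃ m', m = m' + 1 := ⟨m - 1, by omega⟩
        have e1 := getElem?_append_pair_high (L := L) (R := R) (b := b) (c := c) (i := 2 * m + 1)
          (by omega)
        have e2 := getElem?_append_pair_high (L := L) (R := R) (b := b) (c := c) (i := 2 * m + 2)
          (by omega)
        exact Or.inl ⟨k, m, by rw [h.curve_left, ← e1]; exact h1,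
          by rw [h.curve_left, ← e2]; exact h2⟩
      · right; left
        have e : 2 * m + 1 = L.length + 1 := by omega
        rw [e] at h1
        simpa using h1.symm
  · exact Or.inl ⟨k, m, by rwa [← h.curve_of_ne k hkj], by rwa [← h.curve_of_ne k hkj]⟩

theorem tm_eq (h : PairInsert D E j L R b c) : E.tm = D.tm := by
  funext k
  by_cases hkj : k = j
  · subst hkj
    have hR := List.dropLast_append_getLast h.ne_nil
    rw [VCD.tm_eq (L := L ++ b :: c :: R.dropLast) (t := R.getLast h.ne_nil)
      (by rw [h.curve_right]; conv_lhs => rw [← hR]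
          simp),
      VCD.tm_eq (L := L ++ R.dropLast) (t := R.getLast h.ne_nil)
      (by rw [h.curve_left]; conv_lhs => rw [← hR]
          simp)]
  · simp only [tm, h.curve_of_ne k hkj]

theorem terminal_iff (h : PairInsert D E j L R b c) {t : ℚ} : E.IsTerminal t ↔ D.IsTerminal t := by
  rw [isTerminal_iff, isTerminal_iff, h.tm_eq]

theorem overEnds_eq (h : PairInsert D E j L R b c) : E.overEnds = D.overEnds := by
  have : ∀ k, Even (E.curve k).length ↔ Even (D.curve k).length := by
    intro k
    by_cases hk : k = j
    · subst hk
      rw [h.curve_left, h.curve_right]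
      simp only [List.length_append, List.length_cons]
      rw [show L.length + (R.length + 1 + 1) = L.length + R.length + 2 by omega,
        Nat.even_add (n := 2), iff_true_right even_two]
    · rw [h.curve_of_ne k hk]
  simp only [overEnds, h.tm_eq, this]

theorem numPoints (h : PairInsert D E j L R b c) : E.numPoints = D.numPoints + 2 := by
  have e : E.curve = Function.update D.curve j (L ++ b :: c :: R) := by
    funext k
    by_cases hk : k = j
    · subst hk; rw [Function.update_self, h.curve_right]
    · rw [Function.update_of_ne hk, h.curve_of_ne k hk]
  rw [VCD.numPoints, VCD.numPoints, ← Finset.add_sum_erase _ _ (Finset.mem_univ j),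
    ← Finset.add_sum_erase (a := j) Finset.univ (fun j => (D.curve j).length) (Finset.mem_univ j),
    h.curve_left, h.curve_right, Finset.sum_congr rfl fun k hk => by
      rw [h.curve_of_ne k (Finset.ne_of_mem_erase hk)]]
  simp only [List.length_append, List.length_cons]
  omega

theorem notMem (h : PairInsert D E j L R b c) : b ∉ D.points ∧ c ∉ D.points := by
  have hnd := E.nodup_curve j
  rw [h.curve_right, List.nodup_append] at hnd
  have aux : ∀ x, (x = b ∨ x = c) → x ∉ D.points := by
    rintro x hx ⟨k, hk⟩
    by_cases hkj : k = j
    · subst hkj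
      rw [h.curve_left, List.mem_append] at hk
      rcases hk with hk | hk
      · exact hnd.2.2 x hk x (by simpa using hx.imp_right Or.inl) rfl
      · rcases hx with rfl | rfl
        · exact (List.nodup_cons.1 hnd.2.1).1 (by simp [hk])
        · exact (List.nodup_cons.1 (List.nodup_cons.1 hnd.2.1).2).1 hk
    · rw [← h.curve_of_ne k hkj] at hk
      exact hkj (eq_of_mem hk (by rw [h.curve_right]; simpa using Or.inr (hx.imp_right Or.inl)))
  exact ⟨aux b (Or.inl rfl), aux c (Or.inr rfl)⟩

/-- Removal of the inserted pair is a `B`-move, if its points are adjacent. -/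
theorem bMove (h : PairInsert D E j L R b c) (ha : E.Adjacent b c) : E.BMove D := by
  refine ⟨j, L, R, b, c, h.curve_right, h.ne_nil, ha, ?_⟩
  funext k
  by_cases hk : k = j
  · subst hk; rw [Function.update_self, h.curve_left]
  · rw [Function.update_of_ne hk, h.curve_of_ne k hk]

end PairInsert

theorem numPoints_of_tMove {D E : VCD n} (h : D.TMove E) : E.numPoints < D.numPoints := by
  obtain ⟨j, L, a, b, hj, -, hE⟩ := h
  rw [VCD.numPoints, VCD.numPoints, hE, ← Finset.add_sum_erase _ _ (Finset.mem_univ j),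
    ← Finset.add_sum_erase (a := j) Finset.univ (fun j => (D.curve j).length) (Finset.mem_univ j),
    hj, Function.update_self, Finset.sum_congr rfl fun k hk => by
      rw [Function.update_of_ne (Finset.ne_of_mem_erase hk)]]
  simp only [List.length_append, List.length_cons]
  omega

theorem numPoints_of_bMove {D E : VCD n} (h : D.BMove E) : E.numPoints < D.numPoints := by
  obtain ⟨j, L, R, b, c, hj, -, -, hE⟩ := h
  rw [VCD.numPoints, VCD.numPoints, hE, ← Finset.add_sum_erase _ _ (Finset.mem_univ j),
    ← Finset.add_sum_erase (a := j) Finset.univ (fun j => (D.curve j).length) (Finset.mem_univ j),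
    hj, Function.update_self, Finset.sum_congr rfl fun k hk => by
      rw [Function.update_of_ne (Finset.ne_of_mem_erase hk)]]
  simp only [List.length_append, List.length_cons]
  omega

theorem IsSimplified.not_tMove {D E : VCD n} (hD : D.IsSimplified) : ¬ D.TMove E := fun h =>
  absurd (hD E (.rel _ _ (Or.inr (Or.inl h)))) (not_le.2 (numPoints_of_tMove h))

theorem IsSimplified.not_bMove {D E : VCD n} (hD : D.IsSimplified) : ¬ D.BMove E := fun h =>
  absurd (hD E (.rel _ _ (Or.inr (Or.inr h)))) (not_le.2 (numPoints_of_bMove h))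

end VCD

/-! ### Mirror images -/

namespace VCD

variable {n : ℕ}

/-- The mirror image of a diagram in a vertical line. -/
def mirror (D : VCD n) : VCD n where
  curve j := (D.curve j).map fun x => -x
  curve_ne_nil j := by simpa using D.curve_ne_nil j
  point_unique j k a b x h1 h2 := by
    rw [List.getElem?_map, Option.map_eq_some_iff] at h1 h2
    obtain ⟨y, hy, rfl⟩ := h1
    obtain ⟨z, hz, hyz⟩ := h2
    obtain rfl : z = y := neg_injective hyz
    exact D.point_unique _ _ _ _ _ hy hz
  over_noncrossing j k a b x y z w h1 h2 h3 h4 := by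
    rw [List.getElem?_map, Option.map_eq_some_iff] at h1 h2 h3 h4
    obtain ⟨x, h1, rfl⟩ := h1
    obtain ⟨y, h2, rfl⟩ := h2
    obtain ⟨z, h3, rfl⟩ := h3
    obtain ⟨w, h4, rfl⟩ := h4
    have := D.over_noncrossing _ _ _ _ _ _ _ _ h3 h4 h1 h2
    rw [min_neg_neg, min_neg_neg, max_neg_neg, max_neg_neg, neg_lt_neg_iff, neg_lt_neg_iff,
      neg_lt_neg_iff]
    tauto

theorem mirror_curve (D : VCD n) (j : Fin n) :
    D.mirror.curve j = (D.curve j).map fun x => -x := rfl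

theorem getElem?_mirror {D : VCD n} {j : Fin n} {a : ℕ} {x : ℚ} :
    (D.mirror.curve j)[a]? = some x ↔ (D.curve j)[a]? = some (-x) := by
  rw [mirror_curve, List.getElem?_map, Option.map_eq_some_iff]
  constructor
  · rintro ⟨y, hy, rfl⟩; rwa [neg_neg]
  · intro h; exact ⟨_, h, neg_neg x⟩

theorem mirror_mirror (D : VCD n) : D.mirror.mirror = D := by
  have : D.mirror.mirror.curve = D.curve := by
    funext j
    simp [mirror_curve]
  cases D
  simpa only [mirror, VCD.mk.injEq] using this

theorem mem_points_mirror {D : VCD n} {x : ℚ} : x ∈ D.mirror.points ↔ -x ∈ D.points := by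
  constructor
  · rintro ⟨j, hj⟩
    obtain ⟨a, ha⟩ := List.mem_iff_getElem?.1 hj
    exact ⟨j, List.mem_of_getElem? (getElem?_mirror.1 ha)⟩
  · rintro ⟨j, hj⟩
    obtain ⟨a, ha⟩ := List.mem_iff_getElem?.1 hj
    exact ⟨j, List.mem_of_getElem? (getElem?_mirror.2 ha)⟩

theorem isOverArc_mirror {D : VCD n} {x y : ℚ} :
    D.mirror.IsOverArc x y ↔ D.IsOverArc (-x) (-y) := by
  simp only [IsOverArc, getElem?_mirror]

theorem isUnderArc_mirror {D : VCD n} {x y : ℚ} :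
    D.mirror.IsUnderArc x y ↔ D.IsUnderArc (-x) (-y) := by
  simp only [IsUnderArc, getElem?_mirror]

theorem tm_mirror (D : VCD n) (j : Fin n) : D.mirror.tm j = -D.tm j := by
  simp [tm, mirror_curve]

theorem isTerminal_mirror {D : VCD n} {t : ℚ} : D.mirror.IsTerminal t ↔ D.IsTerminal (-t) := by
  simp only [isTerminal_iff, tm_mirror, neg_eq_iff_eq_neg]

theorem mem_overEnds_mirror {D : VCD n} {t : ℚ} : t ∈ D.mirror.overEnds ↔ -t ∈ D.overEnds := by
  simp only [overEnds, Set.mem_ofPred_eq, tm_mirror, mirror_curve, List.length_map,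
    neg_eq_iff_eq_neg]

theorem numPoints_mirror (D : VCD n) : D.mirror.numPoints = D.numPoints := by
  simp [numPoints, mirror_curve]

theorem Adjacent.mirror {D : VCD n} {x y : ℚ} (h : D.Adjacent x y) :
    D.mirror.Adjacent (-x) (-y) := by
  intro z hz hxy
  rw [min_neg_neg, max_neg_neg] at hxy
  exact h (-z) (mem_points_mirror.1 hz) ⟨by linarith, by linarith⟩

theorem mirror_curve_update {D E : VCD n} {j : Fin n} {l : List ℚ}
    (h : E.curve = Function.update D.curve j l) :
    E.mirror.curve = Function.update D.mirror.curve j (l.map fun x => -x) := by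
  funext k
  rw [mirror_curve, h]
  by_cases hk : k = j
  · subst hk; simp
  · simp [Function.update_of_ne hk, mirror_curve]

theorem Equivalent.mirror {D E : VCD n} (h : Equivalent D E) : Equivalent D.mirror E.mirror := by
  induction h with
  | rel D E h =>
    refine .rel _ _ ?_
    rcases h with ⟨f, hf, hE⟩ | ⟨j, L, a, b, hj, ha, hE⟩ | ⟨j, L, R, b, c, hj, hR, ha, hE⟩
    · refine Or.inl ⟨fun x => -f (-x), fun x hx y hy hxy => ?_, fun j => ?_⟩
      · exact neg_lt_neg (hf (mem_points_mirror.1 hy) (mem_points_mirror.1 hx) (neg_lt_neg hxy))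
      · simp [mirror_curve, hE, Function.comp_def]
    · exact Or.inr (Or.inl ⟨j, L.map fun x => -x, -a, -b, by simp [mirror_curve, hj], ha.mirror,
        by simpa using mirror_curve_update hE⟩)
    · exact Or.inr (Or.inr ⟨j, L.map fun x => -x, R.map fun x => -x, -b, -c,
        by simp [mirror_curve, hj], by simpa using hR, ha.mirror,
        by simpa using mirror_curve_update hE⟩)
  | refl D => exact .refl _
  | symm D E _ ih => exact .symm _ _ ih
  | trans D E F _ _ ih1 ih2 => exact .trans _ _ _ ih1 ih2

/-- In the mirror, pushing off a puncture to the right becomes the inverse of a pushing off. -/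
theorem SigmaStep.mirror {i : Fin (n - 1)} {D E : VCD n} (h : D.SigmaStep i E) :
    E.mirror.SigmaStep i.rev D.mirror := by
  obtain ⟨j, L, p, q, q', hj, hL, hq'p, hpq, hpt, hpi, hpo, hter, hpart, hnest, hE⟩ := h
  have hM : MoveEnd D E j L q q' := .of_update hj hL (hq'p.trans hpq).ne' hE
  have hpE := hM.isTerminal hpt hpq.ne
  have key : ∀ {v}, q' < v → v ≠ q' := fun h => h.ne'
  refine ⟨j, L.map fun x => -x, -p, -q', -q, by simp [mirror_curve, hM.curve_right], by simpa,
    neg_lt_neg hpq, neg_lt_neg hq'p, isTerminal_mirror.2 (by rwa [neg_neg]), ?_, ?_, ?_, ?_, ?_, ?_⟩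
  · rw [ncard_terminal_lt]
    rw [ncard_terminal_lt] at hpi
    obtain ⟨a, ha⟩ := isTerminal_iff.1 hpt
    have haj : a ≠ j := by
      rintro rfl; exact hpq.ne (ha.symm.trans hM.tm_self)
    have h1 : (Finset.univ.filter fun k => E.mirror.tm k < -p) =
        Finset.univ \ insert a (insert j (Finset.univ.filter fun k => D.tm k < p)) := by
      ext k
      simp only [Finset.mem_filter, Finset.mem_univ, true_and, tm_mirror, neg_lt_neg_iff,
        Finset.mem_sdiff, Finset.mem_insert, not_or, not_lt]
      by_cases hk : k = j
      · subst hk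
        simp [hM.symm.tm_self, hq'p.le]
      · rw [hM.tm_of_ne hk]
        refine ⟨fun h => ⟨?_, hk, h.le⟩, fun h => lt_of_le_of_ne h.2.2 fun h' => h.1 ?_⟩
        · rintro rfl; exact h.ne ha.symm
        · exact D.tm_injective (h'.symm.trans ha.symm)
    rw [rank, h1, Finset.card_sdiff_of_subset (Finset.subset_univ _), Finset.card_univ,
      Fintype.card_fin, Finset.card_insert_of_notMem, Finset.card_insert_of_notMem, ← rank, hpi,
      Fin.val_rev]
    · omega
    · simp [hM.tm_self, hpq.le]
    · simp [haj, ha]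
  · obtain ⟨x, hx⟩ := hpo
    exact ⟨-x, isOverArc_mirror.2 (by simpa using hM.overArc hx)⟩
  · intro t ht h1 h2
    have := hter (-t) (hM.symm.isTerminal (isTerminal_mirror.1 ht) (by linarith)) (by linarith)
      (by linarith)
    linarith
  · intro x hx h1 h2 h3
    obtain ⟨y, hy, h4, h5, h6, h7⟩ := hpart (-x)
      (hM.symm.mem_points (mem_points_mirror.1 hx) (by linarith)) (by linarith) (by linarith)
      (fun h => h3 (by linarith))
    refine ⟨-y, ?_, by linarith, by linarith, ?_, ?_⟩
    · simpa only [isUnderArc_mirror, neg_neg] using hM.underArc hy (by linarith) h5.ne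
    · have := max_neg_neg (-x) y
      rw [neg_neg] at this
      have := min_neg_neg (-x) y
      rw [neg_neg] at this
      linarith
    · have := max_neg_neg (-x) y
      rw [neg_neg] at this
      linarith
  · intro x y z w hxy hzw h1 h2 h3 h4 h5 h6 h7
    simp only [isUnderArc_mirror] at hxy hzw
    have e1 := hM.symm.underArc hxy (show -x ≠ q' by linarith) (show -y ≠ q' by linarith)
    have e2 := hM.symm.underArc hzw (show -z ≠ q' by linarith) (show -w ≠ q' by linarith)
    rcases lt_trichotomy y w with h | h | h
    · have := hnest (-w) (-z) (-y) (-x) e2.symm e1.symm (by linarith) (by linarith) (by linarith)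
        (by linarith) (by linarith) (by linarith) (by linarith)
      linarith
    · subst h
      have := underArc_unique e1.symm e2.symm
      linarith
    · exact h
  · simpa using mirror_curve_update hM.symm.curve_eq_update

end VCD

theorem Represents.equivalent_right {n : ℕ} {β : BraidGroup n} {D E F : VCD n}
    (h : Represents β D E) (h' : VCD.Equivalent E F) : Represents β D F := by
  cases h with
  | equivalent h => exact .equivalent (.trans _ _ _ h h')
  | sigma i h h1 h2 h3 => exact .sigma i h h1 h2 (.trans _ _ _ h3 h')
  | sigma_inv i h h1 h2 h3 => exact .sigma_inv i h h1 h2 (.trans _ _ _ h3 h')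

theorem Represents.trans {n : ℕ} {β γ : BraidGroup n} {D E F : VCD n}
    (h : Represents β D E) (h' : Represents γ E F) : Represents (γ * β) D F := by
  induction h' with
  | equivalent h1 => rw [one_mul]; exact h.equivalent_right h1
  | sigma i _ h1 h2 h3 ih => rw [mul_assoc]; exact .sigma i (ih h) h1 h2 h3
  | sigma_inv i _ h1 h2 h3 ih => rw [mul_assoc]; exact .sigma_inv i (ih h) h1 h2 h3

theorem Represents.mirror {n : ℕ} {β : BraidGroup n} {D E : VCD n} (h : Represents β D E) :
    ∃ β', Represents β' D.mirror E.mirror := by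
  induction h with
  | equivalent h => exact ⟨1, .equivalent h.mirror⟩
  | sigma i _ h1 h2 h3 ih =>
    obtain ⟨β', h⟩ := ih
    exact ⟨_, .sigma_inv i.rev h h1.mirror h2.mirror h3.mirror⟩
  | sigma_inv i _ h1 h2 h3 ih =>
    obtain ⟨β', h⟩ := ih
    exact ⟨_, .sigma i.rev h h1.mirror h2.mirror h3.mirror⟩

/-! ### Removing a terminal over arc by a braid -/

namespace VCD

variable {n : ℕ}

theorem exists_gap_left (D : VCD n) (z : ℚ) : ∃ c < z, ∀ y ∈ D.points, y < z → y < c := by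
  rcases Set.eq_empty_or_nonempty {y | y ∈ D.points ∧ y < z} with h | h
  · refine ⟨z - 1, by linarith, fun y hy hyz => absurd (show y ∈ {y | y ∈ D.points ∧ y < z} from
      ⟨hy, hyz⟩) (by simp [h])⟩
  · obtain ⟨m, ⟨-, hm⟩, hmax⟩ := Set.exists_max_image _ id
      (D.finite_points.subset fun x hx => hx.1) h
    obtain ⟨c, h1, h2⟩ := exists_between hm
    exact ⟨c, h2, fun y hy hyz => (hmax y ⟨hy, hyz⟩).trans_lt h1⟩

theorem exists_gap_right (D : VCD n) (z : ℚ) : ∃ c > z, ∀ y ∈ D.points, z < y → c < y := by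
  obtain ⟨c, hc, h⟩ := D.mirror.exists_gap_left (-z)
  refine ⟨-c, by linarith, fun y hy hyz => ?_⟩
  have := h (-y) (mem_points_mirror.2 (by rwa [neg_neg])) (by linarith)
  linarith

/-- A point that is not terminal lies on an over arc, which is followed by another arc when it
ends at this point. -/
theorem exists_overArc_of_not_isTerminal {D : VCD n} {z : ℚ} (hz : z ∈ D.points)
    (ht : ¬ D.IsTerminal z) : ∃ w j L R, Even L.length ∧
      (D.curve j = L ++ z :: w :: R ∨ D.curve j = L ++ w :: z :: R ∧ R ≠ []) := by
  obtain ⟨j, hj⟩ := hz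
  obtain ⟨A, B, h⟩ := List.append_of_mem hj
  have hB : B ≠ [] := by
    rintro rfl
    exact ht (isTerminal_iff.2 ⟨j, tm_eq h⟩)
  rcases Nat.even_or_odd A.length with hA | hA
  · obtain ⟨w, R, rfl⟩ := List.exists_cons_of_ne_nil hB
    exact ⟨w, j, A, R, hA, Or.inl h⟩
  · rcases List.eq_nil_or_concat A with rfl | ⟨L, w, rfl⟩
    · simp at hA
    · rw [List.concat_eq_append] at h hA
      refine ⟨w, j, L, B, ?_, Or.inr ⟨by simp [h], hB⟩⟩
      simpa [Nat.odd_add_one] using hA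

theorem exists_isOverArc {D : VCD n} {x : ℚ} (hx : x ∈ D.points) (ht : ¬ D.IsTerminal x) :
    ∃ w, D.IsOverArc x w ∨ D.IsOverArc w x := by
  obtain ⟨w, j, L, R, hL, h | ⟨h, -⟩⟩ := exists_overArc_of_not_isTerminal hx ht
  · exact ⟨w, Or.inl (isOverArc_iff.2 ⟨j, L, R, h, hL⟩)⟩
  · exact ⟨w, Or.inr (isOverArc_iff.2 ⟨j, L, R, h, hL⟩)⟩

/-- The puncture `p` at the end of the over arc `(x, p)` on its way back to `x`: so far it has been
pushed to the place `c`, and the strands dragged along are the points between `c` and `r`. -/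
structure Sliding (D : VCD n) (x c p r : ℚ) : Prop where
  overArc : D.IsOverArc x p
  lt : x < c
  nested : D.Nested c p r
  notMem : c ∉ D.points
  partner_lt : ∀ y ∈ D.points, c < y → y < p → ∀ w, (D.IsOverArc y w ∨ D.IsOverArc w y) → w < c
  terminal : ∀ t, D.IsTerminal t → c < t → t < r → t = p
  notMem_overEnds : ∀ t ∈ D.overEnds, x < t → t < c → False

/-- A terminal point on the way of the sliding puncture is passed by a braid generator. -/
theorem Sliding.pass {D : VCD n} {x c p r z : ℚ} (h : D.Sliding x c p r) (hz : z ∈ D.points)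
    (hxz : x < z) (hzc : z < c) (hmax : ∀ y ∈ D.points, y < c → y ≤ z) (ht : D.IsTerminal z) :
    ∃ (E : VCD n) (q : ℚ) (i : Fin (n - 1)), E.SigmaStep i D ∧ E.Sliding x z p q ∧
      E.numPoints = D.numPoints ∧ E.points ∩ Set.Ioo x z ⊂ D.points ∩ Set.Ioo x c ∧
      E.points ∩ Set.Ioo z p = D.points ∩ Set.Ioo c p := by
  have hcp := h.nested.lt_left
  have hpr := h.nested.lt_right
  obtain ⟨j, rfl⟩ := isTerminal_iff.1 ht
  set z := D.tm j with hzdef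
  have hc := D.curve_eq j
  set L := (D.curve j).dropLast
  have hL : Even L.length := by
    by_contra ho
    refine h.notMem_overEnds z ⟨j, rfl, ?_⟩ hxz hzc
    rw [hc, List.length_append]
    simp only [List.length_cons, List.length_nil, Nat.even_add_one, zero_add]
    exact ho
  obtain ⟨M, hMr, hM⟩ := D.exists_gap_left r
  obtain ⟨q, hMq, hqr⟩ := exists_between hMr
  have hpM : p < M := hM p (mem_points_of_overArc (Or.inr h.overArc)) hpr
  have hq : q ∉ D.points := fun hq => absurd (hM q hq hqr) (not_lt.2 hMq.le)
  obtain ⟨E, hE⟩ := exists_move_end hc hL hq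
  have hpq := hpM.trans hMq
  have hm : MoveEnd D E j L z q := .of_update hc hL (by linarith) hE
  have hlow : ∀ y ∈ D.points, z < y → c < y := fun y hy h1 => by
    by_contra h2
    rcases (not_lt.1 h2).lt_or_eq with h3 | rfl
    · exact absurd (hmax y hy h3) (not_le.2 h1)
    · exact h.notMem hy
  have hND : D.Nested z p q := by
    refine ⟨h.nested.mem_overEnds, hzc.trans hcp, hpq, fun v hv h1 h2 h3 => ?_,
      fun x y u w hxy huw h1 h2 h3 h4 h5 h6 h7 => ?_⟩
    · obtain ⟨y, hy, h4, h5, h6⟩ := h.nested.partner v hv (hlow v hv h1) (h2.trans hqr) h3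
      exact ⟨y, hy, hzc.trans h4, (hM y (mem_points_of_underArc hy.symm) h5).trans hMq, h6⟩
    · exact h.nested.nested x y u w hxy huw (hlow _ (mem_points_of_underArc hxy) h1) h2 h3 h4
        (h5.trans hqr) h6 (h7.trans hqr)
  have hNE : E.Nested z p q := hm.nested hND (fun h => lt_irrefl _ h.1) (fun h => lt_irrefl _ h.2)
  have hEpt : ∀ y ∈ E.points, y ≠ q → y ∈ D.points := fun y hy h1 => hm.symm.mem_points hy h1
  have hqE : E.IsTerminal q := isTerminal_iff.2 ⟨j, hm.symm.tm_self⟩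
  have hter : ∀ t, E.IsTerminal t → z < t → t < q → t = p := fun t ht' h1 h2 => by
    have h3 := hm.symm.isTerminal ht' h2.ne
    obtain ⟨k, rfl⟩ := isTerminal_iff.1 h3
    exact h.terminal _ h3 (hlow _ (D.tm_mem_points k) h1) (h2.trans hqr)
  have hpT := isTerminal_of_mem_overEnds hNE.mem_overEnds
  have hrank : E.rank p < n - 1 := by
    have h1 := rank_lt hpT le_rfl hpq
    have h2 := rank_lt_card hqE
    omega
  refine ⟨E, q, ⟨E.rank p, hrank⟩, ?_, ?_, hm.numPoints, ?_, ?_⟩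
  · exact ⟨j, L, p, q, z, hm.curve_right, hL, hNE.lt_left, hpq, hpT, ncard_terminal_lt E p,
      ⟨x, hm.overArc h.overArc⟩, hter, hNE.partner, hNE.nested, hm.symm.curve_eq_update⟩
  · refine ⟨hm.overArc h.overArc, hxz, hNE, hm.symm.notMem, fun y hy h1 h2 w hw => ?_, hter,
      fun t ht h1 h2 => h.notMem_overEnds t (hm.symm.mem_overEnds ht) h1 (h2.trans hzc)⟩
    have hw' := hw.imp hm.symm.overArc hm.symm.overArc
    have hyD := hEpt y hy (by linarith)
    have h3 := h.partner_lt y hyD (hlow y hyD h1) h2 w hw'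
    refine lt_of_le_of_ne (hmax w (mem_points_of_overArc hw'.symm) h3) ?_
    rintro rfl
    exact hm.symm.notMem (mem_points_of_overArc hw.symm)
  · refine ⟨fun y hy => ⟨hEpt y hy.1 ?_, hy.2.1, hy.2.2.trans hzc⟩, fun hs => ?_⟩
    · have := hy.2.2
      intro h
      linarith
    · exact lt_irrefl z (hs ⟨hz, hxz, hzc⟩).2.2
  · ext y
    simp only [Set.mem_inter_iff, Set.mem_Ioo]
    constructor
    · rintro ⟨h1, h2, h3⟩
      have hyD := hEpt y h1 (by linarith)
      exact ⟨hyD, hlow y hyD h2, h3⟩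
    · rintro ⟨h1, h2, h3⟩
      exact ⟨hm.mem_points h1 (by linarith), by linarith, h3⟩

/-- A strand whose over arc leads to the next strand on the way is shortened by a `B`-move. -/
theorem Sliding.shorten {D : VCD n} {x c p r z w : ℚ} (h : D.Sliding x c p r) (hz : z ∈ D.points)
    (hxz : x < z) (hzc : z < c) (hmax : ∀ y ∈ D.points, y < c → y ≤ z) (ht : ¬ D.IsTerminal z)
    {j : Fin n} {L R : List ℚ} (hL : Even L.length)
    (hj : D.curve j = L ++ z :: w :: R ∨ D.curve j = L ++ w :: z :: R ∧ R ≠ [])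
    (hcw : c < w) (hwp : w < p) :
    ∃ (E : VCD n) (y : ℚ), D.BMove E ∧ E.Sliding x c p y ∧
      D.numPoints = E.numPoints + 2 ∧ E.points ∩ Set.Ioo x c ⊂ D.points ∩ Set.Ioo x c ∧
      D.points ∩ Set.Ioo c p = insert w (E.points ∩ Set.Ioo c p) := by
  have hzw : D.IsOverArc z w ∨ D.IsOverArc w z := hj.imp (fun h => isOverArc_iff.2 ⟨j, L, R, h, hL⟩)
    (fun h => isOverArc_iff.2 ⟨j, L, R, h.1, hL⟩)
  have hw : w ∈ D.points := mem_points_of_overArc hzw.symm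
  have hpr := h.nested.lt_right
  have hwT : ¬ D.IsTerminal w := fun hT => by
    have := h.terminal w hT hcw (hwp.trans hpr)
    linarith
  have hlow : ∀ y ∈ D.points, z < y → c < y := fun y hy h1 => by
    by_contra h2
    rcases (not_lt.1 h2).lt_or_eq with h3 | rfl
    · exact absurd (hmax y hy h3) (not_le.2 h1)
    · exact h.notMem hy
  -- a strand between `c` and `w` would have an over arc crossing that from `w` to `z`
  have hmin : ∀ y ∈ D.points, c < y → y < p → w ≤ y := by
    intro y hy h1 h2
    by_contra h3
    rw [not_le] at h3
    have hyT : ¬ D.IsTerminal y := fun hT => by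
      have := h.terminal y hT h1 (h2.trans hpr)
      linarith
    obtain ⟨v, hv⟩ := exists_isOverArc hy hyT
    have h4 := h.partner_lt y hy h1 h2 v hv
    have h5 := unlinked_of_overArc hzw hv (hzc.trans h1).ne' h3.ne
    have h6 : v ≠ z := by
      rintro rfl
      exact h3.ne (overArc_unique hv.symm hzw)
    have h7 : v < z := lt_of_le_of_ne (hmax v (mem_points_of_overArc hv.symm) h4) h6
    unfold Unlinked at h5
    have e1 : z < y := hzc.trans h1
    have e2 : ¬ w < y := not_lt.2 h3.le
    have e3 : ¬ z < v := not_lt.2 h7.le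
    have e4 : ¬ w < v := not_lt.2 (by linarith)
    simp [e1, e2, e3, e4] at h5
  obtain ⟨b, d, hbd, hcur, hR⟩ : ∃ b d, (b = z ∧ d = w ∨ b = w ∧ d = z) ∧
      D.curve j = L ++ b :: d :: R ∧ R ≠ [] := by
    rcases hj with hj | ⟨hj, hR⟩
    · refine ⟨z, w, Or.inl ⟨rfl, rfl⟩, hj, ?_⟩
      rintro rfl
      exact hwT (isTerminal_iff.2 ⟨j, tm_eq (L := L ++ [z]) (by simp [hj])⟩)
    · exact ⟨w, z, Or.inr ⟨rfl, rfl⟩, hj, hR⟩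
  have hadj : D.Adjacent b d := by
    have : min b d = z ∧ max b d = w := by
      have h1 : z < w := hzc.trans hcw
      rcases hbd with ⟨rfl, rfl⟩ | ⟨rfl, rfl⟩
      · exact ⟨min_eq_left h1.le, max_eq_right h1.le⟩
      · exact ⟨min_eq_right h1.le, max_eq_left h1.le⟩
    rintro y hy ⟨h1, h2⟩
    rw [this.1] at h1
    rw [this.2] at h2
    exact absurd (hmin y hy (hlow y hy h1) (h2.trans hwp)) (not_le.2 h2)
  obtain ⟨E, hE⟩ := exists_remove_pair (L := L) (R := R) hcur (by simp [hR])
    (fun h => absurd hL (Nat.not_even_iff_odd.2 h))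
  have hP : PairInsert E D j L R b d :=
    ⟨by rw [hE, Function.update_self], hcur, fun k hk => by rw [hE, Function.update_of_ne hk], hL, hR⟩
  obtain ⟨y, hwy, hpy, hyr, hN⟩ := h.nested.inner hw hcw hwp hmin
  have hmem : ∀ {v}, v ∈ D.points ↔ v ∈ E.points ∨ v = z ∨ v = w := fun {v} => by
    rw [hP.mem_points_iff]
    rcases hbd with ⟨rfl, rfl⟩ | ⟨rfl, rfl⟩
    · rfl
    · rw [or_comm (a := v = b)]
  have hzE : z ∉ E.points := by
    rcases hbd with ⟨rfl, rfl⟩ | ⟨rfl, rfl⟩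
    exacts [hP.notMem.1, hP.notMem.2]
  have hwE : w ∉ E.points := by
    rcases hbd with ⟨rfl, rfl⟩ | ⟨rfl, rfl⟩
    exacts [hP.notMem.2, hP.notMem.1]
  -- the only new under arc has the endpoint `y`
  have hund : ∀ {u v}, (E.IsUnderArc u v ∨ E.IsUnderArc v u) → u ≠ y → v ≠ y →
      D.IsUnderArc u v ∨ D.IsUnderArc v u := by
    have main : ∀ {u v}, E.IsUnderArc u v → u ≠ y → v ≠ y → D.IsUnderArc u v := by
      intro u v huv hu hv
      rcases hP.underArc_or huv with h1 | ⟨h1, h2⟩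
      · exact h1
      · exfalso
        rcases List.eq_nil_or_concat L with rfl | ⟨A, u', rfl⟩
        · simp at h1
        obtain ⟨v', B, rfl⟩ := List.exists_cons_of_ne_nil hR
        rw [List.concat_eq_append] at *
        obtain rfl : u' = u := by simpa using h1
        obtain rfl : v' = v := by simpa using h2
        have hA : Odd A.length := by
          simpa [Nat.even_add_one] using hL
        have a1 : D.IsUnderArc u' b := isUnderArc_iff.2 ⟨j, A, d :: v' :: B, by simp [hcur], hA⟩
        have a2 : D.IsUnderArc d v' := isUnderArc_iff.2 ⟨j, A ++ [u', b], B, by simp [hcur], by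
          simpa [Nat.odd_add] using hA⟩
        rcases hbd with ⟨rfl, rfl⟩ | ⟨rfl, rfl⟩
        · exact hv (underArc_unique (Or.inl a2) hwy)
        · exact hu (underArc_unique (Or.inr a1) hwy)
    intro u v huv hu hv
    exact Or.imp (main · hu hv) (main · hv hu) huv
  have hund' : ∀ {u v}, (D.IsUnderArc u v ∨ D.IsUnderArc v u) → u ≠ z → u ≠ w → v ≠ z → v ≠ w →
      E.IsUnderArc u v ∨ E.IsUnderArc v u := by
    intro u v huv h1 h2 h3 h4
    refine huv.imp (fun h => ?_) (fun h => ?_) <;> rcases hP.underArc_of h with h | h | h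
    any_goals exact h
    all_goals (subst h; rcases hbd with ⟨h5, h6⟩ | ⟨h5, h6⟩) <;> contradiction
  have hlow' : ∀ {v}, v ∈ E.points → c < v → w < v := by
    intro v hv hcv
    rcases lt_or_ge v p with hvp | hvp
    · refine lt_of_le_of_ne (hmin v (hmem.2 (Or.inl hv)) hcv hvp) ?_
      rintro rfl
      exact hwE hv
    · linarith
  have hnE : E.Nested c p y := by
    refine ⟨hP.overEnds_eq ▸ h.nested.mem_overEnds, h.nested.lt_left, hpy, fun v hv h1 h2 h3 => ?_,
      fun u v s t huv hst h1 h2 h3 h4 h5 h6 h7 => ?_⟩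
    · have hvD := hmem.2 (Or.inl hv)
      obtain ⟨u, hu, h4, h5, h6⟩ := hN.partner v hvD (hlow' hv h1) h2 h3
      refine ⟨u, hund' hu (by linarith) (hlow' hv h1).ne' (by linarith) h4.ne', by linarith, h5, h6⟩
    · have hu : u ∈ E.points := mem_points_of_underArc huv
      exact hN.nested u v s t (hund huv (by linarith) h5.ne) (hund hst (by linarith) h7.ne)
        (hlow' hu h1) h2 h3 h4 h5 h6 h7
  refine ⟨E, y, hP.bMove hadj, ⟨?_, h.lt, hnE, fun hc => h.notMem (hmem.2 (Or.inl hc)), ?_, ?_, ?_⟩,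
    hP.numPoints, ?_, ?_⟩
  · rcases hP.overArc_iff.1 h.overArc with h1 | ⟨h1, h2⟩
    · exact h1
    · rcases hbd with ⟨rfl, rfl⟩ | ⟨rfl, rfl⟩ <;> linarith
  · exact fun v hv h1 h2 u hu => h.partner_lt v (hmem.2 (Or.inl hv)) h1 h2 u
      (hu.imp (fun h => hP.overArc_iff.2 (Or.inl h)) (fun h => hP.overArc_iff.2 (Or.inl h)))
  · exact fun t ht h1 h2 => h.terminal t (hP.terminal_iff.2 ht) h1 (h2.trans hyr)
  · exact fun t ht => h.notMem_overEnds t (hP.overEnds_eq ▸ ht)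
  · exact ⟨fun v hv => ⟨hmem.2 (Or.inl hv.1), hv.2⟩, fun hs => hzE (hs ⟨hz, hxz, hzc⟩).1⟩
  · ext v
    simp only [Set.mem_inter_iff, Set.mem_Ioo, Set.mem_insert_iff, hmem]
    constructor
    · rintro ⟨h1 | rfl | rfl, h2, h3⟩
      · exact Or.inr ⟨h1, h2, h3⟩
      · linarith
      · exact Or.inl rfl
    · rintro (rfl | ⟨h1, h2, h3⟩)
      · exact ⟨Or.inr (Or.inr rfl), hcw, hwp⟩
      · exact ⟨Or.inl h1, h2, h3⟩

/-- Any other strand on the way is dragged along, which creates two new points. -/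
theorem Sliding.drag {D : VCD n} {x c p r z w : ℚ} (h : D.Sliding x c p r) (hz : z ∈ D.points)
    (hxz : x < z) (hzc : z < c) (hmax : ∀ y ∈ D.points, y < c → y ≤ z) (ht : ¬ D.IsTerminal z)
    {j : Fin n} {L R : List ℚ} (hL : Even L.length)
    (hj : D.curve j = L ++ z :: w :: R ∨ D.curve j = L ++ w :: z :: R ∧ R ≠ [])
    (hwz : w < z) :
    ∃ (E : VCD n) (c' r' : ℚ), E.BMove D ∧ E.Sliding x c' p r' ∧
      E.numPoints = D.numPoints + 2 ∧ E.points ∩ Set.Ioo x c' ⊂ D.points ∩ Set.Ioo x c ∧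
      z ∉ D.points ∩ Set.Ioo c p ∧ E.points ∩ Set.Ioo c' p = insert z (D.points ∩ Set.Ioo c p) := by
  have hzw : D.IsOverArc z w ∨ D.IsOverArc w z := hj.imp (fun h => isOverArc_iff.2 ⟨j, L, R, h, hL⟩)
    (fun h => isOverArc_iff.2 ⟨j, L, R, h.1, hL⟩)
  have hcp := h.nested.lt_left
  have hpr := h.nested.lt_right
  have hlow : ∀ y ∈ D.points, z < y → c < y := fun y hy h1 => by
    by_contra h2
    rcases (not_lt.1 h2).lt_or_eq with h3 | rfl
    · exact absurd (hmax y hy h3) (not_le.2 h1)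
    · exact h.notMem hy
  obtain ⟨M, hMr, hM⟩ := D.exists_gap_left r
  obtain ⟨s, hMs, hsr⟩ := exists_between hMr
  obtain ⟨s', hss', hs'r⟩ := exists_between hsr
  have hpM : p < M := hM p (mem_points_of_overArc (Or.inr h.overArc)) hpr
  have hs : s ∉ D.points := fun h => absurd (hM s h hsr) (not_lt.2 hMs.le)
  have hs' : s' ∉ D.points := fun h => absurd (hM s' h hs'r) (not_lt.2 (hMs.trans hss').le)
  have hsep : ∀ v ∈ D.points, s < v ↔ s' < v := fun v hv =>
    ⟨fun h1 => by
      by_contra h2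
      have := hM v hv (by linarith)
      linarith, fun h1 => hss'.trans h1⟩
  obtain ⟨c', hc'z, hc'⟩ := D.exists_gap_left z
  -- the pair is inserted next to `z` on the side away from `w`
  obtain ⟨E, L', R', b, d, hP, hbd, hjun, hzs⟩ : ∃ (E : VCD n) (L' R' : List ℚ) (b d : ℚ),
      PairInsert D E j L' R' b d ∧ (b = s ∧ d = s' ∨ b = s' ∧ d = s) ∧
      (L'.getLast? = some z ∧ b = s ∨ R'.head? = some z ∧ d = s) ∧
      (E.IsUnderArc z s ∨ E.IsUnderArc s z) := by
    rcases hj with hj | ⟨hj, hR⟩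
    · obtain ⟨E, hE⟩ := exists_insert_pair hj hL hs' hs hss'.ne' fun v hv => (hsep v hv).symm
      have hEj : E.curve j = L ++ s' :: s :: z :: w :: R := by rw [hE, Function.update_self]
      refine ⟨E, L, z :: w :: R, s', s, ⟨hj, hEj, fun k hk => by rw [hE, Function.update_of_ne hk],
        hL, by simp⟩, Or.inr ⟨rfl, rfl⟩, Or.inr ⟨rfl, rfl⟩, Or.inr (isUnderArc_iff.2
        ⟨j, L ++ [s'], w :: R, by simp [hEj], by simpa [Nat.odd_add_one] using hL⟩)⟩
    · have hj' : D.curve j = (L ++ [w, z]) ++ R := by simp [hj]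
      obtain ⟨E, hE⟩ := exists_insert_pair hj' (by simpa [Nat.even_add] using hL) hs hs' hss'.ne
        fun v hv => hsep v hv
      have hEj : E.curve j = (L ++ [w, z]) ++ s :: s' :: R := by rw [hE, Function.update_self]
      refine ⟨E, L ++ [w, z], R, s, s', ⟨hj', hEj, fun k hk => by rw [hE, Function.update_of_ne hk],
        by simpa [Nat.even_add] using hL, hR⟩, Or.inl ⟨rfl, rfl⟩, Or.inl ⟨by simp, rfl⟩,
        Or.inl (isUnderArc_iff.2
        ⟨j, L ++ [w], s' :: R, by simp [hEj], by simpa [Nat.odd_add_one] using hL⟩)⟩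
  have hmem : ∀ {v}, v ∈ E.points ↔ v ∈ D.points ∨ v = s ∨ v = s' := fun {v} => by
    rw [hP.mem_points_iff]
    rcases hbd with ⟨rfl, rfl⟩ | ⟨rfl, rfl⟩
    · rfl
    · rw [or_comm (a := v = b)]
  have hadj : E.Adjacent b d := by
    have : min b d = s ∧ max b d = s' := by
      rcases hbd with ⟨rfl, rfl⟩ | ⟨rfl, rfl⟩
      · exact ⟨min_eq_left hss'.le, max_eq_right hss'.le⟩
      · exact ⟨min_eq_right hss'.le, max_eq_left hss'.le⟩
    rintro y hy ⟨h1, h2⟩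
    rw [this.1] at h1
    rw [this.2] at h2
    rcases hmem.1 hy with h3 | rfl | rfl
    · exact absurd ((hsep y h3).1 h1) (not_lt.2 h2.le)
    · exact lt_irrefl _ h1
    · exact lt_irrefl _ h2
  have hund : ∀ {u v}, (D.IsUnderArc u v ∨ D.IsUnderArc v u) → u ≠ z → v ≠ z →
      E.IsUnderArc u v ∨ E.IsUnderArc v u := by
    intro u v huv hu hv
    refine huv.imp (fun h => ?_) (fun h => ?_) <;> rcases hP.underArc_or h with h | ⟨h1, h2⟩
    any_goals exact h
    all_goals
      exfalso
      rcases hjun with ⟨h3, -⟩ | ⟨h3, -⟩ <;> simp_all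
  have hund' : ∀ {u v}, (E.IsUnderArc u v ∨ E.IsUnderArc v u) → u ≠ s → u ≠ s' → v ≠ s → v ≠ s' →
      D.IsUnderArc u v ∨ D.IsUnderArc v u := by
    intro u v huv h1 h2 h3 h4
    refine huv.imp (fun h => ?_) (fun h => ?_) <;> rcases hP.underArc_of h with h | h | h
    any_goals exact h
    all_goals (subst h; rcases hbd with ⟨h5, h6⟩ | ⟨h5, h6⟩) <;> contradiction
  have hover : ∀ {u v}, (E.IsOverArc u v ∨ E.IsOverArc v u) → u ≠ s → u ≠ s' →
      D.IsOverArc u v ∨ D.IsOverArc v u := by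
    intro u v huv h1 h2
    refine huv.imp (fun h => ?_) (fun h => ?_) <;> rcases hP.overArc_iff.1 h with h | ⟨h3, h4⟩
    any_goals exact h
    all_goals (rcases hbd with ⟨h5, h6⟩ | ⟨h5, h6⟩) <;> subst h3 <;> subst h4 <;> contradiction
  -- the points in the new interval
  have hin : ∀ {v}, v ∈ E.points → c' < v → v < s' → v = z ∨ v = s ∨ v ∈ D.points ∧ c < v ∧ v < r ∧
      z < v ∧ v < s := by
    intro v hv h1 h2
    rcases hmem.1 hv with h3 | rfl | rfl
    · rcases lt_trichotomy v z with h4 | h4 | h4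
      · exact absurd (hc' v h3 h4) (not_lt.2 h1.le)
      · exact Or.inl h4
      · have := hM v h3 (by linarith)
        exact Or.inr (Or.inr ⟨h3, hlow v h3 h4, by linarith, h4, by linarith⟩)
    · exact Or.inr (Or.inl rfl)
    · exact absurd h2 (lt_irrefl _)
  have hnE : E.Nested c' p s' := by
    refine ⟨hP.overEnds_eq ▸ h.nested.mem_overEnds, by linarith, by linarith,
      fun v hv h1 h2 h3 => ?_, fun u v a b' huv hab h1 h2 h3 h4 h5 h6 h7 => ?_⟩
    · have hz1 : min z s = z := min_eq_left (by linarith)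
      have hz2 : max z s = s := max_eq_right (by linarith)
      rcases hin hv h1 h2 with rfl | rfl | ⟨h4, h5, h6, h7, h8⟩
      · exact ⟨s, hzs, by linarith, hss', by rw [hz1]; linarith, by rw [hz2]; linarith⟩
      · exact ⟨z, hzs.symm, hc'z, by linarith, by rw [min_comm, hz1]; linarith,
          by rw [max_comm, hz2]; linarith⟩
      · obtain ⟨u, hu, h9, h10, h11⟩ := h.nested.partner v h4 h5 h6 h3
        have := hM u (mem_points_of_underArc hu.symm) h10
        exact ⟨u, hund hu h7.ne' (by linarith), by linarith, by linarith, h11⟩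
    · have hu := hin (mem_points_of_underArc huv) h1 (by linarith)
      have hv := hin (mem_points_of_underArc huv.symm) (by linarith) h5
      have ha := hin (mem_points_of_underArc hab) (by linarith) (by linarith)
      have hb := hin (mem_points_of_underArc hab.symm) (by linarith) h7
      have hzu : z ≤ u := by
        rcases hu with h | h | h
        · exact h.ge
        · linarith
        · exact h.2.2.2.1.le
      have hbs : b' ≤ s := by
        rcases hb with h | h | h
        · linarith
        · exact h.le
        · exact h.2.2.2.2.le
      have haz : a ≠ z := by linarith
      have hbs' : b' ≠ s := by
        rintro rfl
        exact haz (underArc_unique hab.symm hzs.symm)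
      have hbs'' : b' < s := lt_of_le_of_ne hbs hbs'
      rcases hzu.lt_or_eq with h8 | rfl
      · have hvs : v ≠ s := by
          rintro rfl
          exact h8.ne' (underArc_unique huv.symm hzs.symm)
        have hD1 := hund' huv (by linarith) (by linarith) hvs h5.ne
        have hD2 := hund' hab (by linarith) (by linarith) hbs' h7.ne
        exact h.nested.nested u v a b' hD1 hD2 (hlow u (mem_points_of_underArc hD1) h8) h2 h3 h4
          (by linarith) h6 (by linarith)
      · rwa [underArc_unique huv hzs]
  refine ⟨E, c', s', hP.bMove hadj, ⟨hP.overArc_iff.2 (Or.inl h.overArc),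
    hc' x (mem_points_of_overArc (Or.inl h.overArc)) hxz, hnE, ?_, ?_, ?_, ?_⟩, hP.numPoints, ?_,
    fun h1 => by linarith [h1.2.1], ?_⟩
  · intro h1
    rcases hmem.1 h1 with h1 | h1 | h1
    · exact lt_irrefl _ (hc' c' h1 hc'z)
    · linarith
    · linarith
  · intro v hv h1 h2 u hu
    have hu' := hover hu (by linarith) (by linarith)
    rcases hin hv h1 (by linarith) with rfl | rfl | ⟨h3, h4, h5, h6, h7⟩
    · rw [overArc_unique hu' hzw]
      exact hc' w (mem_points_of_overArc hzw.symm) hwz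
    · linarith
    · have h8 := hmax u (mem_points_of_overArc hu'.symm) (h.partner_lt v h3 h4 h2 u hu')
      refine hc' u (mem_points_of_overArc hu'.symm) (lt_of_le_of_ne h8 ?_)
      rintro rfl
      have := overArc_unique hu'.symm hzw
      linarith
  · intro t ht' h1 h2
    have htD := hP.terminal_iff.1 ht'
    obtain ⟨k, rfl⟩ := isTerminal_iff.1 ht'
    rcases hin (E.tm_mem_points k) h1 h2 with h3 | h3 | ⟨h3, h4, h5, h6, h7⟩
    · exact absurd (h3 ▸ htD) ht
    · obtain ⟨k', hk'⟩ := isTerminal_iff.1 htD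
      exact absurd (h3 ▸ hk' ▸ D.tm_mem_points k') hs
    · exact h.terminal _ htD h4 h5
  · exact fun t ht h1 h2 => h.notMem_overEnds t (hP.overEnds_eq ▸ ht) h1 (by linarith)
  · refine ⟨fun v hv => ⟨?_, hv.2.1, by linarith [hv.2.2]⟩, fun h1 => ?_⟩
    · rcases hmem.1 hv.1 with h1 | h1 | h1
      · exact h1
      · linarith [hv.2.2]
      · linarith [hv.2.2]
    · linarith [(h1 ⟨hz, hxz, hzc⟩).2.2]
  · ext v
    simp only [Set.mem_inter_iff, Set.mem_Ioo, Set.mem_insert_iff]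
    constructor
    · rintro ⟨h1, h2, h3⟩
      rcases hin h1 h2 (by linarith) with h4 | h4 | h4
      · exact Or.inl h4
      · linarith
      · exact Or.inr ⟨h4.1, h4.2.1, h3⟩
    · rintro (rfl | ⟨h1, h2, h3⟩)
      · exact ⟨hmem.2 (Or.inl hz), hc'z, by linarith⟩
      · exact ⟨hmem.2 (Or.inl h1), by linarith, h3⟩

/-- The sliding puncture can be pushed back to the start of its over arc, which then disappears.
Every strand dragged along at present saves two points. -/
theorem Sliding.exists_represents {D : VCD n} {x c p r : ℚ} (h : D.Sliding x c p r) :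
    ∃ γ E, Represents γ D E ∧
      E.numPoints + 2 * (D.points ∩ Set.Ioo c p).ncard < D.numPoints := by
  induction hm : (D.points ∩ Set.Ioo x c).ncard using Nat.strong_induction_on
    generalizing D c r with
  | _ m ih =>
  have hcp := h.nested.lt_left
  have hpr := h.nested.lt_right
  have hfin : ∀ (F : VCD n) (s : Set ℚ), (F.points ∩ s).Finite := fun F s =>
    F.finite_points.subset Set.inter_subset_left
  have hxO : ∀ {y w}, (D.IsOverArc y w ∨ D.IsOverArc w y) → x < y → y < p → x < w ∧ w < p := by
    intro y w hyw h1 h2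
    have h3 := unlinked_of_overArc (Or.inl h.overArc) hyw h1.ne' h2.ne
    have hwx : w ≠ x := by
      rintro rfl
      exact h2.ne (overArc_unique hyw.symm (Or.inl h.overArc))
    have hwp : w ≠ p := by
      rintro rfl
      exact h1.ne' (overArc_unique hyw.symm (Or.inr h.overArc))
    unfold Unlinked at h3
    have h4 := h.lt
    simp only [h1, not_lt.2 h2.le, iff_false, not_true_eq_false, false_iff] at h3
    rcases lt_or_gt_of_ne hwx with h5 | h5
    · exact absurd ⟨fun h6 => absurd h5 (not_lt.2 h6.le), fun h6 => by linarith⟩ h3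
    · refine ⟨h5, lt_of_le_of_ne (not_lt.1 fun h6 => h3 ⟨fun _ => h6, fun _ => h5⟩) hwp⟩
  by_cases hne : (D.points ∩ Set.Ioo x c).Nonempty
  · obtain ⟨z, ⟨hz, hxz, hzc⟩, hmax'⟩ := Set.exists_max_image _ id (hfin D _) hne
    have hmax : ∀ y ∈ D.points, y < c → y ≤ z := by
      intro y hy hyc
      by_contra h1
      exact h1 (hmax' y ⟨hy, hxz.trans (not_le.1 h1), hyc⟩)
    by_cases ht : D.IsTerminal z
    · obtain ⟨E, q, i, h1, h2, h3, h4, h5⟩ := h.pass hz hxz hzc hmax ht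
      obtain ⟨γ, F, h6, h7⟩ := ih _ (hm ▸ Set.ncard_lt_ncard h4 (hfin _ _)) h2 rfl
      refine ⟨_, F, Represents.trans (Represents.sigma_inv i (.equivalent (.refl D)) (.refl D) h1
        (.refl E)) h6, ?_⟩
      rwa [← h3, ← h5]
    · obtain ⟨w, j, L, R, hL, hj⟩ := exists_overArc_of_not_isTerminal hz ht
      have hzw : D.IsOverArc z w ∨ D.IsOverArc w z := hj.imp
        (fun h => isOverArc_iff.2 ⟨j, L, R, h, hL⟩) (fun h => isOverArc_iff.2 ⟨j, L, R, h.1, hL⟩)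
      obtain ⟨hxw, hwp⟩ := hxO hzw hxz (hzc.trans hcp)
      have hw := mem_points_of_overArc hzw.symm
      rcases lt_or_ge w c with hwc | hwc
      · have hwz : w < z := lt_of_le_of_ne (hmax w hw hwc) fun h => by
          subst h
          rcases hzw with h | h <;> exact h.ne rfl
        obtain ⟨E, c', r', h1, h2, h3, h4, h5, h6⟩ := h.drag hz hxz hzc hmax ht hL hj hwz
        obtain ⟨γ, F, h7, h8⟩ := ih _ (hm ▸ Set.ncard_lt_ncard h4 (hfin _ _)) h2 rfl
        refine ⟨_, F, Represents.trans (.equivalent (.symm _ _ (.rel _ _ (Or.inr (Or.inr h1))))) h7,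
          ?_⟩
        rw [h6, Set.ncard_insert_of_notMem h5 (hfin _ _)] at h8
        omega
      · have hcw : c < w := lt_of_le_of_ne hwc fun h' => h.notMem (h' ▸ hw)
        obtain ⟨E, y, h1, h2, h3, h4, h5⟩ := h.shorten hz hxz hzc hmax ht hL hj hcw hwp
        obtain ⟨γ, F, h6, h7⟩ := ih _ (hm ▸ Set.ncard_lt_ncard h4 (hfin _ _)) h2 rfl
        refine ⟨_, F, Represents.trans (.equivalent (.rel _ _ (Or.inr (Or.inr h1)))) h6, ?_⟩
        have := Set.ncard_insert_le w (E.points ∩ Set.Ioo c p)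
        rw [h5]
        omega
  · have hemp : ∀ y ∈ D.points, ¬ (x < y ∧ y < c) := fun y hy h1 => hne ⟨y, hy, h1⟩
    have hemp' : ∀ y ∈ D.points, ¬ (x < y ∧ y < p) := by
      rintro y hy ⟨h1, h2⟩
      rcases lt_or_ge y c with h3 | h3
      · exact hemp y hy ⟨h1, h3⟩
      have h3 : c < y := lt_of_le_of_ne h3 fun h' => h.notMem (h' ▸ hy)
      obtain ⟨w, hw⟩ := exists_isOverArc hy fun hT =>
        h2.ne (h.terminal y hT h3 (h2.trans hpr))
      exact hemp w (mem_points_of_overArc hw.symm) ⟨(hxO hw h1 h2).1, h.partner_lt y hy h3 h2 w hw⟩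
    have h0 : D.points ∩ Set.Ioo c p = ∅ := Set.eq_empty_of_forall_notMem fun y hy =>
      hemp' y hy.1 ⟨h.lt.trans hy.2.1, hy.2.2⟩
    obtain ⟨j, L, R, hj, hL⟩ := isOverArc_iff.1 h.overArc
    have hR : R = [] := by
      have h1 := tm_of_mem (isTerminal_of_mem_overEnds h.nested.mem_overEnds)
        (show p ∈ D.curve j by simp [hj])
      have h2 := D.curve_eq j
      rw [h1] at h2
      exact (split_unique (show D.curve j = (L ++ [x]) ++ p :: R by simp [hj]) h2).2.2
    subst hR
    obtain ⟨E, hE⟩ := exists_drop_end hj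
    have hT : D.TMove E := by
      refine ⟨j, L, x, p, hj, fun y hy hxy => ?_, hE⟩
      rw [min_eq_left (h.lt.trans hcp).le, max_eq_right (h.lt.trans hcp).le] at hxy
      exact hemp' y hy hxy
    refine ⟨1, E, .equivalent (.rel _ _ (Or.inr (Or.inl hT))), ?_⟩
    rw [h0, Set.ncard_empty]
    simpa using numPoints_of_tMove hT

/-- An innermost terminal over arc that runs from left to right. -/
theorem exists_represents_of_overArc_right {D : VCD n} {x p : ℚ} (ho : D.IsOverArc x p)
    (hp : p ∈ D.overEnds) (hxp : x < p) (hin : ∀ t ∈ D.overEnds, x < t → t < p → False) :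
    ∃ γ E, Represents γ D E ∧ E.numPoints < D.numPoints := by
  obtain ⟨c, hcp, hc⟩ := D.exists_gap_left p
  obtain ⟨r, hpr, hr⟩ := D.exists_gap_right p
  have hone : ∀ y ∈ D.points, c < y → y < r → y = p := by
    intro y hy h1 h2
    rcases lt_trichotomy y p with h | h | h
    · exact absurd (hc y hy h) (not_lt.2 h1.le)
    · exact h
    · exact absurd (hr y hy h) (not_lt.2 h2.le)
  have hS : D.Sliding x c p r := by
    refine ⟨ho, hc x (mem_points_of_overArc (Or.inl ho)) hxp, ⟨hp, hcp, hpr, ?_, ?_⟩, ?_, ?_, ?_, ?_⟩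
    · exact fun v hv h1 h2 h3 => absurd (hone v hv h1 h2) h3
    · intro u v s t huv _ h1 h2 h3 _ _ _ _
      have := hone u (mem_points_of_underArc huv) h1 (by linarith)
      linarith
    · exact fun h => lt_irrefl _ (hc c h hcp)
    · intro y hy h1 h2
      exact absurd (hone y hy h1 (h2.trans hpr)) h2.ne
    · rintro t ht h1 h2
      obtain ⟨k, rfl⟩ := isTerminal_iff.1 ht
      exact hone _ (D.tm_mem_points k) h1 h2
    · exact fun t ht h1 h2 => hin t ht h1 (h2.trans hcp)
  obtain ⟨γ, E, h1, h2⟩ := hS.exists_represents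
  exact ⟨γ, E, h1, by omega⟩

/-- A terminal over arc allows to reduce the number of points by the action of a braid. -/
theorem exists_represents_numPoints_lt {D : VCD n} (h : D.HasTerminalOverArc) :
    ∃ γ E, Represents γ D E ∧ E.numPoints < D.numPoints := by
  -- an innermost terminal over arc
  obtain ⟨x, p, hp, ho, hin⟩ : ∃ x p, p ∈ D.overEnds ∧ D.IsOverArc x p ∧
      ∀ t ∈ D.overEnds, ¬ (min x p < t ∧ t < max x p) := by
    let s : Set (ℚ × ℚ) := {z | z.2 ∈ D.overEnds ∧ D.IsOverArc z.1 z.2}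
    have hs : s.Finite := (D.finite_points.prod D.finite_points).subset fun z hz =>
      ⟨mem_points_of_overArc (Or.inl hz.2), mem_points_of_overArc (Or.inr hz.2)⟩
    have hne : s.Nonempty := by
      obtain ⟨x, t, h1, h2⟩ := h
      exact ⟨(x, t), mem_overEnds_iff_isOverArc.2 ⟨h2, x, h1⟩, h1⟩
    obtain ⟨⟨x, p⟩, ⟨h1, h2⟩, hmin⟩ := Set.exists_min_image s (fun z => max z.1 z.2 - min z.1 z.2)
      hs hne
    refine ⟨x, p, h1, h2, fun t ht hxt => ?_⟩
    obtain ⟨-, w, hw⟩ := mem_overEnds_iff_isOverArc.1 ht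
    have h3 := hmin (w, t) ⟨ht, hw⟩
    have htx : t ≠ x := by
      rintro rfl
      rcases le_total t p with h | h <;> simp [h] at hxt
    have htp : t ≠ p := by
      rintro rfl
      rcases le_total x t with h | h <;> simp [h] at hxt
    have hwx : w ≠ x := by
      rintro rfl
      exact htp (overArc_unique (Or.inl hw) (Or.inl h2))
    have hwp : w ≠ p := by
      rintro rfl
      exact htx (overArc_unique (Or.inl hw) (Or.inr h2))
    have h4 := unlinked_of_overArc (Or.inl h2) (Or.inr hw) htx htp
    unfold Unlinked at h4
    dsimp only at h3
    rcases le_total x p with h | h <;> rcases le_total w t with h' | h' <;>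
      simp only [h, h', min_eq_left, max_eq_right, min_eq_right, max_eq_left] at h3 hxt <;> grind
  rcases lt_or_gt_of_ne ho.ne with h1 | h1
  · rw [min_eq_left h1.le, max_eq_right h1.le] at hin
    exact exists_represents_of_overArc_right ho hp h1 fun t ht h2 h3 => hin t ht ⟨h2, h3⟩
  · rw [min_eq_right h1.le, max_eq_left h1.le] at hin
    obtain ⟨γ, E, h2, h3⟩ := exists_represents_of_overArc_right (D := D.mirror) (x := -x) (p := -p)
      (isOverArc_mirror.2 (by simpa)) (mem_overEnds_mirror.2 (by simpa)) (neg_lt_neg h1)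
      fun t ht h2 h3 => hin (-t) (mem_overEnds_mirror.1 ht) ⟨by linarith, by linarith⟩
    obtain ⟨γ', h4⟩ := h2.mirror
    rw [mirror_mirror] at h4
    exact ⟨γ', E.mirror, h4, by rwa [numPoints_mirror, ← D.numPoints_mirror]⟩

end VCD

/-! ### Simplified diagrams -/

namespace VCD

variable {n : ℕ}

theorem rank_ne_of_between {D : VCD n} {x y t : ℚ} (ht : D.IsTerminal t) (h1 : min x y < t)
    (h2 : t < max x y) : D.rank x ≠ D.rank y := by
  rcases le_total x y with h | h
  · rw [min_eq_left h] at h1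
    rw [max_eq_right h] at h2
    exact (rank_lt ht h1.le h2).ne
  · rw [min_eq_right h] at h1
    rw [max_eq_left h] at h2
    exact (rank_lt ht h1.le h2).ne'

theorem IsSimplified.not_adjacent {D : VCD n} (hD : D.IsSimplified) {j : Fin n} {L R : List ℚ}
    {x y : ℚ} (hj : D.curve j = L ++ x :: y :: R) : ¬ D.Adjacent x y := by
  intro ha
  rcases R with _ | ⟨z, R⟩
  · obtain ⟨E, hE⟩ := exists_drop_end hj
    exact hD.not_tMove ⟨j, L, x, y, hj, ha, hE⟩
  · obtain ⟨E, hE⟩ := exists_remove_pair hj (by simp) fun _ => ha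
    exact hD.not_bMove ⟨j, L, z :: R, x, y, hj, by simp, ha, hE⟩

/-- In a simplified diagram every over arc passes over a terminal point: an innermost over arc
without this property would have adjacent ends. -/
theorem IsSimplified.exists_terminal {D : VCD n} (hD : D.IsSimplified) {x y : ℚ}
    (h : D.IsOverArc x y) : ∃ t, D.IsTerminal t ∧ min x y < t ∧ t < max x y := by
  by_contra hno
  let s : Set (ℚ × ℚ) := {z | D.IsOverArc z.1 z.2 ∧
    ¬ ∃ t, D.IsTerminal t ∧ min z.1 z.2 < t ∧ t < max z.1 z.2}
  have hs : s.Finite := (D.finite_points.prod D.finite_points).subset fun z hz =>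
    ⟨mem_points_of_overArc (Or.inl hz.1), mem_points_of_overArc (Or.inr hz.1)⟩
  obtain ⟨⟨x, y⟩, ⟨h1, h2⟩, hmin⟩ := Set.exists_min_image s (fun z => max z.1 z.2 - min z.1 z.2)
    hs ⟨(x, y), h, hno⟩
  dsimp only at h1 h2 hmin
  obtain ⟨j, L, R, hj, -⟩ := isOverArc_iff.1 h1
  refine hD.not_adjacent hj fun z hz hxy => ?_
  have hzT : ¬ D.IsTerminal z := fun ht => h2 ⟨z, ht, hxy⟩
  obtain ⟨w, hw⟩ := exists_isOverArc hz hzT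
  have hzx : z ≠ x := by
    rintro rfl
    rcases le_total z y with h | h <;> simp [h] at hxy
  have hzy : z ≠ y := by
    rintro rfl
    rcases le_total x z with h | h <;> simp [h] at hxy
  have hwx : w ≠ x := by
    rintro rfl
    exact hzy (overArc_unique hw.symm (Or.inl h1))
  have hwy : w ≠ y := by
    rintro rfl
    exact hzx (overArc_unique hw.symm (Or.inr h1))
  have h4 := unlinked_of_overArc (Or.inl h1) hw hzx hzy
  -- the over arc through `z` lies inside the given one
  have hbd : min x y < w ∧ w < max x y := by
    unfold Unlinked at h4
    rcases le_total x y with h | h <;>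
      simp only [h, min_eq_left, max_eq_right, min_eq_right, max_eq_left] at hxy ⊢ <;> grind
  have hin : min x y < min z w ∧ max z w < max x y :=
    ⟨lt_min hxy.1 hbd.1, max_lt hxy.2 hbd.2⟩
  have hno' : ¬ ∃ t, D.IsTerminal t ∧ min z w < t ∧ t < max z w := by
    rintro ⟨t, ht, h5, h6⟩
    exact h2 ⟨t, ht, hin.1.trans h5, h6.trans hin.2⟩
  rcases hw with hw | hw
  · have := hmin (z, w) ⟨hw, hno'⟩
    dsimp only at this
    linarith [hin.1, hin.2]
  · have := hmin (w, z) ⟨hw, by rwa [min_comm, max_comm]⟩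
    dsimp only at this
    rw [min_comm w, max_comm w] at this
    linarith [hin.1, hin.2]

theorem overEnds_eq_empty {D : VCD n} (h : ¬ D.HasTerminalOverArc) : D.overEnds = ∅ := by
  rw [hasTerminalOverArc_iff] at h
  ext t
  simp only [overEnds, Set.mem_ofPred_eq, Set.mem_empty_iff_false, iff_false]
  rintro ⟨j, -, hj⟩
  exact h ⟨j, hj⟩

theorem conf_of_not_hasTerminalOverArc {D : VCD n} (h : ¬ D.HasTerminalOverArc) (j : Fin n) :
    D.conf j = lab D.letter true 1 (D.curve j) := by
  rw [conf, config, overEnds_eq_empty h]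
  simp [keep]

/-- The configuration of a simplified diagram without terminal over arcs is irreducible, whatever
the labels. -/
theorem IsSimplified.not_del {D : VCD n} {G : Type*} (hD : D.IsSimplified)
    (h : ¬ D.HasTerminalOverArc) (φ : FreeGroup ℕ → G) (C : Config n G) :
    ¬ (D.conf.act φ).Del C := by
  rintro ⟨j, L, R, b, c, u, hj, ha, -⟩
  have e : (D.conf.act φ j).map Prod.fst = D.curve j := by
    rw [Config.act, Config.map_fst_act, conf_of_not_hasTerminalOverArc h, map_fst_lab]
  rw [hj] at e
  refine hD.not_adjacent (j := j) (L := L.map Prod.fst) (x := b) (y := c) (R := R.map Prod.fst)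
    (by simp [← e]) fun z hz => ?_
  refine ha z ?_
  rw [Config.pts_act, conf, mem_pts_config, overEnds_eq_empty h]
  exact ⟨hz, by simp⟩

theorem IsSimplified.not_del_conf {D : VCD n} (hD : D.IsSimplified) (h : ¬ D.HasTerminalOverArc)
    (C : Config n (FreeGroup ℕ)) : ¬ D.conf.Del C := by
  have := hD.not_del h id C
  rwa [Config.act_id] at this

theorem even_length_dropLast {D : VCD n} (h : ¬ D.HasTerminalOverArc) (j : Fin n) :
    Even (D.curve j).dropLast.length := by
  rw [hasTerminalOverArc_iff, not_exists] at h
  have h1 := h j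
  rw [D.curve_eq j, List.length_append] at h1
  simpa [Nat.even_add_one] using h1

theorem conf_eq_append {D : VCD n} (h : ¬ D.HasTerminalOverArc) (j : Fin n) :
    D.conf j = lab D.letter true 1 (D.curve j).dropLast ++
      [(D.tm j, hol D.letter true 1 (D.curve j).dropLast)] := by
  rw [conf_of_not_hasTerminalOverArc h]
  conv_lhs => rw [D.curve_eq j]
  rw [lab_append, side_of_even (even_length_dropLast h j)]
  rfl

theorem exists_rank_tm (D : VCD n) {m : ℕ} (hm : m < n) : ∃ j, D.rank (D.tm j) = m := by
  have hinj : Function.Injective fun j => (⟨D.rank (D.tm j), rank_lt_card (isTerminal_iff.2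
      ⟨j, rfl⟩)⟩ : Fin n) := by
    intro j k hjk
    simp only [Fin.mk.injEq] at hjk
    apply D.tm_injective
    rcases lt_trichotomy (D.tm j) (D.tm k) with h | h | h
    · exact absurd hjk (rank_lt (isTerminal_iff.2 ⟨j, rfl⟩) le_rfl h).ne
    · exact h
    · exact absurd hjk (rank_lt (isTerminal_iff.2 ⟨k, rfl⟩) le_rfl h).ne'
  obtain ⟨j, hj⟩ := Finite.surjective_of_injective hinj ⟨m, hm⟩
  exact ⟨j, congrArg Fin.val hj⟩

open FreeGroup (of)
open BraidGroup

/-- The uniqueness of the braid: its Artin automorphism fixes the free group, since the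
configuration, being irreducible on both sides, determines the position and the label of each
puncture. -/
theorem eq_one_of_represents {D E : VCD n} {β : BraidGroup n} (h : Represents β D E)
    (hD : D.IsSimplified) (hE : E.IsSimplified) (hD' : ¬ D.HasTerminalOverArc)
    (hE' : ¬ E.HasTerminalOverArc) : β = 1 := by
  obtain ⟨h1, h2⟩ := represents_conf h
  obtain ⟨G, rfl, f, hf, hfE⟩ := Config.Eqv.exists_reposition_of_irreducible
    (Config.Simple.act _ (simple_config _ _)) h1 (hE.not_del_conf hE')
    (P := fun G => G = D.conf.act (artin n β)) rfl fun G H hG hGH =>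
      absurd (hG ▸ hGH) (hD.not_del hD' _ _)
  have hlast : ∀ j, E.tm j = f (D.tm j) ∧ hol E.letter true 1 (E.curve j).dropLast =
      artin n β (hol D.letter true 1 (D.curve j).dropLast) := by
    intro j
    have := hfE j
    rw [conf_eq_append hE', Config.act, conf_eq_append hD', List.map_append, List.map_append] at this
    have := List.append_inj_right' this (by simp)
    simpa using this
  have hrank : ∀ j, E.rank (E.tm j) = D.rank (D.tm j) := by
    intro j
    have hpt : ∀ k, D.tm k ∈ (D.conf.act (artin n β)).pts := fun k => by
      rw [Config.pts_act, conf, mem_pts_config, overEnds_eq_empty hD']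
      exact ⟨D.tm_mem_points k, by simp⟩
    simp only [rank, (hlast _).1, hf.lt_iff_lt (hpt _) (hpt j)]
  apply eq_one_of_fixes
  intro m hm
  obtain ⟨j, rfl⟩ := D.exists_rank_tm hm
  have h3 := h2 j
  rw [loop, loop, (hlast j).2, hrank, side_of_even (even_length_dropLast hE' j),
    side_of_even (even_length_dropLast hD' j), map_mul, map_mul, map_inv, mul_left_inj, mul_right_inj] at h3
  exact h3.symm

/-! ### Reduced words along simplified diagrams -/

/-- The word of the letters along a list of points, with alternating exponents. -/
def altWord (r : ℚ → ℕ) : Bool → List ℚ → List (ℕ × Bool)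
  | _, [] => []
  | s, x :: l => (r x, !s) :: altWord r (!s) l

theorem hol_eq_altWord (r : ℚ → ℕ) (s : Bool) (g : FreeGroup ℕ) (l : List ℚ) :
    hol (fun x => of (r x)) s g l = g * FreeGroup.mk (altWord r s l) := by
  induction l generalizing s g with
  | nil => simp [hol, altWord, ← FreeGroup.one_eq_mk]
  | cons x l ih =>
    cases s
    · rw [hol, ih, mul_assoc]; rfl
    · rw [hol, ih, mul_assoc]; rfl

theorem isChain_altWord {r : ℚ → ℕ} {l : List ℚ} (h : l.IsChain fun x y => r x ≠ r y) (s : Bool) :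
    (altWord r s l).IsChain fun a b => a.1 ≠ b.1 := by
  induction l generalizing s with
  | nil => simp [altWord]
  | cons x l ih =>
    rcases l with _ | ⟨y, l⟩
    · simp [altWord]
    · rw [List.isChain_cons_cons] at h
      have := ih h.2 (!s)
      simp only [altWord, List.isChain_cons_cons] at this ⊢
      exact ⟨h.1, this⟩

theorem reduce_of_isChain {W : List (ℕ × Bool)} (h : W.IsChain fun a b => a.1 ≠ b.1) :
    FreeGroup.reduce W = W :=
  FreeGroup.IsReduced.reduce_eq (h.imp fun _ _ h1 h2 => absurd h2 h1)

/-- The sets of points that can be removed from the configuration of a simplified diagram: besides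
the ends of terminal over arcs, they contain pairs of ends of under arcs around such an end. -/
structure Removable (D : VCD n) (R : Set ℚ) : Prop where
  subset : D.overEnds ⊆ R
  partner : ∀ b ∈ R, b ∉ D.overEnds → ∃ c ∈ R, (D.IsUnderArc b c ∨ D.IsUnderArc c b) ∧
    (∃ t ∈ D.overEnds, min b c < t ∧ t < max b c) ∧
    ∀ z ∈ D.points, min b c < z → z < max b c → z ∈ R

theorem Removable.mem_of_underArc {D : VCD n} {R : Set ℚ} (hR : D.Removable R) {x y : ℚ}
    (h : D.IsUnderArc x y ∨ D.IsUnderArc y x) (hx : x ∈ R) : y ∈ R := by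
  obtain ⟨c, hc, hxc, -⟩ := hR.partner x hx (notMem_overEnds_of_underArc h)
  rwa [underArc_unique h hxc]

/-- Consecutive points of a curve have different letters, if they are joined by an over arc or by an
under arc between removed points. -/
theorem IsSimplified.rank_ne {D : VCD n} (hD : D.IsSimplified) {R : Set ℚ} (hR : D.Removable R)
    {j : Fin n} {A B : List ℚ} {x y : ℚ} (hj : D.curve j = A ++ x :: y :: B)
    (hx : Odd A.length → x ∈ R) : D.rank x ≠ D.rank y := by
  rcases Nat.even_or_odd A.length with hA | hA
  · obtain ⟨t, ht, h1, h2⟩ := hD.exists_terminal (isOverArc_iff.2 ⟨j, A, B, hj, hA⟩)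
    exact rank_ne_of_between ht h1 h2
  · have hu : D.IsUnderArc x y := isUnderArc_iff.2 ⟨j, A, B, hj, hA⟩
    obtain ⟨c, -, hc, ⟨t, ht, h1, h2⟩, -⟩ := hR.partner x (hx hA)
      (notMem_overEnds_of_underArc (Or.inl hu))
    rw [← underArc_unique (Or.inl hu) hc] at h1 h2
    exact rank_ne_of_between (isTerminal_of_mem_overEnds ht) h1 h2

theorem IsSimplified.isChain_rank {D : VCD n} (hD : D.IsSimplified) {R : Set ℚ}
    (hR : D.Removable R) {j : Fin n} {L S N : List ℚ} (hj : D.curve j = L ++ S ++ N)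
    (hL : Even L.length) (hS : ∀ A x y B, S = A ++ x :: y :: B → A ≠ [] → x ∈ R) :
    S.IsChain fun x y => D.rank x ≠ D.rank y := by
  rw [List.isChain_iff_forall_rel_of_append_cons_cons]
  intro x y A B h
  refine hD.rank_ne hR (j := j) (A := L ++ A) (B := B ++ N) (by simp [hj, h]) fun ho =>
    hS A x y B h ?_
  rintro rfl
  rw [List.append_nil] at ho
  exact Nat.not_even_iff_odd.2 ho hL

/-- The label of a point, expressed by the holonomy of the part of the curve before it. -/
theorem label_eq {G : Type*} [Group G] {e : ℚ → G} {X Y : List (ℚ × G)} {l : List ℚ} {b : ℚ} {u : G}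
    (h : lab e true 1 l = X ++ (b, u) :: Y) :
    u = if Even X.length then hol e true 1 (X.map Prod.fst)
      else hol e true 1 (X.map Prod.fst ++ [b]) := by
  have h1 := congrArg (List.map Prod.fst) h
  rw [map_fst_lab, List.map_append, List.map_cons] at h1
  rw [h1, lab_append] at h
  have h2 := List.append_inj_right h (by
    rw [← List.length_map Prod.fst, map_fst_lab, List.length_map])
  split_ifs with hX
  · rw [side_of_even (by simpa using hX)] at h2
    simpa [lab] using (congrArg List.head? h2).symm
  · have hs : side true (X.map Prod.fst) = false :=
      side_of_odd (by simpa using Nat.not_even_iff_odd.1 hX)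
    rw [hs] at h2
    rw [hol_append, hs]
    simpa [lab, hol] using (congrArg List.head? h2).symm

theorem mem_fst_of_filter_eq_nil {G : Type*} {R : Set ℚ} {l : List (ℚ × G)}
    (h : l.filter (fun z => keep R z.1) = []) : ∀ x ∈ l.map Prod.fst, x ∈ R := by
  intro x hx
  obtain ⟨z, hz, rfl⟩ := List.mem_map.1 hx
  by_contra h1
  have := List.filter_eq_nil_iff.1 h z hz
  exact this (keep_of_notMem h1)

theorem exists_of_config_eq {D : VCD n} {R : Set ℚ} {j : Fin n} {X Y : List (ℚ × FreeGroup ℕ)}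
    {b : ℚ} {u : FreeGroup ℕ} (h : D.config R j = X ++ (b, u) :: Y) :
    ∃ X' Y', lab D.letter true 1 (D.curve j) = X' ++ (b, u) :: Y' ∧
      Y'.filter (fun z => keep R z.1) = Y ∧ b ∉ R := by
  rw [config, List.filter_eq_append_iff] at h
  obtain ⟨A, B, h1, -, h2⟩ := h
  rw [List.filter_eq_cons_iff] at h2
  obtain ⟨A', Y', rfl, -, h3, h4⟩ := h2
  exact ⟨A ++ A', Y', by simp [h1], h4, keep_eq_true.1 h3⟩

/-- Reductions of the configuration of a simplified diagram remove pairs of ends of under arcs only.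
Two points that are separated on their curve by removed points, or joined by an over arc, have
holonomies that differ by a reduced word, because neighbouring letters of it have different
indices. -/
theorem IsSimplified.removable_of_del {D : VCD n} (hD : D.IsSimplified) {R : Set ℚ}
    (hR : D.Removable R) {C : Config n (FreeGroup ℕ)} (h : (D.config R).Del C) :
    ∃ R', D.Removable R' ∧ C = D.config R' := by
  obtain ⟨j, L', T', b, c, u, hj, ha, rfl⟩ := h
  obtain ⟨X, Y, hXY, hY, hb⟩ := exists_of_config_eq hj
  rw [List.filter_eq_cons_iff] at hY
  obtain ⟨M', N', rfl, hM, hc, -⟩ := hY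
  have hc : c ∉ R := keep_eq_true.1 hc
  have hM : ∀ x ∈ M'.map Prod.fst, x ∈ R := by
    refine mem_fst_of_filter_eq_nil (List.filter_eq_nil_iff.2 hM)
  have hcur := congrArg (List.map Prod.fst) hXY
  rw [map_fst_lab] at hcur
  simp only [List.map_append, List.map_cons] at hcur
  have hu1 := label_eq hXY
  have hu2 := label_eq (X := X ++ (b, u) :: M') (b := c) (u := u) (Y := N')
    (hXY.trans (by simp))
  set L := X.map Prod.fst with hLdef
  set M := M'.map Prod.fst with hMdef
  set N := N'.map Prod.fst
  have hXL : X.length = L.length := by simp [hLdef]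
  have hMM : M'.length = M.length := by simp [hMdef]
  have hbc : b ≠ c := by
    rintro rfl
    have := D.nodup_curve j
    rw [hcur, List.nodup_append, List.nodup_cons] at this
    exact this.2.1.1 (by simp)
  have hptb : b ∈ D.points := ⟨j, by simp [hcur]⟩
  have hptc : c ∈ D.points := ⟨j, by simp [hcur]⟩
  rcases Nat.even_or_odd L.length with hL | hL
  · exfalso
    have hMe : Even M.length := by
      by_contra hMo
      rw [Nat.not_even_iff_odd] at hMo
      rcases List.eq_nil_or_concat M with h | ⟨M₁, m, h⟩
      · rw [h] at hMo; simp at hMo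
      · rw [List.concat_eq_append] at h
        rw [h] at hcur hM
        have : D.IsUnderArc m c := isUnderArc_iff.2 ⟨j, L ++ b :: M₁, N, by simp [hcur], by
          rw [h] at hMo
          simp only [List.length_append, List.length_cons, List.length_nil] at hMo ⊢
          rw [Nat.odd_add]
          rw [zero_add] at hMo
          exact ⟨fun ho => absurd hL (Nat.not_even_iff_odd.2 ho), fun he =>
            absurd hMo (Nat.not_odd_iff_even.2 he)⟩⟩
        exact hc (hR.mem_of_underArc (Or.inl this) (hM m (by simp)))
    have hchain := hD.isChain_rank hR (j := j) (L := L) (S := b :: M ++ [c]) (N := N)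
      (by simp [hcur]) hL (by
        intro A x y B h hA
        obtain ⟨a, A, rfl⟩ := List.exists_cons_of_ne_nil hA
        have h : M ++ [c] = A ++ x :: y :: B := by simpa using (List.cons.inj h).2
        refine hM x ?_
        have : M = (A ++ x :: y :: B).dropLast := by rw [← h]; simp
        rw [this, List.dropLast_append_of_ne_nil (by simp)]
        simp)
    rw [if_pos (hXL ▸ hL)] at hu1
    rw [if_neg (by
      simp only [List.length_append, List.length_cons, hXL, hMM]
      rw [← add_assoc, Nat.even_add_one, not_not]
      exact hL.add hMe)] at hu2
    have e1 : hol D.letter true 1 (L ++ (b :: M ++ [c])) =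
        hol D.letter true 1 L * FreeGroup.mk (altWord D.rank true (b :: M ++ [c])) := by
      rw [hol_append, side_of_even hL]
      exact hol_eq_altWord _ _ _ _
    have e2 : (X ++ (b, u) :: M').map Prod.fst ++ [c] = L ++ (b :: M ++ [c]) := by
      simp [hLdef, hMdef]
    rw [e2, e1, ← hu1] at hu2
    have e3 : FreeGroup.mk (altWord D.rank true (b :: M ++ [c])) = 1 := by
      simpa using hu2
    have e4 := congrArg FreeGroup.toWord e3
    rw [FreeGroup.toWord_mk, reduce_of_isChain (isChain_altWord hchain true),
      FreeGroup.toWord_one] at e4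
    simp [altWord] at e4
  · have hM0 : M = [] := by
      by_contra hne
      obtain ⟨m, M₁, hm⟩ := List.exists_cons_of_ne_nil hne
      rw [hm] at hcur hM
      have : D.IsUnderArc b m := isUnderArc_iff.2 ⟨j, L, M₁ ++ c :: N, by simp [hcur], hL⟩
      exact hb (hR.mem_of_underArc (Or.inr this) (hM m (by simp)))
    rw [hM0, List.nil_append] at hcur
    have hu : D.IsUnderArc b c := isUnderArc_iff.2 ⟨j, L, N, hcur, hL⟩
    have hbet : ∀ z ∈ D.points, min b c < z → z < max b c → z ∈ R := by
      intro z hz h1 h2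
      by_contra h3
      exact ha z (mem_pts_config.2 ⟨hz, h3⟩) ⟨h1, h2⟩
    have hmin : min b c ∉ R := by
      rcases min_choice b c with h | h <;> rwa [h]
    have hmax : max b c ∉ R := by
      rcases max_choice b c with h | h <;> rwa [h]
    have hptmin : min b c ∈ D.points := by
      rcases min_choice b c with h | h <;> rwa [h]
    have hptmax : max b c ∈ D.points := by
      rcases max_choice b c with h | h <;> rwa [h]
    -- the partner of a removed point between `b` and `c` also lies between them, since `b` and `c`
    -- have not been removed yet
    have hover : ∃ t ∈ D.overEnds, min b c < t ∧ t < max b c := by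
      have := hD.not_adjacent hcur
      unfold Adjacent at this
      push Not at this
      obtain ⟨z, hz, h1, h2⟩ := this
      by_cases hzO : z ∈ D.overEnds
      · exact ⟨z, hzO, h1, h2⟩
      · obtain ⟨z', hz', -, ⟨t, ht, h3, h4⟩, h5⟩ := hR.partner z (hbet z hz h1 h2) hzO
        refine ⟨t, ht, ?_, ?_⟩
        · by_contra h6
          exact hmin (h5 _ hptmin (h3.trans_le (not_lt.1 h6))
            (h1.trans_le (le_max_left _ _)))
        · by_contra h6
          exact hmax (h5 _ hptmax ((min_le_left _ _).trans_lt h2) ((not_lt.1 h6).trans_lt h4))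
    refine ⟨R ∪ {b, c}, ⟨hR.subset.trans Set.subset_union_left, ?_⟩, ?_⟩
    · rintro x (hx | rfl | rfl) hxO
      · obtain ⟨y, hy, h1, h2, h3⟩ := hR.partner x hx hxO
        exact ⟨y, Or.inl hy, h1, h2, fun z hz h4 h5 => Or.inl (h3 z hz h4 h5)⟩
      · exact ⟨c, by simp, Or.inl hu, hover, fun z hz h4 h5 => Or.inl (hbet z hz h4 h5)⟩
      · refine ⟨b, by simp, Or.inr hu, ?_, fun z hz h4 h5 => Or.inl ?_⟩
        · simpa only [min_comm, max_comm] using hover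
        · exact hbet z hz (by rwa [min_comm]) (by rwa [max_comm])
    · have hkeep : ∀ k, D.config (R ∪ {b, c}) k =
          (D.config R k).filter fun z => keep {b, c} z.1 := by
        intro k
        rw [config, config, List.filter_filter]
        apply List.filter_congr
        intro z _
        by_cases h1 : z.1 ∈ R
        · rw [keep_of_mem h1, keep_of_mem (Or.inl h1), Bool.and_false]
        · by_cases h2 : z.1 ∈ ({b, c} : Set ℚ)
          · rw [keep_of_mem h2, keep_of_mem (Or.inr h2), Bool.false_and]
          · rw [keep_of_notMem h1, keep_of_notMem h2, keep_of_notMem (fun h => h.elim h1 h2),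
              Bool.and_true]
      have hsim := simple_config D R
      have hall : ∀ l : List (ℚ × FreeGroup ℕ), b ∉ l.map Prod.fst → c ∉ l.map Prod.fst →
          l.filter (fun z => keep {b, c} z.1) = l := by
        intro l h1 h2
        rw [List.filter_eq_self]
        intro z hz
        refine keep_of_notMem ?_
        have h3 : z.1 ∈ l.map Prod.fst := List.mem_map.2 ⟨z, hz, rfl⟩
        rintro (h4 | h4)
        · exact h1 (h4 ▸ h3)
        · exact h2 (h4 ▸ h3)
      funext k
      rw [hkeep]
      by_cases hk : k = j
      · subst hk
        have hnd := hsim.1 k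
        rw [hj] at hnd ⊢
        simp only [List.map_append, List.map_cons, List.nodup_append, List.nodup_cons,
          List.mem_cons, not_or] at hnd
        obtain ⟨-, ⟨⟨-, h1⟩, h2, -⟩, h3⟩ := hnd
        rw [Function.update_self, List.filter_append, List.filter_cons_of_neg, List.filter_cons_of_neg,
          hall _ (fun h => h3 b h b (Or.inl rfl) rfl)
            (fun h => h3 c h c (Or.inr (Or.inl rfl)) rfl), hall _ h1 h2]
        · simp [keep]
        · simp [keep]
      · rw [Function.update_of_ne hk, hall]
        · refine hsim.2 j k (Ne.symm hk) b (by simp [hj])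
        · refine hsim.2 j k (Ne.symm hk) c (by simp [hj])

/-- A simplified diagram with the invariants of one without terminal over arcs has no terminal over
arcs either: the loop around the end of a terminal over arc, based at the last point that survives
in the reduced configuration, is not a product of two letters. -/
theorem not_hasTerminalOverArc {D E : VCD n} (hD : D.IsSimplified) (hE : E.IsSimplified)
    (hE' : ¬ E.HasTerminalOverArc) (h : SameInv D E) : ¬ D.HasTerminalOverArc := by
  obtain ⟨G, ⟨R, hR, rfl⟩, f, hf, hfE⟩ := h.1.exists_reposition_of_irreducible (simple_config _ _)
    (hE.not_del_conf hE') (P := fun G => ∃ R, D.Removable R ∧ G = D.config R)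
    ⟨D.overEnds, ⟨subset_rfl, fun b hb hb' => absurd hb hb'⟩, rfl⟩
    (by
      rintro _ H ⟨R, hR, rfl⟩ hH
      exact hD.removable_of_del hR hH)
  rw [hasTerminalOverArc_iff]
  rintro ⟨j, hj⟩
  have h1 := hfE j
  rw [conf_eq_append hE'] at h1
  obtain ⟨X, Y, hXY, -, hY⟩ := List.append_eq_map_iff.1 h1
  obtain ⟨⟨z, u⟩, rfl, hzu⟩ : ∃ z, Y = [z] ∧
      Prod.map f id z = (E.tm j, hol E.letter true 1 (E.curve j).dropLast) := by
    obtain ⟨z, Y', rfl, hz, hY'⟩ := List.map_eq_cons_iff.1 hY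
    exact ⟨z, by simpa using hY', hz⟩
  have hu : u = hol E.letter true 1 (E.curve j).dropLast := (Prod.mk.inj hzu).2
  obtain ⟨X', Y', hlab, hY', hz⟩ := exists_of_config_eq hXY
  have hlabel := label_eq hlab
  have hcur := congrArg (List.map Prod.fst) hlab
  rw [map_fst_lab] at hcur
  simp only [List.map_append, List.map_cons] at hcur
  have hT := mem_fst_of_filter_eq_nil hY'
  have hXL : X'.length = (X'.map Prod.fst).length := by simp
  rw [hXL] at hlabel
  generalize X'.map Prod.fst = L at hcur hlabel hXL
  generalize Y'.map Prod.fst = N at hcur hT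
  have hpR : D.tm j ∈ R := hR.subset ⟨j, rfl, hj⟩
  have hN : N ≠ [] := by
    rintro rfl
    rw [← tm_eq hcur] at hz
    exact hz hpR
  have hlen : (D.curve j).length = L.length + (N.length + 1) := by simp [hcur]
  rcases Nat.even_or_odd L.length with hL | hL
  · obtain ⟨T, p, rfl⟩ : ∃ T p, N = T ++ [p] := ⟨_, _, (List.dropLast_append_getLast hN).symm⟩
    have hTe : Even T.length := by
      rw [hlen] at hj
      simp only [List.length_append, List.length_cons, List.length_nil] at hj
      rw [show L.length + (T.length + (0 + 1) + 1) = L.length + T.length + 2 by omega,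
        Nat.even_add (n := 2), iff_true_right even_two, Nat.even_add] at hj
      exact hj.1 hL
    have hcur' : D.curve j = (L ++ z :: T) ++ [p] := by simp [hcur]
    have hp := tm_eq hcur'
    have hloop := h.2 j
    rw [loop_eq hcur', loop, side_of_even (even_length_dropLast hE' j), ← hu, hol_append, side_of_even hL,
      show D.letter = fun x => of (D.rank x) from rfl, hol_eq_altWord,
      show (fun x => of (D.rank x)) = D.letter from rfl] at hloop
    rw [if_pos hL] at hlabel
    rw [← hlabel, side_of_odd (by
      rw [List.length_append, List.length_cons]
      exact hL.add_odd hTe.add_one)] at hloop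
    set W := altWord D.rank true (z :: T) with hW
    set k := D.rank p
    set k' := E.rank (E.tm j)
    -- the loops agree if and only if the following two words represent the same element
    have heq : FreeGroup.mk (W ++ [(k + 1, true), (k, false)]) =
        FreeGroup.mk ([(k', false), (k' + 1, true)] ++ W) := by
      rw [← FreeGroup.mul_mk, ← FreeGroup.mul_mk]
      have e1 : FreeGroup.mk [(k + 1, true), (k, false)] = loopElt false k := rfl
      have e2 : FreeGroup.mk [(k', false), (k' + 1, true)] = loopElt true k' := rfl
      rw [e1, e2]
      have e3 : loopElt true k' = u⁻¹ * (u * FreeGroup.mk W * loopElt false k *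
          (u * FreeGroup.mk W)⁻¹) * u := by
        rw [hloop]; group
      rw [e3]; group
    obtain ⟨S, m, hS⟩ : ∃ S m, z :: T = S ++ [m] :=
      ⟨_, _, (List.dropLast_append_getLast (by simp)).symm⟩
    have hSe : Even S.length := by
      have := congrArg List.length hS
      simp only [List.length_cons, List.length_append, List.length_nil] at this
      rw [show S.length = T.length by omega]
      exact hTe
    have hlast : ∃ V s, W = V ++ [(D.rank m, s)] := by
      have : ∀ (s : Bool) (S : List ℚ), ∃ V s', altWord D.rank s (S ++ [m]) =
          V ++ [(D.rank m, s')] := by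
        intro s S
        induction S generalizing s with
        | nil => exact ⟨[], _, rfl⟩
        | cons x S ih =>
          obtain ⟨V, s', h⟩ := ih (!s)
          exact ⟨(D.rank x, !s) :: V, s', by simp [altWord, h]⟩
      rw [hW, hS]
      exact this true S
    have hmp : D.IsOverArc m p := isOverArc_iff.2 ⟨j, L ++ S, [], by
      rw [hcur', hS]; simp, by rw [List.length_append]; exact hL.add hSe⟩
    obtain ⟨t, ht, h3, h4⟩ := hD.exists_terminal hmp
    have hpT : D.IsTerminal p := isTerminal_iff.2 ⟨j, hp⟩
    have hmk : D.rank m ≠ k ∧ D.rank m ≠ k + 1 := by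
      rcases lt_or_gt_of_ne hmp.ne with h5 | h5
      · rw [min_eq_left h5.le] at h3
        rw [max_eq_right h5.le] at h4
        have := rank_lt ht h3.le h4
        omega
      · rw [min_eq_right h5.le] at h3
        rw [max_eq_left h5.le] at h4
        have h6 := rank_lt hpT le_rfl h3
        have h7 := rank_lt ht le_rfl h4
        omega
    obtain ⟨V, s, hV⟩ := hlast
    have hchain : W.IsChain fun a b => a.1 ≠ b.1 := by
      refine isChain_altWord (hD.isChain_rank hR (j := j) (L := L) (S := z :: T) (N := [p])
        (by simp [hcur]) hL ?_) true
      intro A x y B h hA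
      obtain ⟨a, A, rfl⟩ := List.exists_cons_of_ne_nil hA
      have h := (List.cons.inj h).2
      exact hT x (by simp [h])
    have hchain' : (W ++ [(k + 1, true), (k, false)]).IsChain fun a b => a.1 ≠ b.1 := by
      rw [List.isChain_append]
      refine ⟨hchain, by simp, ?_⟩
      intro a ha b hb
      rw [hV] at ha
      simp only [List.getLast?_append, List.getLast?_singleton, Option.some_or, Option.mem_def,
        Option.some.injEq, List.head?_cons] at ha hb
      rw [← ha, ← hb]
      exact hmk.2
    have hred := congrArg FreeGroup.toWord heq
    rw [FreeGroup.toWord_mk, FreeGroup.toWord_mk, reduce_of_isChain hchain'] at hred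
    -- the reduction of the right hand word does not shorten it, so both words agree
    have hsub := FreeGroup.Red.sublist
      (FreeGroup.reduce.red (L := [(k', false), (k' + 1, true)] ++ W))
    rw [← hred] at hsub
    have hww := hsub.eq_of_length (by simp)
    have hends : (W ++ [(k + 1, true)]) ++ [(k, false)] =
        ([(k', false), (k' + 1, true)] ++ V) ++ [(D.rank m, s)] := by
      rw [List.append_assoc, List.append_assoc, ← hV]
      exact hww
    have := List.append_inj_right' hends rfl
    simp only [List.cons.injEq, Prod.mk.injEq] at this
    exact hmk.1 this.1.1.symm
  · obtain ⟨t, T, rfl⟩ := List.exists_cons_of_ne_nil hN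
    have hu : D.IsUnderArc z t := isUnderArc_iff.2 ⟨j, L, T, hcur, hL⟩
    exact hz (hR.mem_of_underArc (Or.inr hu) (hT t (by simp)))

end VCD

/-! ### The braid of a diagram -/

/-- The relation given by the action can be read backwards. -/
theorem Represents.symm {n : ℕ} {β : BraidGroup n} {D E : VCD n} (h : Represents β D E) :
    Represents β⁻¹ E D := by
  induction h with
  | equivalent h => rw [inv_one]; exact .equivalent (.symm _ _ h)
  | sigma i _ h1 h2 h3 ih =>
    rw [mul_inv_rev]
    refine Represents.trans ?_ ih
    rw [← mul_one (BraidGroup.sigma i)⁻¹]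
    exact .sigma_inv i (.equivalent (.symm _ _ h3)) (.refl _) h2 (.symm _ _ h1)
  | sigma_inv i _ h1 h2 h3 ih =>
    rw [mul_inv_rev, inv_inv]
    refine Represents.trans ?_ ih
    rw [← mul_one (BraidGroup.sigma i)]
    exact .sigma i (.equivalent (.symm _ _ h3)) (.refl _) h2 (.symm _ _ h1)

theorem proposition3p1 (n : ℕ) (D : VCD n) (hD : D.IsSimplified) :
    ∃ β : BraidGroup n,
      (∃ E, Represents β⁻¹ D E ∧ E.IsSimplified) ∧
      (∀ E, Represents β⁻¹ D E → E.IsSimplified → ¬ E.HasTerminalOverArc) ∧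
      (∀ γ : BraidGroup n,
        (∃ E, Represents γ⁻¹ D E ∧ E.IsSimplified ∧ ¬ E.HasTerminalOverArc) → γ = β) := by
  -- a diagram with the least number of points in the whole orbit of `D`
  let P : ℕ → Prop := fun m => ∃ γ E, Represents γ D E ∧ E.numPoints = m
  have hP : ∃ m, P m := ⟨_, 1, D, .equivalent (.refl _), rfl⟩
  classical
  obtain ⟨β, E, hE, hm⟩ := Nat.find_spec hP
  have hmin : ∀ γ F, Represents γ E F → E.numPoints ≤ F.numPoints := fun γ F hF => by
    rw [hm]
    exact Nat.find_min' hP ⟨_, F, hE.trans hF, rfl⟩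
  have hES : E.IsSimplified := fun F hF => hmin 1 F (.equivalent hF)
  have hET : ¬ E.HasTerminalOverArc := fun h => by
    obtain ⟨γ, F, h1, h2⟩ := VCD.exists_represents_numPoints_lt h
    exact absurd (hmin γ F h1) (not_le.2 h2)
  refine ⟨β⁻¹, ⟨E, by rwa [inv_inv], hES⟩, fun F hF hFS => ?_, ?_⟩
  · rw [inv_inv] at hF
    have h1 := VCD.represents_conf (hE.symm.trans hF)
    rw [mul_inv_cancel, map_one] at h1
    refine VCD.not_hasTerminalOverArc hFS hES hET ⟨?_, h1.2⟩
    have := h1.1.symm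
    rwa [MulAut.coe_one, Config.act_id] at this
  · rintro γ ⟨F, hF, hFS, hFT⟩
    have h1 := VCD.eq_one_of_represents (hE.symm.trans hF) hES hFS hET hFT
    rw [mul_inv_eq_one] at h1
    rw [← h1, inv_inv]
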